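/- **Definitions.** For real $P_1\ge 2$ and $D_1\ge 1$ let $\mathcal D^{+}$ (resp. $\mathcal D^{-}$) be the set of all $d=p_1\cdots p_l$ with primes $p_1>\dots>p_l$, $l\ge 0$, such that $p_1\cdots p_h\,p_h^{200}<D_1$ for every odd (resp. every even) $h\le l$. Put $\lambda^{\pm}(d)=\mu(d)\mathbf 1_{d\mid\prod_{5\le p<P_1}p}\,\mathbf 1_{d\in\mathcal D^{\pm}}$. The normalised lower and upper bound beta-sieve pre-sieves with sifting range $P_1$ and level $D_1$ are $$\omega(n)=\mathbf 1_{(n,6)=1}\prod_{p<P_1}\Bigl(1-\frac1p\Bigr)^{-1}\sum_{d\mid n}\lambda^{-}(d),\qquad \Omega(n)=\mathbf 1_{(n,6)=1}\prod_{p<P_1}\Bigl(1-\frac1p\Bigr)^{-1}\sum_{d\mid n}\lambda^{+}(d).$$ For natural numbers $m$ let $$\mathfrak S(m)=\mathbf 1_{m\equiv 4\,(6)}\frac{27}{2}\prod_{p\ge5}\Bigl(1-\frac{6p^2-4p+1}{(p-1)^4}\Bigr)\prod_{\substack{p\ge5\\ p\mid m(m+4)}}\Bigl(1+\frac1{p-4}\Bigr)\prod_{\substack{p\ge5\\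 p\mid m+2}}\Bigl(1+\frac2{p-4}\Bigr).$$ **Proposition.** Let $\chi$ be a primitive quadratic Dirichlet character modulo $r\ge 3$. There exist functions $\sigma_1,\sigma_2\colon\mathbb N\to\mathbb C$, depending only on $\chi$, with $|\sigma_1|,|\sigma_2|\le 1$, such that for all real $P_1\ge 2$ and $D_1>P_1^{202}$, all choices of $f_1,f_2,f_3,f_4\in\{\omega,\Omega\}$ (with these parameters), all natural numbers $m$ and all real $1\le X\le m$, we have $$\begin{aligned}&\sum_{n\le X}\mathbf 1_{\chi(n)=\chi(m-n)=-1}\,\mathbf 1_{(n+2,r)=(m-n+2,r)=1}\,f_1(n)f_2(n+2)f_3(m-n)f_4(m-n+2)\\&=X\,\mathfrak S(m)\Bigl(\frac{1+\sigma_1(m)}4+O_\epsilon(r^{-1+\epsilon})\Bigr)\Bigl(1+O\Bigl(e^{-\frac{\log D_1}{10\log P_1}}+\frac{\log m}{P_1}\Bigr)\Bigr)+O\bigl(rD_1^4(\log P_1)^4\bigr)\end{aligned}$$ and $$\begin{aligned}&\sum_{n\le X}\mathbf 1_{\chi(n)=\chi(n+2)=1}\,\mathbf 1_{\chi(m-n)=-1}\,\mathbf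 1_{(m-n+2,r)=1}\,f_1(n)f_2(n+2)f_3(m-n)f_4(m-n+2)\\&=X\,\mathfrak S(m)\Bigl(\frac{1-\sigma_1(m)-\sigma_2(m)}8+O_\epsilon(r^{-1/2+\epsilon})\Bigr)\Bigl(1+O\Bigl(e^{-\frac{\log D_1}{10\log P_1}}+\frac{\log m}{P_1}\Bigr)\Bigr)+O\bigl(rD_1^4(\log P_1)^4\bigr)\end{aligned}$$ for every $\epsilon>0$. Here $n$ runs over positive integers, the constants implied by $O$ are absolute, and those implied by $O_\epsilon$ depend only on $\epsilon$. -/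

import Mathlib

/-- `S` is the index set of the even or of the odd positions. The set of moduli
`d = p₁ p₂ ⋯ p_l` with primes `p₁ > p₂ > ⋯ > p_l` such that
`p₁ ⋯ p_h * p_h ^ β < D` for every position `h ∈ S`.
For a prime `p = p_h` dividing `d`, the primes `p₁, …, p_h` are the prime factors `q ≥ p` of `d`,
so `h` is the number of these and `p₁ ⋯ p_h` is their product. -/
def betaSieveSet (S : Set ℕ) (β : ℕ) (D : ℝ) : Set ℕ :=
  {d | ∀ p ∈ d.primeFactors, (d.primeFactors.filter (fun q => p ≤ q)).card ∈ S →
    ((∏ q ∈ d.primeFactors.filter (fun q => p ≤ q), q : ℕ) : ℝ) * (p : ℝ) ^ β < D}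

/-- The primes `p` with `a ≤ p < P`. -/
noncomputable def primesBetween (a : ℕ) (P : ℝ) : Finset ℕ :=
  (Finset.range ⌈P⌉₊).filter (fun p => p.Prime ∧ a ≤ p)

lemma mem_primesBetween {a : ℕ} {P : ℝ} {p : ℕ} :
    p ∈ primesBetween a P ↔ p.Prime ∧ a ≤ p ∧ (p : ℝ) < P := by
  simp only [primesBetween, Finset.mem_filter, Finset.mem_range, Nat.lt_ceil]
  tauto

open Classical in
/-- The beta sieve pre-sieve with sieve weights `λ(d) = μ(d) 1_{d ∣ ∏_{5 ≤ p < P} p} 1_{d ∈ 𝒟}`: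
`n ↦ 1_{(n,6)=1} ∏_{p < P} (1 - 1/p)⁻¹ ∑_{d ∣ n} λ(d)`. -/
noncomputable def preSieve (𝒟 : Set ℕ) (P : ℝ) (n : ℕ) : ℝ :=
  if Nat.Coprime n 6 then
    (∏ p ∈ primesBetween 2 P, (1 - 1 / (p : ℝ))⁻¹) *
      ∑ d ∈ (∏ p ∈ primesBetween 5 P, p).divisors with d ∣ n ∧ d ∈ 𝒟,
        (ArithmeticFunction.moebius d : ℝ)
  else 0

/-- The normalised lower bound pre-sieve `ω`: the lower bound beta sieve, `β = 200`, of level `D`,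
sifting the primes `5 ≤ p < P`, with the primes `2` and `3` sifted directly. -/
noncomputable def lowerPreSieve (P D : ℝ) : ℕ → ℝ :=
  preSieve (betaSieveSet {h | Even h} 200 D) P

/-- The normalised upper bound pre-sieve `Ω`. -/
noncomputable def upperPreSieve (P D : ℝ) : ℕ → ℝ :=
  preSieve (betaSieveSet {h | Odd h} 200 D) P

/-- The Euler product in the singular series converges. -/
lemma multipliable_singularSeries :
    Multipliable (fun p : {p : ℕ // p.Prime ∧ 5 ≤ p} =>
      1 - (6 * (p : ℝ) ^ 2 - 4 * (p : ℝ) + 1) / ((p : ℝ) - 1) ^ 4) := by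
  have key : Summable (fun p : {p : ℕ // p.Prime ∧ 5 ≤ p} =>
      ‖-((6 * (p : ℝ) ^ 2 - 4 * (p : ℝ) + 1) / ((p : ℝ) - 1) ^ 4)‖) := by
    have h2 : Summable (fun p : {p : ℕ // p.Prime ∧ 5 ≤ p} => 24 * (1 / ((p : ℕ) : ℝ) ^ 2)) :=
      ((Real.summable_one_div_nat_pow.mpr one_lt_two).comp_injective
        Subtype.val_injective).mul_left 24
    refine Summable.of_nonneg_of_le (fun _ => norm_nonneg _) (fun p => ?_) h2
    have h5 : (5 : ℝ) ≤ ((p : ℕ) : ℝ) := by exact_mod_cast p.2.2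
    generalize ((p : ℕ) : ℝ) = x at h5
    have hx : 0 < x - 1 := by linarith
    have h1 : 0 ≤ 6 * x ^ 2 - 4 * x + 1 := by nlinarith
    rw [norm_neg, Real.norm_of_nonneg (by positivity), mul_one_div,
      div_le_div_iff₀ (by positivity) (by positivity)]
    have h3 : x ^ 2 ≤ 2 * (x - 1) ^ 2 := by nlinarith
    have h4 : x ^ 2 * x ^ 2 ≤ (2 * (x - 1) ^ 2) * (2 * (x - 1) ^ 2) := by gcongr
    nlinarith [sq_nonneg x]
  have := multipliable_one_add_of_summable key
  simpa [sub_eq_add_neg] using this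

/-- The singular series
`𝔖(m) = 1_{m ≡ 4 (6)} (27/2) ∏_{p ≥ 5} (1 - (6p² - 4p + 1)/(p - 1)⁴)
  ∏_{p ≥ 5, p ∣ m(m+4)} (1 + 1/(p - 4)) ∏_{p ≥ 5, p ∣ m+2} (1 + 2/(p - 4))`. -/
noncomputable def singularSeries (m : ℕ) : ℝ :=
  if m ≡ 4 [MOD 6] then
    27 / 2 *
      (∏' p : {p : ℕ // p.Prime ∧ 5 ≤ p},
        (1 - (6 * (p : ℝ) ^ 2 - 4 * (p : ℝ) + 1) / ((p : ℝ) - 1) ^ 4)) *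
      (∏ p ∈ (m * (m + 4)).primeFactors.filter (fun p => 5 ≤ p), (1 + 1 / ((p : ℝ) - 4))) *
      ∏ p ∈ (m + 2).primeFactors.filter (fun p => 5 ≤ p), (1 + 2 / ((p : ℝ) - 4))
  else 0

open Classical in
/-- `∑_{n ≤ X, Q(n)} f₁(n) f₂(n+2) f₃(m-n) f₄(m-n+2)`, over positive integers `n`;
it is only used for `X ≤ m`, where `m - n` is a true difference. -/
noncomputable def siftedSum (f : Fin 4 → ℕ → ℝ) (Q : ℕ → Prop) (m : ℕ) (X : ℝ) : ℝ :=
  ∑ n ∈ Finset.Icc 1 ⌊X⌋₊ with Q n, f 0 n * f 1 (n + 2) * f 2 (m - n) * f 3 (m - n + 2)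

/-! The character conditions and the explicit coprimality conditions together force n, n + 2, m - n
and m - n + 2 to be prime to r. Each sum therefore runs over sifted residue classes modulo r, and
primes dividing r drop out of the sieve weights. What remains is a product of four beta sieves over
the primes 5 ≤ p < P not dividing r, times a weight in [0, 1] that is periodic modulo a divisor of
6r (`siftedSum_eq`).

Over a full period the beta sieves can be replaced by exact ones. If p is the least sieving prime
dividing k, pairing the sets with and without p cancels everything except the sets whose first
failure of the sieve condition occurs at p. Such a failure requires at least log D / log P - 200
primes and a p that is not too small, so the sieve sum at k is at most a constant times e^{-log D /
(10 log P)} 3^{ω(k)} (log p / log P)^41, where ω counts sieving primes (`abs_sieveSum_le`). By the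
Chinese remainder theorem, the average over n of the resulting majorant for a given p is ≪ (log P /
log p)^40 / p relative to the exact sieve. Mertens' estimates then bound the sum over p
(`exists_sum_majorant_le`), which gives the fundamental lemma `exists_abs_sum_prod_sieveSum_sub_le`.

Passing from a period to [1, X] costs O(1) for each of at most 6 r D^4 systems of congruences
(`abs_sum_Icc_sub_sum_range_le`, `card_sieveSupport_le`), and the four Euler products in the
normalisation contribute ≪ (log P)^4. If r ≤ m^4, the local densities times the Euler products give
the singular series up to a relative error ≪ log m / P (`exists_ratio_singularSeries`). If r ≥ m^4,
both sides are already ≪ r D^4 (log P)^4 (`abs_siftedSum_sub_le`).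

It remains to find the proportion of sifted classes modulo r on which χ takes the prescribed values
(`exists_siftedCharSum_approx`). Expand the indicators in products of values of χ. The sums of χ(x),
χ(x + 2), χ(m - x) and χ(x)χ(x + 2) are small: after inclusion-exclusion over the primes dividing r,
a substitution multiplies the summand by a constant ≠ 1 and annihilates all but at most two terms
(`norm_sum_sifted_le`). The average of χ(x)χ(m - x) is σ₁. The average of (1 + χ(x))χ(x + 2)χ(m - x)
is σ₂ up to a small rescaling, so no bound for the cubic character sum is needed. -/

/-! ### Mertens' estimates -/

/-- The Euler product `∏_{p < P} (1 - 1/p)⁻¹`. -/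
noncomputable def eulerProd (P : ℝ) : ℝ := ∏ p ∈ primesBetween 2 P, (1 - 1 / (p : ℝ))⁻¹

lemma primesBetween_two_eq (P : ℝ) : primesBetween 2 P = (⌈P⌉₊).primesBelow := by
  ext p
  rw [mem_primesBetween, Nat.mem_primesBelow, Nat.lt_ceil]
  exact ⟨fun h => ⟨h.2.2, h.1⟩, fun h => ⟨h.2, h.2.two_le, h.1⟩⟩

lemma two_le_of_mem_primesBetween {a : ℕ} {P : ℝ} {p : ℕ} (hp : p ∈ primesBetween a P) :
    (2 : ℝ) ≤ p := by
  exact_mod_cast (mem_primesBetween.1 hp).1.two_le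

lemma one_le_inv_one_sub_inv {x : ℝ} (hx : 2 ≤ x) : 1 ≤ (1 - 1 / x)⁻¹ := by
  have h1 : 1 / x ≤ 1 / 2 := one_div_le_one_div_of_le (by norm_num) hx
  have h2 : 0 < 1 / x := by positivity
  exact (one_le_inv₀ (by linarith)).2 (by linarith)

lemma one_le_eulerProd (P : ℝ) : 1 ≤ eulerProd P := by
  unfold eulerProd
  calc (1 : ℝ) = ∏ p ∈ primesBetween 2 P, 1 := by simp
    _ ≤ _ := Finset.prod_le_prod (fun _ _ => zero_le_one)
      (fun p hp => one_le_inv_one_sub_inv (two_le_of_mem_primesBetween hp))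

lemma eulerProd_mono {P Q : ℝ} (h : P ≤ Q) : eulerProd P ≤ eulerProd Q := by
  unfold eulerProd
  refine Finset.prod_le_prod_of_subset_of_one_le ?_ ?_ ?_
  · intro p hp
    rw [mem_primesBetween] at hp ⊢
    exact ⟨hp.1, hp.2.1, hp.2.2.trans_le h⟩
  · intro p hp
    exact zero_le_one.trans (one_le_inv_one_sub_inv (two_le_of_mem_primesBetween hp))
  · intro p hp _
    exact one_le_inv_one_sub_inv (two_le_of_mem_primesBetween hp)

/-- `n ↦ n ^ (-σ)` as a monoid homomorphism. -/
noncomputable def rpowNegHom (σ : ℝ) : ℕ →* ℝ where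
  toFun n := ((n : ℝ) ^ σ)⁻¹
  map_one' := by simp
  map_mul' a b := by
    push_cast
    rw [Real.mul_rpow (by positivity) (by positivity), mul_inv]

lemma norm_rpowNegHom_lt_one {σ : ℝ} (hσ : 0 < σ) {p : ℕ} (hp : p.Prime) :
    ‖rpowNegHom σ p‖ < 1 := by
  have h2 : (1 : ℝ) < p := by exact_mod_cast hp.one_lt
  have : 1 < (p : ℝ) ^ σ := Real.one_lt_rpow h2 hσ
  simp only [rpowNegHom, MonoidHom.coe_mk, OneHom.coe_mk]
  rw [Real.norm_of_nonneg (by positivity)]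
  exact inv_lt_one_of_one_lt₀ this

/-- The product expands into the sum of 1/n over integers n all of whose prime factors are below P.
This contains the harmonic sum over n < ⌈P⌉, which is at least log ⌈P⌉. -/
lemma log_le_eulerProd {P : ℝ} (hP : 1 ≤ P) : Real.log P ≤ eulerProd P := by
  obtain ⟨hs, hsum⟩ := EulerProduct.summable_and_hasSum_smoothNumbers_prod_primesBelow_geometric
    (f := rpowNegHom 1) (fun hp => norm_rpowNegHom_lt_one one_pos hp) ⌈P⌉₊
  have he : ∏ p ∈ (⌈P⌉₊).primesBelow, (1 - rpowNegHom 1 p)⁻¹ = eulerProd P := by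
    rw [eulerProd, primesBetween_two_eq]
    simp [rpowNegHom]
  rw [he] at hsum
  have hN : 1 ≤ ⌈P⌉₊ := Nat.one_le_ceil_iff.2 (by linarith)
  have h1 : Real.log P ≤ Real.log ((⌈P⌉₊ - 1 + 1 : ℕ) : ℝ) := by
    rw [Nat.sub_add_cancel hN]
    exact Real.log_le_log (by linarith) (Nat.le_ceil P)
  refine (h1.trans (log_add_one_le_harmonic _)).trans ?_
  rw [harmonic_eq_sum_Icc]
  push_cast
  have hmem : ∀ n ∈ Finset.Icc 1 (⌈P⌉₊ - 1), n ∈ (⌈P⌉₊).smoothNumbers := fun n hn => by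
    rw [Finset.mem_Icc] at hn
    exact Nat.mem_smoothNumbers_of_lt (by omega) (by omega)
  have := sum_le_hasSum (Finset.univ.map ⟨fun n : Finset.Icc 1 (⌈P⌉₊ - 1) =>
      (⟨n.1, hmem n.1 n.2⟩ : (⌈P⌉₊).smoothNumbers), fun a b h =>
        Subtype.ext (congrArg (fun x : (⌈P⌉₊).smoothNumbers => (x : ℕ)) h)⟩)
    (fun i _ => (by simp only [rpowNegHom, MonoidHom.coe_mk, OneHom.coe_mk]; positivity)) hsum
  refine le_trans (le_of_eq ?_) this
  rw [Finset.sum_map, ← Finset.sum_coe_sort]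
  refine Finset.sum_congr rfl fun i _ => ?_
  simp only [rpowNegHom, MonoidHom.coe_mk, OneHom.coe_mk, Real.rpow_one]
  rfl

lemma sum_log_primeFactors_le {n : ℕ} (hn : n ≠ 0) :
    ∑ p ∈ n.primeFactors, Real.log p ≤ Real.log n := by
  rw [← Real.log_prod (fun p hp => by
    have := (Nat.prime_of_mem_primeFactors hp).pos; positivity), ← Nat.cast_prod]
  refine Real.log_le_log ?_ ?_
  · exact_mod_cast Finset.prod_pos fun p hp => (Nat.prime_of_mem_primeFactors hp).pos
  · exact_mod_cast Nat.le_of_dvd (Nat.pos_of_ne_zero hn) (Nat.prod_primeFactors_dvd n)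

/-- The upper bound in Mertens' first theorem. -/
lemma sum_log_div_le {P : ℝ} (hP : 2 ≤ P) :
    ∑ p ∈ primesBetween 2 P, Real.log p / p ≤ Real.log P + Real.log 4 := by
  set n := ⌊P⌋₊ with hn
  have hn2 : 2 ≤ n := Nat.le_floor hP
  have hnpos : (0 : ℝ) < n := by positivity
  have hsub : ∀ p ∈ primesBetween 2 P, p ∈ Finset.Icc 1 n := fun p hp => by
    rw [mem_primesBetween] at hp
    exact Finset.mem_Icc.2 ⟨hp.1.one_le, Nat.le_floor hp.2.2.le⟩
  have h1 : ∑ p ∈ primesBetween 2 P, Real.log p * ((n / p : ℕ) : ℝ) ≤ n * Real.log n := by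
    -- Count multiples: the integer part of n / p is the number of k ≤ n divisible by p, and each k
    -- collects the logarithms of its prime factors, at most log k.
    calc ∑ p ∈ primesBetween 2 P, Real.log p * ((n / p : ℕ) : ℝ)
        = ∑ p ∈ primesBetween 2 P, ∑ k ∈ Finset.Ioc 0 n, if p ∣ k then Real.log p else 0 := by
          refine Finset.sum_congr rfl fun p _ => ?_
          rw [← Finset.sum_filter, Finset.sum_const, Nat.Ioc_filter_dvd_card_eq_div, nsmul_eq_mul,
            mul_comm]
      _ = ∑ k ∈ Finset.Ioc 0 n, ∑ p ∈ primesBetween 2 P, if p ∣ k then Real.log p else 0 :=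
          Finset.sum_comm
      _ ≤ ∑ k ∈ Finset.Ioc 0 n, Real.log n := by
          refine Finset.sum_le_sum fun k hk => ?_
          rw [Finset.mem_Ioc] at hk
          rw [← Finset.sum_filter]
          refine le_trans ?_ ((sum_log_primeFactors_le (by omega : k ≠ 0)).trans
            (Real.log_le_log (by exact_mod_cast hk.1) (by exact_mod_cast hk.2)))
          refine Finset.sum_le_sum_of_subset_of_nonneg ?_ ?_
          · intro p hp
            rw [Finset.mem_filter, mem_primesBetween] at hp
            exact Nat.mem_primeFactors.2 ⟨hp.1.1, hp.2, by omega⟩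
          · intro p hp _
            exact Real.log_natCast_nonneg p
      _ = n * Real.log n := by simp
  have h2 : ∑ p ∈ primesBetween 2 P, Real.log p ≤ Real.log 4 * n := by
    refine le_trans ?_ (Chebyshev.theta_le_log4_mul_x hnpos.le)
    rw [Chebyshev.theta_eq_sum_Icc, Nat.floor_natCast]
    refine Finset.sum_le_sum_of_subset_of_nonneg ?_ ?_
    · intro p hp
      have h := hsub p hp
      rw [Finset.mem_Icc] at h
      exact Finset.mem_filter.2 ⟨Finset.mem_Icc.2 ⟨by omega, h.2⟩, (mem_primesBetween.1 hp).1⟩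
    · intro p hp _
      exact Real.log_natCast_nonneg p
  -- Removing the integer part costs at most log p for each p, in total no more than the Chebyshev
  -- bound.
  have h3 : ∑ p ∈ primesBetween 2 P, Real.log p / p * n ≤ n * Real.log n + Real.log 4 * n := by
    refine le_trans ?_ (add_le_add h1 h2)
    rw [← Finset.sum_add_distrib]
    refine Finset.sum_le_sum fun p hp => ?_
    have hp2 := two_le_of_mem_primesBetween hp
    have hfl : (n : ℝ) / p ≤ ((n / p : ℕ) : ℝ) + 1 := by
      rw [← Nat.floor_div_eq_div (K := ℝ)]
      exact (Nat.lt_floor_add_one _).le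
    have hl : 0 ≤ Real.log p := Real.log_natCast_nonneg p
    calc Real.log p / p * n = Real.log p * (n / p) := by ring
      _ ≤ Real.log p * (((n / p : ℕ) : ℝ) + 1) := by gcongr
      _ = _ := by ring
  rw [← Finset.sum_mul] at h3
  have h4 : ∑ p ∈ primesBetween 2 P, Real.log p / p ≤ Real.log n + Real.log 4 := by
    refine le_of_mul_le_mul_right (h3.trans (le_of_eq ?_)) hnpos
    ring
  refine h4.trans ?_
  gcongr
  exact Nat.floor_le (by linarith)

lemma exists_sum_log_div_le :
    ∃ C : ℝ, 1 ≤ C ∧ ∀ P : ℝ, 2 ≤ P →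
      ∑ p ∈ primesBetween 2 P, Real.log p / p ≤ C * Real.log P := by
  refine ⟨3, by norm_num, fun P hP => (sum_log_div_le hP).trans ?_⟩
  have : Real.log 4 = 2 * Real.log 2 := by
    rw [show (4 : ℝ) = 2 ^ 2 by norm_num, Real.log_pow]; norm_num
  have h2 : Real.log 2 ≤ Real.log P := Real.log_le_log (by norm_num) hP
  linarith

/-- Comparison of the Euler factors at `1` and at `σ ∈ (1, 2]`. -/
lemma inv_one_sub_inv_le {x σ : ℝ} (hx : 2 ≤ x) (hσ : 1 ≤ σ) :
    (1 - 1 / x)⁻¹ ≤ Real.exp (2 * ((σ - 1) * (Real.log x / x))) * (1 - (x ^ σ)⁻¹)⁻¹ := by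
  have hx0 : 0 < x := by linarith
  have hy : 0 < (x ^ σ)⁻¹ := by positivity
  have hyx : (x ^ σ)⁻¹ ≤ 1 / x := by
    rw [one_div]
    refine inv_anti₀ hx0 ?_
    calc x = x ^ (1 : ℝ) := (Real.rpow_one x).symm
      _ ≤ x ^ σ := Real.rpow_le_rpow_of_exponent_le (by linarith) hσ
  have hxh : 1 / x ≤ 1 / 2 := one_div_le_one_div_of_le (by norm_num) hx
  -- This is 1 - e^{-u} ≤ u with u = (σ - 1) log x.
  have hdiff : 1 / x - (x ^ σ)⁻¹ ≤ (σ - 1) * (Real.log x / x) := by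
    have : (x ^ σ)⁻¹ = 1 / x * Real.exp (-((σ - 1) * Real.log x)) := by
      rw [← Real.rpow_neg hx0.le, Real.rpow_def_of_pos hx0, one_div,
        show x⁻¹ = Real.exp (-Real.log x) by rw [Real.exp_neg, Real.exp_log hx0], ← Real.exp_add]
      congr 1; ring
    rw [this]
    have h := Real.add_one_le_exp (-((σ - 1) * Real.log x))
    have hx1 : 0 < 1 / x := by positivity
    calc 1 / x - 1 / x * Real.exp (-((σ - 1) * Real.log x))
        = 1 / x * (1 - Real.exp (-((σ - 1) * Real.log x))) := by ring
      _ ≤ 1 / x * ((σ - 1) * Real.log x) := by gcongr; linarith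
      _ = _ := by ring
  have hE := Real.add_one_le_exp (2 * ((σ - 1) * (Real.log x / x)))
  set δ := (σ - 1) * (Real.log x / x) with hδ
  have hA : 0 < 1 - 1 / x := by linarith
  have hB : 0 < 1 - (x ^ σ)⁻¹ := by linarith
  have hδ0 : 0 ≤ δ := by
    have := Real.log_nonneg (by linarith : (1 : ℝ) ≤ x)
    have : 0 ≤ σ - 1 := by linarith
    positivity
  -- Since 1 - 1/x ≥ 1/2, the quotient of the two factors is at most 1 + 2δ ≤ e^{2δ}.
  rw [← div_eq_mul_inv, le_div_iff₀ hB, inv_mul_le_iff₀ hA]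
  nlinarith

/-- Raising the exponent from 1 to σ in every Euler factor costs a total controlled by Mertens'
first theorem. The product at σ is a partial sum of ζ(σ). -/
lemma eulerProd_le_exp_mul_tsum {P σ : ℝ} (hP : 2 ≤ P) (hσ : 1 < σ) :
    eulerProd P ≤ Real.exp (2 * ((σ - 1) * (Real.log P + Real.log 4))) *
      ∑' n : ℕ, 1 / (n : ℝ) ^ σ := by
  obtain ⟨hs, hsum⟩ := EulerProduct.summable_and_hasSum_smoothNumbers_prod_primesBelow_geometric
    (f := rpowNegHom σ) (fun hp => norm_rpowNegHom_lt_one (by linarith) hp) ⌈P⌉₊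
  have hsummable := Real.summable_one_div_nat_rpow.2 hσ
  have h1 : ∏ p ∈ (⌈P⌉₊).primesBelow, (1 - rpowNegHom σ p)⁻¹ ≤ ∑' n : ℕ, 1 / (n : ℝ) ^ σ := by
    rw [← hsum.tsum_eq]
    have := Summable.tsum_subtype_le (fun n : ℕ => 1 / (n : ℝ) ^ σ) (⌈P⌉₊).smoothNumbers
      (fun n => by positivity) hsummable
    simpa [rpowNegHom] using this
  calc eulerProd P ≤ ∏ p ∈ primesBetween 2 P,
        Real.exp (2 * ((σ - 1) * (Real.log p / p))) * (1 - ((p : ℝ) ^ σ)⁻¹)⁻¹ :=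
        Finset.prod_le_prod (fun p hp => zero_le_one.trans
          (one_le_inv_one_sub_inv (two_le_of_mem_primesBetween hp)))
          (fun p hp => inv_one_sub_inv_le (two_le_of_mem_primesBetween hp) hσ.le)
    _ = Real.exp (2 * ((σ - 1) * ∑ p ∈ primesBetween 2 P, Real.log p / p)) *
        ∏ p ∈ (⌈P⌉₊).primesBelow, (1 - rpowNegHom σ p)⁻¹ := by
        rw [Finset.prod_mul_distrib, ← Real.exp_sum, ← Finset.mul_sum, ← Finset.mul_sum,
          primesBetween_two_eq]
        rfl
    _ ≤ _ := by
        gcongr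
        · exact hsum.nonneg fun i => by simp only [rpowNegHom, MonoidHom.coe_mk, OneHom.coe_mk]; positivity
        · exact sum_log_div_le hP

/-- The upper bound in Mertens' third theorem. -/
lemma exists_eulerProd_le : ∃ C : ℝ, 1 ≤ C ∧ ∀ P : ℝ, 2 ≤ P → eulerProd P ≤ C * Real.log P := by
  -- The choice is σ = 1 + 1 / log P: the exponential cost stays bounded, and the simple pole of ζ
  -- at 1 gives ζ(σ) < 2 log P once σ is within δ of 1.
  have ht := tendsto_sub_mul_tsum_nat_rpow.eventually (gt_mem_nhds (by norm_num : (1 : ℝ) < 2))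
  rw [eventually_nhdsWithin_iff, Metric.eventually_nhds_iff] at ht
  obtain ⟨δ, hδ, hb⟩ := ht
  -- Beyond this threshold 1 / log P < δ. Below it, monotonicity and log P ≥ log 2 suffice, with a
  -- larger constant.
  set Q : ℝ := max 2 (Real.exp (2 / δ)) with hQ
  have hl2 : 0 < Real.log 2 := Real.log_pos (by norm_num)
  have hbig : ∀ P : ℝ, Q ≤ P → eulerProd P ≤ 2 * Real.exp 6 * Real.log P := fun P hP => by
    have hP2 : 2 ≤ P := (le_max_left _ _).trans hP
    have hlog2 : Real.log 2 ≤ Real.log P := Real.log_le_log (by norm_num) hP2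
    have hlog : 0 < Real.log P := by linarith
    have hlogδ : 2 / δ ≤ Real.log P := by
      rw [Real.le_log_iff_exp_le (by linarith)]
      exact (le_max_right _ _).trans hP
    have hσ : (1 : ℝ) < 1 + 1 / Real.log P := by
      have : 0 < 1 / Real.log P := by positivity
      linarith
    have hz := @hb (1 + 1 / Real.log P) (by
      rw [Real.dist_eq, add_sub_cancel_left, abs_of_pos (by positivity), div_lt_iff₀ hlog]
      rw [div_le_iff₀ hδ] at hlogδ
      linarith) hσ
    rw [add_sub_cancel_left, one_div, inv_mul_lt_iff₀ hlog] at hz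
    refine (eulerProd_le_exp_mul_tsum hP2 hσ).trans ?_
    have hlog4 : Real.log 4 = 2 * Real.log 2 := by
      rw [show (4 : ℝ) = 2 ^ 2 by norm_num, Real.log_pow]; norm_num
    have he : 2 * ((1 + 1 / Real.log P - 1) * (Real.log P + Real.log 4)) ≤ 6 := by
      rw [add_sub_cancel_left, one_div_mul_eq_div]
      have : (Real.log P + Real.log 4) / Real.log P ≤ 3 := by
        rw [div_le_iff₀ hlog]; linarith
      linarith
    have hz' := hz.le
    rw [one_div] at *
    calc _ ≤ Real.exp 6 * (Real.log P * 2) := by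
          refine mul_le_mul (Real.exp_le_exp.2 he) hz' (tsum_nonneg fun n => by positivity)
            (Real.exp_nonneg _)
      _ = _ := by ring
  have hQ2 : (2 : ℝ) ≤ Q := le_max_left _ _
  have hlQ : 0 < Real.log Q := Real.log_pos (by linarith)
  have h6 : 1 ≤ Real.exp 6 := Real.one_le_exp (by norm_num)
  refine ⟨2 * Real.exp 6 * (1 + Real.log Q / Real.log 2), ?_, fun P hP => ?_⟩
  · have : 0 ≤ Real.log Q / Real.log 2 := by positivity
    nlinarith
  have hlog2 : Real.log 2 ≤ Real.log P := Real.log_le_log (by norm_num) hP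
  have key : Real.log Q ≤ Real.log Q / Real.log 2 * Real.log P := by
    rw [div_mul_eq_mul_div, le_div_iff₀ hl2]
    gcongr
  have hlP : 0 < Real.log P := by linarith
  rcases le_total Q P with h | h
  · refine (hbig P h).trans ?_
    have : 0 ≤ Real.log Q / Real.log 2 := by positivity
    refine mul_le_mul_of_nonneg_right ?_ hlP.le
    exact le_mul_of_one_le_right (by positivity) (by linarith)
  · refine (eulerProd_mono h).trans ((hbig Q le_rfl).trans ?_)
    rw [mul_assoc (2 * Real.exp 6)]
    gcongr
    linarith

/-- The product is the quotient of the Euler products at P and at a, so both the upper bound at P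
and the lower bound `log_le_eulerProd` at a are needed. -/
lemma exists_prod_primesBetween_le :
    ∃ C : ℝ, 1 ≤ C ∧ ∀ (P : ℝ) (a : ℕ), 2 ≤ a → (a : ℝ) ≤ P →
      ∏ p ∈ primesBetween a P, (1 - 1 / (p : ℝ))⁻¹ ≤ C * (Real.log P / Real.log a) := by
  obtain ⟨C, hC1, hC⟩ := exists_eulerProd_le
  refine ⟨C, hC1, fun P a ha haP => ?_⟩
  have ha2 : (2 : ℝ) ≤ a := by exact_mod_cast ha
  have hla : 0 < Real.log a := Real.log_pos (by linarith)
  have hsplit : eulerProd P =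
      eulerProd a * ∏ p ∈ primesBetween a P, (1 - 1 / (p : ℝ))⁻¹ := by
    unfold eulerProd
    rw [← Finset.prod_union]
    · refine Finset.prod_congr ?_ fun _ _ => rfl
      ext p
      simp only [Finset.mem_union, mem_primesBetween, Nat.cast_lt]
      constructor
      · rintro ⟨h1, h2, h3⟩
        rcases lt_or_ge p a with h | h
        · exact Or.inl ⟨h1, h2, h⟩
        · exact Or.inr ⟨h1, h, h3⟩
      · rintro (⟨h1, h2, h3⟩ | ⟨h1, h2, h3⟩)
        · exact ⟨h1, h2, lt_of_lt_of_le (by exact_mod_cast h3) haP⟩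
        · exact ⟨h1, h1.two_le, h3⟩
    · rw [Finset.disjoint_left]
      intro p hp hp'
      rw [mem_primesBetween] at hp hp'
      have : p < a := by exact_mod_cast hp.2.2
      omega
  have hX : 0 ≤ ∏ p ∈ primesBetween a P, (1 - 1 / (p : ℝ))⁻¹ :=
    Finset.prod_nonneg fun p hp => zero_le_one.trans
      (one_le_inv_one_sub_inv (two_le_of_mem_primesBetween hp))
  have h1 := hC P (ha2.trans haP)
  rw [hsplit] at h1
  rw [← mul_div_assoc, le_div_iff₀ hla, mul_comm]
  exact (mul_le_mul_of_nonneg_right (log_le_eulerProd (by linarith)) hX).trans h1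

/-! ### The beta sieve at a single integer -/

open Classical in
/-- `∑ (-1)^|C|` over the sets `C ⊆ 𝒬` of divisors of `k` with `∏ C ∈ 𝒟`. -/
noncomputable def sieveSum (𝒟 : Set ℕ) (𝒬 : Finset ℕ) (k : ℤ) : ℝ :=
  ∑ C ∈ (𝒬.filter (fun p : ℕ => (p : ℤ) ∣ k)).powerset with ∏ p ∈ C, p ∈ 𝒟, (-1) ^ C.card

/-- The condition defining `betaSieveSet`, on the set of prime factors. -/
def SieveAdmissible (S : Set ℕ) (β : ℕ) (D : ℝ) (C : Finset ℕ) : Prop :=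
  ∀ p ∈ C, (C.filter (fun q => p ≤ q)).card ∈ S →
    ((∏ q ∈ C.filter (fun q => p ≤ q), q : ℕ) : ℝ) * (p : ℝ) ^ β < D

lemma prod_mem_betaSieveSet_iff {S : Set ℕ} {β : ℕ} {D : ℝ} {C : Finset ℕ}
    (hC : ∀ p ∈ C, p.Prime) : ∏ p ∈ C, p ∈ betaSieveSet S β D ↔ SieveAdmissible S β D C := by
  unfold betaSieveSet SieveAdmissible
  rw [Set.mem_ofPred_eq, Nat.primeFactors_prod hC]

/-- Positions are counted from the largest prime downwards, so adding a smaller prime leaves the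
conditions at the earlier positions unchanged. Inductions accordingly remove least elements. -/
lemma filter_le_insert_of_lt {B : Finset ℕ} {p x : ℕ} (h : p < x) :
    (insert p B).filter (fun q => x ≤ q) = B.filter (fun q => x ≤ q) := by
  rw [Finset.filter_insert, if_neg (by omega)]

lemma SieveAdmissible.of_insert {S : Set ℕ} {β : ℕ} {D : ℝ} {B : Finset ℕ} {p : ℕ}
    (hp : ∀ q ∈ B, p < q) (h : SieveAdmissible S β D (insert p B)) : SieveAdmissible S β D B := by
  intro x hx hS
  have := h x (Finset.mem_insert_of_mem hx)
  rw [filter_le_insert_of_lt (hp x hx)] at this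
  exact this hS

lemma exists_insert_min {C : Finset ℕ} (hC : C.Nonempty) :
    ∃ p B, C = insert p B ∧ p ∉ B ∧ ∀ q ∈ B, p < q := by
  refine ⟨C.min' hC, C.erase (C.min' hC), (Finset.insert_erase (C.min'_mem hC)).symm,
    Finset.notMem_erase _ _, fun q hq => ?_⟩
  exact C.min'_lt_of_mem_erase_min' hC hq

/-- If `C` satisfies the sieve conditions except possibly at its least element, then `D / ∏ C` is
not much smaller than `D`. -/
lemma pow_mul_log_le_log_sub_sum {S : Set ℕ} (hS : ∀ h ∈ S, 2 ≤ h → h - 2 ∈ S) {P D : ℝ}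
    (hP : 2 ≤ P) (hD : P ^ 202 < D) (h : ℕ) :
    ∀ C : Finset ℕ, C.card = h → h ∈ S → (∀ p ∈ C, 2 ≤ p ∧ (p : ℝ) < P) →
      (∀ p ∈ C, (∃ q ∈ C, q < p) → (C.filter (fun q => p ≤ q)).card ∈ S →
        ((∏ q ∈ C.filter (fun q => p ≤ q), q : ℕ) : ℝ) * (p : ℝ) ^ 200 < D) →
      (99 / 100 : ℝ) ^ ((h + 1) / 2) * Real.log D ≤ Real.log D - ∑ q ∈ C, Real.log q := by
  have hlogP : 0 < Real.log P := Real.log_pos (by linarith)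
  have hDP : 202 * Real.log P < Real.log D := by
    have := Real.log_lt_log (by positivity) hD
    rwa [Real.log_pow] at this
  have hlt : ∀ {C : Finset ℕ}, (∀ p ∈ C, 2 ≤ p ∧ (p : ℝ) < P) → ∀ p ∈ C,
      0 < Real.log p ∧ Real.log p < Real.log P := fun hC p hp => by
    have h2 : (2 : ℝ) ≤ p := by exact_mod_cast (hC p hp).1
    exact ⟨Real.log_pos (by linarith), Real.log_lt_log (by linarith) (hC p hp).2⟩
  induction h using Nat.strong_induction_on with
  | _ h ih =>
  intro C hcard hh hCP hC
  rcases C.eq_empty_or_nonempty with rfl | hne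
  · simp at hcard
    subst hcard
    simp
  obtain ⟨p, B, rfl, hpB, hlp⟩ := exists_insert_min hne
  have hp := hlt hCP p (Finset.mem_insert_self _ _)
  rw [Finset.card_insert_of_notMem hpB] at hcard
  rw [Finset.sum_insert hpB]
  -- With one or two primes no sieve condition is needed: each logarithm is below log P, which is
  -- less than log D / 202.
  rcases B.eq_empty_or_nonempty with rfl | hne'
  · simp at hcard
    subst hcard
    norm_num
    linarith
  obtain ⟨q, B', rfl, hqB, hlq⟩ := exists_insert_min hne'
  have hpq : p < q := hlp q (Finset.mem_insert_self _ _)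
  have hq := hlt hCP q (by simp)
  rw [Finset.card_insert_of_notMem hqB] at hcard
  rw [Finset.sum_insert hqB]
  rcases B'.eq_empty_or_nonempty with rfl | hne''
  · simp at hcard
    subst hcard
    norm_num
    linarith
  have hexp : (h + 1) / 2 = (B'.card + 1) / 2 + 1 := by omega
  have hB'S : B'.card ∈ S := by
    have := hS h hh (by omega)
    rwa [show h - 2 = B'.card by omega] at this
  have hfil : ∀ x ∈ B', (insert p (insert q B')).filter (fun y => x ≤ y) =
      B'.filter (fun y => x ≤ y) := fun x hx => by
    rw [filter_le_insert_of_lt (hpq.trans (hlq x hx)), filter_le_insert_of_lt (hlq x hx)]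
  have hIH := ih B'.card (by omega) B' rfl hB'S (fun x hx => hCP x (by simp [hx]))
    (fun x hx hx' hcx => by
      have := hC x (by simp [hx]) ⟨q, by simp, hlq x hx⟩
      rw [hfil x hx] at this
      exact this hcx)
  have hx := B'.min'_mem hne''
  set x := B'.min' hne'' with hxdef
  have hsucc := hC x (by simp [hx]) ⟨q, by simp, hlq x hx⟩
  rw [hfil x hx, Finset.filter_true_of_mem (fun y hy => B'.min'_le y hy)] at hsucc
  have hs := hsucc hB'S
  have hx2 : ∀ y ∈ B', (0 : ℝ) < y := fun y hy => by
    have := (hCP y (by simp [hy])).1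
    positivity
  -- The condition at the least prime x of `B'` says that 200 log x is below the remainder log D -
  -- log ∏ B'. As p, q < x, removing these two primes from that remainder costs less than 1/100 of
  -- it, whence one factor 99/100 for every two primes.
  have hlogs : ∑ y ∈ B', Real.log y + 200 * Real.log x < Real.log D := by
    have h1 : (0 : ℝ) < ((∏ y ∈ B', y : ℕ) : ℝ) := by
      push_cast
      exact Finset.prod_pos hx2
    have h2 := hx2 x hx
    have := Real.log_lt_log (by positivity) hs
    rw [Real.log_mul (by positivity) (by positivity), Real.log_pow] at this
    push_cast at this
    rwa [Real.log_prod (fun y hy => (hx2 y hy).ne')] at this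
  have hpx : Real.log p ≤ Real.log x := Real.log_le_log (by
      have := (hCP p (by simp)).1
      positivity) (by exact_mod_cast (hpq.trans (hlq x hx)).le)
  have hqx : Real.log q ≤ Real.log x := Real.log_le_log (by
      have := (hCP q (by simp)).1
      positivity) (by exact_mod_cast (hlq x hx).le)
  rw [hexp, pow_succ]
  linarith

/-- The hypotheses bound the exponential below by e^{-20} e^{-h/10} and the ratio of logarithms
below by (99/100)^h. The exponents fit because (9/10) · 2 · (99/100)^41 ≥ 1. -/
lemma one_le_sieve_factor {P D : ℝ} (hP : 2 ≤ P) {p h : ℕ} (hh : 1 ≤ h)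
    (h1 : Real.log D ≤ (h + 200) * Real.log P)
    (h2 : (99 / 100 : ℝ) ^ ((h + 1) / 2) * Real.log P ≤ Real.log p) :
    1 ≤ Real.exp 20 * Real.exp (-(Real.log D / (10 * Real.log P))) *
      (2 ^ h * (Real.log p / Real.log P) ^ 41) := by
  have hlogP : 0 < Real.log P := Real.log_pos (by linarith)
  have h3 : (99 / 100 : ℝ) ^ h ≤ Real.log p / Real.log P := by
    rw [le_div_iff₀ hlogP]
    refine le_trans ?_ h2
    gcongr ?_ * _
    exact pow_le_pow_of_le_one (by norm_num) (by norm_num) (by omega)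
  have h4 : Real.exp (-1 / 10) ^ h ≤
      Real.exp 20 * Real.exp (-(Real.log D / (10 * Real.log P))) := by
    rw [← Real.exp_nat_mul, ← Real.exp_add, Real.exp_le_exp]
    have : Real.log D / (10 * Real.log P) ≤ (h + 200) / 10 := by
      rw [div_le_div_iff₀ (by positivity) (by norm_num)]
      linarith
    linarith
  have h5 : (9 / 10 : ℝ) ≤ Real.exp (-1 / 10) := by
    have := Real.add_one_le_exp (-1 / 10 : ℝ)
    linarith
  calc (1 : ℝ) ≤ ((9 / 10) * (2 * (99 / 100) ^ 41)) ^ h := one_le_pow₀ (by norm_num)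
    _ = (9 / 10) ^ h * (2 ^ h * ((99 / 100) ^ h) ^ 41) := by
        rw [mul_pow, mul_pow, ← pow_mul, ← pow_mul, mul_comm 41 h]
    _ ≤ Real.exp (-1 / 10) ^ h * (2 ^ h * (Real.log p / Real.log P) ^ 41) := by gcongr
    _ ≤ _ := by
        have : 0 ≤ Real.log p / Real.log P := le_trans (by positivity) h3
        gcongr

/-- If the sieve conditions fail first at the least prime `p`, then `D` is not too large and `p` is
not too small, in terms of the number of primes. -/
lemma one_le_of_not_sieveAdmissible {S : Set ℕ} (hS : ∀ h ∈ S, 2 ≤ h → h - 2 ∈ S) {P D : ℝ}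
    (hP : 2 ≤ P) (hD : P ^ 202 < D) {B : Finset ℕ} {p : ℕ} (hlp : ∀ q ∈ B, p < q)
    (hB : ∀ q ∈ insert p B, 2 ≤ q ∧ (q : ℝ) < P) (hadm : SieveAdmissible S 200 D B)
    (hnot : ¬ SieveAdmissible S 200 D (insert p B)) :
    1 ≤ Real.exp 20 * Real.exp (-(Real.log D / (10 * Real.log P))) *
      (2 ^ (B.card + 1) * (Real.log p / Real.log P) ^ 41) := by
  have hpB : p ∉ B := fun h => lt_irrefl _ (hlp p h)
  have hlogP : 0 < Real.log P := Real.log_pos (by linarith)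
  have hDP : 202 * Real.log P < Real.log D := by
    have := Real.log_lt_log (by positivity) hD
    rwa [Real.log_pow] at this
  have hself : (insert p B).filter (fun q => p ≤ q) = insert p B := by
    refine Finset.filter_true_of_mem fun q hq => ?_
    rcases Finset.mem_insert.1 hq with rfl | hq
    · exact le_rfl
    · exact (hlp q hq).le
  unfold SieveAdmissible at hnot
  push Not at hnot
  obtain ⟨x, hx, hxS, hxD⟩ := hnot
  -- The conditions at the primes of `B` hold by admissibility of `B`, so the failure is at p.
  have hxp : x = p := by
    rcases Finset.mem_insert.1 hx with rfl | hxB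
    · rfl
    · rw [filter_le_insert_of_lt (hlp x hxB)] at hxS hxD
      exact absurd (hadm x hxB hxS) (not_lt.2 hxD)
  subst hxp
  rw [hself] at hxS hxD
  have hpos : ∀ q ∈ insert x B, (0 : ℝ) < q := fun q hq => by
    have := (hB q hq).1
    positivity
  have hlog : Real.log D ≤ ∑ q ∈ insert x B, Real.log q + 200 * Real.log x := by
    have h1 : (0 : ℝ) < ((∏ y ∈ insert x B, y : ℕ) : ℝ) := by
      push_cast
      exact Finset.prod_pos hpos
    have h2 := hpos x (Finset.mem_insert_self _ _)
    have := Real.log_le_log (lt_trans (by positivity) hD) hxD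
    rw [Real.log_mul (by positivity) (by positivity), Real.log_pow] at this
    push_cast at this
    rwa [Real.log_prod (fun y hy => (hpos y hy).ne')] at this
  have hcard : (insert x B).card = B.card + 1 := Finset.card_insert_of_notMem hpB
  have hltP : ∀ q ∈ insert x B, Real.log q ≤ Real.log P := fun q hq =>
    Real.log_le_log (hpos q hq) (hB q hq).2.le
  have key := pow_mul_log_le_log_sub_sum hS hP hD _ (insert x B) rfl hxS hB
    (fun y hy ⟨z, hz, hzy⟩ hyS => by
      have hxy : x < y := by
        rcases Finset.mem_insert.1 hy with rfl | hyB
        · rcases Finset.mem_insert.1 hz with rfl | hzB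
          · exact absurd hzy (lt_irrefl _)
          · exact absurd (hzy.trans (hlp z hzB)) (lt_irrefl _)
        · exact hlp y hyB
      have hyB : y ∈ B := by
        rcases Finset.mem_insert.1 hy with rfl | hyB
        · exact absurd hxy (lt_irrefl _)
        · exact hyB
      rw [filter_le_insert_of_lt hxy] at hyS ⊢
      exact hadm y hyB hyS)
  rw [hcard] at key
  refine one_le_sieve_factor hP (by omega) ?_ ?_
  · have h1 : ∑ q ∈ insert x B, Real.log q ≤ (B.card + 1) * Real.log P := by
      refine (Finset.sum_le_sum hltP).trans ?_
      rw [Finset.sum_const, hcard, nsmul_eq_mul]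
      push_cast
      exact le_rfl
    have h2 := hltP x (Finset.mem_insert_self _ _)
    push_cast
    linarith
  -- The failed condition gives 200 log p ≥ log D - log ∏, which is at least the power of 99/100
  -- times log D, and log D > 202 log P.
  · have h3 : (0 : ℝ) < (99 / 100) ^ ((B.card + 1 + 1) / 2) := by positivity
    nlinarith

lemma sieveSum_betaSieveSet {S : Set ℕ} {β : ℕ} {D : ℝ} {𝒬 : Finset ℕ} (h𝒬 : ∀ p ∈ 𝒬, p.Prime)
    (k : ℤ) [DecidablePred (SieveAdmissible S β D)] :
    sieveSum (betaSieveSet S β D) 𝒬 k =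
      ∑ C ∈ (𝒬.filter (fun p : ℕ => (p : ℤ) ∣ k)).powerset,
        if SieveAdmissible S β D C then (-1 : ℝ) ^ C.card else 0 := by
  unfold sieveSum
  rw [Finset.sum_filter]
  refine Finset.sum_congr rfl fun C hC => ?_
  have : ∀ p ∈ C, p.Prime := fun p hp =>
    h𝒬 p (Finset.mem_filter.1 (Finset.mem_powerset.1 hC hp)).1
  simp only [prod_mem_betaSieveSet_iff this]

lemma sieveSum_of_forall_not_dvd {S : Set ℕ} {β : ℕ} {D : ℝ} {𝒬 : Finset ℕ}
    (h𝒬 : ∀ p ∈ 𝒬, p.Prime) {k : ℤ} (hk : ∀ p ∈ 𝒬, ¬ (p : ℤ) ∣ k) :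
    sieveSum (betaSieveSet S β D) 𝒬 k = 1 := by
  classical
  rw [sieveSum_betaSieveSet h𝒬, Finset.filter_false_of_mem hk]
  simp [SieveAdmissible]

/-- The beta sieve is small on the integers having a prime factor in `𝒬`. -/
lemma abs_sieveSum_le {S : Set ℕ} (hS : ∀ h ∈ S, 2 ≤ h → h - 2 ∈ S) {P D : ℝ}
    (hP : 2 ≤ P) (hD : P ^ 202 < D) {𝒬 : Finset ℕ} (h𝒬 : ∀ p ∈ 𝒬, p.Prime ∧ (p : ℝ) < P)
    {k : ℤ} {p : ℕ} (hp : p ∈ 𝒬) (hpk : (p : ℤ) ∣ k)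
    (hmin : ∀ q ∈ 𝒬, (q : ℤ) ∣ k → p ≤ q) :
    |sieveSum (betaSieveSet S 200 D) 𝒬 k| ≤
      Real.exp 20 * Real.exp (-(Real.log D / (10 * Real.log P))) *
        (3 ^ (𝒬.filter (fun q : ℕ => (q : ℤ) ∣ k)).card * (Real.log p / Real.log P) ^ 41) := by
  classical
  have hlogP : 0 < Real.log P := Real.log_pos (by linarith)
  have hlogp : 0 ≤ Real.log p := Real.log_natCast_nonneg p
  rw [sieveSum_betaSieveSet fun p hp => (h𝒬 p hp).1]
  set A := 𝒬.filter (fun q : ℕ => (q : ℤ) ∣ k) with hA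
  have hpA : p ∈ A := Finset.mem_filter.2 ⟨hp, hpk⟩
  have hins : A = insert p (A.erase p) := (Finset.insert_erase hpA).symm
  have hlt : ∀ q ∈ A.erase p, p < q := fun q hq => by
    rw [Finset.mem_erase] at hq
    have hq' := Finset.mem_filter.1 hq.2
    exact lt_of_le_of_ne (hmin q hq'.1 hq'.2) (Ne.symm hq.1)
  have hcard : A.card = (A.erase p).card + 1 := (Finset.card_erase_add_one hpA).symm
  -- Pair each set without the least prime p with the set obtained by adding p. The signs are
  -- opposite.
  rw [hcard, hins, Finset.sum_powerset_insert (Finset.notMem_erase _ _), ← Finset.sum_add_distrib,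
    ← hins]
  set E := Real.exp 20 * Real.exp (-(Real.log D / (10 * Real.log P))) with hE
  have hE0 : 0 < E := by positivity
  refine (Finset.abs_sum_le_sum_abs _ _).trans ?_
  have hterm : ∀ t ∈ (A.erase p).powerset,
      |(if SieveAdmissible S 200 D t then (-1 : ℝ) ^ t.card else 0) +
        (if SieveAdmissible S 200 D (insert p t) then (-1 : ℝ) ^ (insert p t).card else 0)| ≤
      E * (2 ^ (t.card + 1) * (Real.log p / Real.log P) ^ 41) := by
    intro t ht
    rw [Finset.mem_powerset] at ht
    have hpt : p ∉ t := fun h => Finset.notMem_erase _ _ (ht h)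
    have hltt : ∀ q ∈ t, p < q := fun q hq => hlt q (ht hq)
    have hnn : 0 ≤ E * (2 ^ (t.card + 1) * (Real.log p / Real.log P) ^ 41) := by positivity
    by_cases h1 : SieveAdmissible S 200 D t
    · by_cases h2 : SieveAdmissible S 200 D (insert p t)
      · rw [if_pos h1, if_pos h2, Finset.card_insert_of_notMem hpt, pow_succ]
        simpa using hnn
      -- This is the only surviving case: p causes the first failure, so the term of modulus 1 can
      -- be dominated.
      · rw [if_pos h1, if_neg h2, add_zero, abs_pow, abs_neg, abs_one, one_pow]
        refine one_le_of_not_sieveAdmissible hS hP hD hltt (fun q hq => ?_) h1 h2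
        have : q ∈ 𝒬 := by
          rcases Finset.mem_insert.1 hq with rfl | hq
          · exact hp
          · exact (Finset.mem_filter.1 (Finset.mem_of_mem_erase (ht hq))).1
        exact ⟨(h𝒬 q this).1.two_le, (h𝒬 q this).2⟩
    · have h2 : ¬ SieveAdmissible S 200 D (insert p t) := fun h => h1 (h.of_insert hltt)
      rw [if_neg h1, if_neg h2]
      simpa using hnn
  refine (Finset.sum_le_sum hterm).trans ?_
  -- The binomial theorem turns the weight 2 per prime into 3 per prime of `A.erase p`. The prime p
  -- contributes only 2 ≤ 3.
  have h3 : ∑ t ∈ (A.erase p).powerset, (2 : ℝ) ^ t.card = 3 ^ (A.erase p).card := by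
    have := Finset.sum_pow_mul_eq_add_pow (2 : ℝ) 1 (A.erase p)
    norm_num at this
    exact this
  calc ∑ t ∈ (A.erase p).powerset, E * (2 ^ (t.card + 1) * (Real.log p / Real.log P) ^ 41)
      = E * (2 * (∑ t ∈ (A.erase p).powerset, (2 : ℝ) ^ t.card) *
          (Real.log p / Real.log P) ^ 41) := by
        rw [Finset.mul_sum, Finset.sum_mul, Finset.mul_sum]
        exact Finset.sum_congr rfl fun t _ => by ring
    _ ≤ _ := by
        rw [h3]
        gcongr
        rw [pow_succ]
        nlinarith [pow_pos (by norm_num : (0 : ℝ) < 3) (A.erase p).card]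

/-! ### Pointwise comparison for the product of four sieves -/

/-- The four linear forms `n, n + 2, m - n, m - n + 2`. -/
def sieveForm (m n : ℤ) : Fin 4 → ℤ := ![n, n + 2, m - n, m - n + 2]

/-- `p` divides none of `n, n + 2, m - n, m - n + 2`. -/
def FreeAt (m : ℤ) (p : ℕ) (n : ℤ) : Prop := ∀ i, ¬ (p : ℤ) ∣ sieveForm m n i

instance (m : ℤ) (p : ℕ) (n : ℤ) : Decidable (FreeAt m p n) :=
  inferInstanceAs (Decidable (∀ i, ¬ (p : ℤ) ∣ sieveForm m n i))

/-- The number of the forms `n, n + 2, m - n, m - n + 2` that `p` divides. -/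
def dvdCount (m : ℤ) (p : ℕ) (n : ℤ) : ℕ :=
  (Finset.univ.filter (fun i => (p : ℤ) ∣ sieveForm m n i)).card

/-- The local factor at `q` of the majorant for integers all of whose forms are free of primes
smaller than `p`, while `p` divides one of them. -/
noncomputable def majorantFactor (m : ℤ) (p q : ℕ) (n : ℤ) : ℝ :=
  if q < p then (if FreeAt m q n then 1 else 0)
  else if q = p then (if FreeAt m q n then 0 else 3 ^ dvdCount m q n)
  else 3 ^ dvdCount m q n

lemma majorantFactor_nonneg (m : ℤ) (p q : ℕ) (n : ℤ) : 0 ≤ majorantFactor m p q n := by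
  unfold majorantFactor
  split_ifs <;> positivity

/-- Telescoping: replace one factor at a time. In the application t is the beta sieve, o the exact
sieve and w a common majorant. -/
lemma abs_prod_sub_prod_le {ι : Type*} (s : Finset ι) (t o w : ι → ℝ) {δ : ℝ} (hδ : 0 ≤ δ)
    (ho : ∀ i ∈ s, |o i| ≤ w i) (ht : ∀ i ∈ s, |t i - o i| ≤ δ * w i) :
    |∏ i ∈ s, t i - ∏ i ∈ s, o i| ≤ ((1 + δ) ^ s.card - 1) * ∏ i ∈ s, w i := by
  classical
  induction s using Finset.induction_on with
  | empty => simp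
  | insert a s ha ih =>
    have ih' := ih (fun i hi => ho i (Finset.mem_insert_of_mem hi))
      (fun i hi => ht i (Finset.mem_insert_of_mem hi))
    have hoa := ho a (Finset.mem_insert_self _ _)
    have hta := ht a (Finset.mem_insert_self _ _)
    have hw : 0 ≤ w a := (abs_nonneg _).trans hoa
    have hO : |∏ i ∈ s, o i| ≤ ∏ i ∈ s, w i := by
      rw [Finset.abs_prod]
      exact Finset.prod_le_prod (fun _ _ => abs_nonneg _)
        fun i hi => ho i (Finset.mem_insert_of_mem hi)
    have hW : 0 ≤ ∏ i ∈ s, w i := (abs_nonneg _).trans hO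
    have hT : |∏ i ∈ s, t i| ≤ (1 + δ) ^ s.card * ∏ i ∈ s, w i := by
      have := abs_add_le (∏ i ∈ s, t i - ∏ i ∈ s, o i) (∏ i ∈ s, o i)
      rw [sub_add_cancel] at this
      linarith
    rw [Finset.prod_insert ha, Finset.prod_insert ha, Finset.prod_insert ha,
      Finset.card_insert_of_notMem ha,
      show t a * ∏ i ∈ s, t i - o a * ∏ i ∈ s, o i =
        (t a - o a) * ∏ i ∈ s, t i + o a * (∏ i ∈ s, t i - ∏ i ∈ s, o i) by ring]
    refine (abs_add_le _ _).trans ?_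
    rw [abs_mul, abs_mul]
    calc _ ≤ δ * w a * ((1 + δ) ^ s.card * ∏ i ∈ s, w i) +
          w a * (((1 + δ) ^ s.card - 1) * ∏ i ∈ s, w i) := by gcongr
      _ = _ := by ring

lemma prod_three_pow_dvdCount (m n : ℤ) (𝒬 : Finset ℕ) :
    ∏ i, (3 : ℝ) ^ (𝒬.filter (fun q : ℕ => (q : ℤ) ∣ sieveForm m n i)).card =
      ∏ q ∈ 𝒬, (3 : ℝ) ^ dvdCount m q n := by
  rw [Finset.prod_pow_eq_pow_sum, Finset.prod_pow_eq_pow_sum]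
  congr 1
  simp only [dvdCount, Finset.card_filter]
  exact Finset.sum_comm

/-- Pointwise comparison of a product of four beta sieves with the product of four exact sieves. -/
lemma abs_prod_sieveSum_sub_le {S : Fin 4 → Set ℕ} (hS : ∀ i, ∀ h ∈ S i, 2 ≤ h → h - 2 ∈ S i)
    {P D : ℝ} (hP : 2 ≤ P) (hD : P ^ 202 < D) {𝒬 : Finset ℕ}
    (h𝒬 : ∀ p ∈ 𝒬, p.Prime ∧ (p : ℝ) < P) (m n : ℤ) :
    |∏ i, sieveSum (betaSieveSet (S i) 200 D) 𝒬 (sieveForm m n i) -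
        ∏ q ∈ 𝒬, (if FreeAt m q n then 1 else 0)| ≤
      (2 + Real.exp 20) ^ 4 * Real.exp (-(Real.log D / (10 * Real.log P))) *
        ∑ p ∈ 𝒬, (Real.log p / Real.log P) ^ 41 * ∏ q ∈ 𝒬, majorantFactor m p q n := by
  classical
  have hlogP : 0 < Real.log P := Real.log_pos (by linarith)
  have hDP : 202 * Real.log P < Real.log D := by
    have := Real.log_lt_log (by positivity) hD
    rwa [Real.log_pow] at this
  have hprimes : ∀ p ∈ 𝒬, p.Prime := fun p hp => (h𝒬 p hp).1
  have hφ : ∀ p ∈ 𝒬, 0 ≤ Real.log p / Real.log P ∧ Real.log p / Real.log P ≤ 1 := fun p hp => by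
    have hp2 : (0 : ℝ) < p := by exact_mod_cast (h𝒬 p hp).1.pos
    refine ⟨div_nonneg (Real.log_natCast_nonneg p) hlogP.le, (div_le_one hlogP).2 ?_⟩
    exact Real.log_le_log hp2 (h𝒬 p hp).2.le
  have hRHS : ∀ p ∈ 𝒬, 0 ≤ (Real.log p / Real.log P) ^ 41 * ∏ q ∈ 𝒬, majorantFactor m p q n :=
    fun p hp => mul_nonneg (pow_nonneg (hφ p hp).1 _)
      (Finset.prod_nonneg fun q _ => majorantFactor_nonneg m p q n)
  by_cases hall : ∀ q ∈ 𝒬, FreeAt m q n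
  · rw [Finset.prod_congr rfl (fun q hq => if_pos (hall q hq)), Finset.prod_const_one,
      Finset.prod_congr rfl (fun i _ => sieveSum_of_forall_not_dvd hprimes
        (fun q hq => hall q hq i)), Finset.prod_const_one, sub_self, abs_zero]
    exact mul_nonneg (by positivity) (Finset.sum_nonneg hRHS)
  set U := 𝒬.filter (fun q => ¬ FreeAt m q n) with hU
  have hUne : U.Nonempty := by
    push Not at hall
    obtain ⟨q, hq, hq'⟩ := hall
    exact ⟨q, Finset.mem_filter.2 ⟨hq, hq'⟩⟩
  set p := U.min' hUne with hpdef
  have hpU : p ∈ U := U.min'_mem hUne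
  obtain ⟨hp𝒬, hpn⟩ := Finset.mem_filter.1 hpU
  have hpmin : ∀ q ∈ 𝒬, ¬ FreeAt m q n → p ≤ q := fun q hq hq' =>
    U.min'_le q (Finset.mem_filter.2 ⟨hq, hq'⟩)
  set A : Fin 4 → Finset ℕ := fun i => 𝒬.filter (fun q : ℕ => (q : ℤ) ∣ sieveForm m n i) with hA
  -- The default value 1 is for a form free of sieving primes, where the exact sieve equals 1 and
  -- the majorant must not be smaller.
  set μ : Fin 4 → ℝ := fun i =>
    if h : (A i).Nonempty then (Real.log ((A i).min' h : ℕ) / Real.log P) ^ 41 else 1 with hμ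
  have hμ0 : ∀ i, 0 ≤ μ i ∧ μ i ≤ 1 := fun i => by
    simp only [hμ]
    split_ifs with h
    · have hmem := (Finset.mem_filter.1 ((A i).min'_mem h)).1
      exact ⟨pow_nonneg (hφ _ hmem).1 _, pow_le_one₀ (hφ _ hmem).1 (hφ _ hmem).2⟩
    · exact ⟨zero_le_one, le_rfl⟩
  obtain ⟨i₀, hi₀⟩ : ∃ i, (p : ℤ) ∣ sieveForm m n i := by
    unfold FreeAt at hpn
    push Not at hpn
    exact hpn
  have hμp : μ i₀ = (Real.log p / Real.log P) ^ 41 := by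
    have hpA : p ∈ A i₀ := Finset.mem_filter.2 ⟨hp𝒬, hi₀⟩
    have hne : (A i₀).Nonempty := ⟨p, hpA⟩
    simp only [hμ]
    rw [dif_pos hne]
    have : (A i₀).min' hne = p := by
      refine le_antisymm ((A i₀).min'_le p hpA) ?_
      refine (A i₀).le_min' hne p fun q hq => ?_
      obtain ⟨hq1, hq2⟩ := Finset.mem_filter.1 hq
      exact hpmin q hq1 fun h => h i₀ hq2
    rw [this]
  set ε := Real.exp (-(Real.log D / (10 * Real.log P))) with hε
  have hε0 : 0 < ε := Real.exp_pos _
  have hε1 : ε ≤ 1 := by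
    rw [hε, Real.exp_le_one_iff, neg_nonpos]
    have : 0 < Real.log D := by linarith
    positivity
  have h01 : ∀ q ∈ 𝒬, (if FreeAt m q n then (1 : ℝ) else 0) =
      ∏ i, (if (q : ℤ) ∣ sieveForm m n i then (0 : ℝ) else 1) := fun q _ => by
    split_ifs with h
    · exact (Finset.prod_eq_one fun i _ => if_neg (h i)).symm
    · unfold FreeAt at h
      push Not at h
      obtain ⟨i, hi⟩ := h
      refine (Finset.prod_eq_zero (Finset.mem_univ i) ?_).symm
      exact if_pos hi
  rw [Finset.prod_congr rfl h01, Finset.prod_comm]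
  have hz : ∀ i, ∀ q ∈ 𝒬, (q : ℤ) ∣ sieveForm m n i →
      ∏ q ∈ 𝒬, (if (q : ℤ) ∣ sieveForm m n i then (0 : ℝ) else 1) = 0 := fun i q hq hd => by
    refine Finset.prod_eq_zero hq ?_
    exact if_pos hd
  have hμw : ∀ i, (0 : ℝ) ≤ 3 ^ (A i).card * μ i := fun i => by
    have := (hμ0 i).1
    positivity
  have hmain := abs_prod_sub_prod_le (Finset.univ : Finset (Fin 4))
    (fun i => sieveSum (betaSieveSet (S i) 200 D) 𝒬 (sieveForm m n i))
    (fun i => ∏ q ∈ 𝒬, (if (q : ℤ) ∣ sieveForm m n i then (0 : ℝ) else 1))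
    (fun i => 3 ^ (A i).card * μ i) (δ := Real.exp 20 * ε) (by positivity)
    (fun i _ => by
      by_cases hne : (A i).Nonempty
      · obtain ⟨q, hq⟩ := hne
        obtain ⟨hq1, hq2⟩ := Finset.mem_filter.1 hq
        rw [hz i q hq1 hq2, abs_zero]
        exact hμw i
      · simp only [hμ]
        rw [dif_neg hne, mul_one]
        rw [Finset.not_nonempty_iff_eq_empty] at hne
        rw [hne, Finset.card_empty, pow_zero, Finset.prod_eq_one, abs_one]
        intro q hq
        refine if_neg fun hd => ?_
        have : q ∈ A i := Finset.mem_filter.2 ⟨hq, hd⟩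
        simp [hne] at this)
    (fun i _ => by
      by_cases hne : (A i).Nonempty
      · have hmem := Finset.mem_filter.1 ((A i).min'_mem hne)
        rw [hz i _ hmem.1 hmem.2, sub_zero]
        simp only [hμ]
        rw [dif_pos hne]
        exact abs_sieveSum_le (hS i) hP hD h𝒬 hmem.1 hmem.2 fun q hq hq' =>
          (A i).min'_le q (Finset.mem_filter.2 ⟨hq, hq'⟩)
      · rw [Finset.not_nonempty_iff_eq_empty] at hne
        have hnd : ∀ q ∈ 𝒬, ¬ (q : ℤ) ∣ sieveForm m n i := fun q hq hd => by
          have : q ∈ A i := Finset.mem_filter.2 ⟨hq, hd⟩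
          simp [hne] at this
        rw [sieveSum_of_forall_not_dvd hprimes hnd, Finset.prod_eq_one
          (fun q hq => if_neg (hnd q hq)), sub_self, abs_zero]
        have := hμw i
        positivity)
  refine hmain.trans ?_
  -- As ε ≤ 1, all higher powers of ε are absorbed into the linear one.
  have hc : (1 + Real.exp 20 * ε) ^ (Finset.univ : Finset (Fin 4)).card - 1 ≤
      (2 + Real.exp 20) ^ 4 * ε := by
    rw [Finset.card_univ, Fintype.card_fin]
    have hK : 0 < Real.exp 20 := Real.exp_pos _
    generalize Real.exp 20 = K at hK
    have e2 : ε ^ 2 ≤ ε := by nlinarith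
    have e3 : ε ^ 3 ≤ ε := by nlinarith
    have e4 : ε ^ 4 ≤ ε := by nlinarith
    calc (1 + K * ε) ^ 4 - 1 = 4 * K * ε + 6 * K ^ 2 * ε ^ 2 + 4 * K ^ 3 * ε ^ 3 + K ^ 4 * ε ^ 4 := by
          ring
      _ ≤ 4 * K * ε + 6 * K ^ 2 * ε + 4 * K ^ 3 * ε + K ^ 4 * ε := by gcongr
      _ ≤ (2 + K) ^ 4 * ε := by
          rw [← add_mul, ← add_mul, ← add_mul]
          gcongr
          have : 0 < K ^ 2 := by positivity
          have : 0 < K ^ 3 := by positivity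
          nlinarith
  have hw : ∏ i, (3 ^ (A i).card * μ i) ≤
      (Real.log p / Real.log P) ^ 41 * ∏ q ∈ 𝒬, majorantFactor m p q n := by
    rw [Finset.prod_mul_distrib, prod_three_pow_dvdCount, mul_comm]
    -- Only the form containing the overall least prime p is used. The other three weights are at
    -- most 1.
    have h1 : ∏ i, μ i ≤ (Real.log p / Real.log P) ^ 41 := by
      rw [← Finset.mul_prod_erase _ _ (Finset.mem_univ i₀), hμp]
      refine mul_le_of_le_one_right (pow_nonneg (hφ p hp𝒬).1 _) ?_
      exact Finset.prod_le_one (fun i _ => (hμ0 i).1) fun i _ => (hμ0 i).2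
    have h2 : ∏ q ∈ 𝒬, (3 : ℝ) ^ dvdCount m q n = ∏ q ∈ 𝒬, majorantFactor m p q n := by
      refine Finset.prod_congr rfl fun q hq => ?_
      unfold majorantFactor
      split_ifs with h3 h4 h5 h6
      · have : dvdCount m q n = 0 := by
          rw [dvdCount, Finset.card_eq_zero]
          exact Finset.filter_false_of_mem fun i _ => h4 i
        rw [this, pow_zero]
      · exact absurd (hpmin q hq h4) (by omega)
      · subst h5
        exact absurd h6 hpn
      · rfl
      · rfl
    rw [h2]
    refine mul_le_mul_of_nonneg_right h1 (Finset.prod_nonneg fun q _ => ?_)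
    exact majorantFactor_nonneg m p q n
  refine mul_le_mul hc (hw.trans ?_) (Finset.prod_nonneg fun i _ => hμw i) (by positivity)
  exact Finset.single_le_sum hRHS hp𝒬

/-! ### Sums over a period -/

lemma Function.Periodic.int_add_mul {β : Type*} {F : ℤ → β} {M : ℤ} (hF : Function.Periodic F M)
    (n k : ℤ) : F (n + M * k) = F n := by
  have := hF.zsmul k n
  rwa [smul_eq_mul, mul_comm] at this

lemma Function.Periodic.int_map_mod_nat {β : Type*} {F : ℤ → β} {M : ℕ}
    (hF : Function.Periodic F (M : ℤ)) (n : ℕ) : F ((n % M : ℕ) : ℤ) = F n := by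
  have h := hF.int_add_mul ((n % M : ℕ) : ℤ) ((n / M : ℕ) : ℤ)
  rw [← h]
  congr 1
  exact_mod_cast Nat.mod_add_div n M

/-- The Chinese remainder theorem for sums over a period. -/
lemma sum_range_mul_of_coprime {R : Type*} [CommSemiring R] {a b : ℕ} (hab : Nat.Coprime a b)
    {F G : ℤ → R} (hF : Function.Periodic F (a : ℤ)) (hG : Function.Periodic G (b : ℤ)) :
    ∑ n ∈ Finset.range (a * b), F n * G n =
      (∑ n ∈ Finset.range a, F n) * ∑ n ∈ Finset.range b, G n := by
  rw [Finset.sum_mul_sum, ← Finset.sum_product']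
  rcases Nat.eq_zero_or_pos a with rfl | ha
  · simp
  rcases Nat.eq_zero_or_pos b with rfl | hb
  · simp
  refine Finset.sum_nbij' (fun n => (n % a, n % b))
    (fun x => (Nat.chineseRemainder hab x.1 x.2 : ℕ)) ?_ ?_ ?_ ?_ ?_
  · intro n _
    exact Finset.mem_product.2 ⟨Finset.mem_range.2 (Nat.mod_lt _ ha),
      Finset.mem_range.2 (Nat.mod_lt _ hb)⟩
  · intro x _
    exact Finset.mem_range.2 (Nat.chineseRemainder_lt_mul hab _ _ ha.ne' hb.ne')
  · intro n hn
    rw [Finset.mem_range] at hn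
    have h := Nat.chineseRemainder_modEq_unique hab (a := n % a) (b := n % b) (z := n)
      (Nat.mod_modEq n a).symm (Nat.mod_modEq n b).symm
    have h' := h.symm
    unfold Nat.ModEq at h'
    rwa [Nat.mod_eq_of_lt hn, Nat.mod_eq_of_lt (Nat.chineseRemainder_lt_mul hab _ _ ha.ne' hb.ne')]
      at h'
  · intro x hx
    obtain ⟨h1, h2⟩ := Finset.mem_product.1 hx
    rw [Finset.mem_range] at h1 h2
    have h := (Nat.chineseRemainder hab x.1 x.2).2
    refine Prod.ext ?_ ?_
    · exact Eq.trans (b := x.1 % a) h.1 (Nat.mod_eq_of_lt h1)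
    · exact Eq.trans (b := x.2 % b) h.2 (Nat.mod_eq_of_lt h2)
  · intro n _
    simp only
    rw [hF.int_map_mod_nat, hG.int_map_mod_nat]

/-- Induction on the set of primes, separating one coprime modulus at a time. This is the form of
independence used for both the main term and the majorant. -/
lemma sum_range_mul_prod {R : Type*} [CommSemiring R] {M : ℕ} {h : ℤ → R}
    (hh : Function.Periodic h (M : ℤ)) {𝒬 : Finset ℕ} (h𝒬 : ∀ p ∈ 𝒬, p.Prime)
    (hM : ∀ p ∈ 𝒬, Nat.Coprime M p) {F : ℕ → ℤ → R}
    (hF : ∀ p ∈ 𝒬, Function.Periodic (F p) (p : ℤ)) :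
    ∑ n ∈ Finset.range (M * ∏ p ∈ 𝒬, p), h n * ∏ p ∈ 𝒬, F p n =
      (∑ n ∈ Finset.range M, h n) * ∏ p ∈ 𝒬, ∑ n ∈ Finset.range p, F p n := by
  classical
  induction 𝒬 using Finset.induction_on with
  | empty => simp
  | insert a s ha ih =>
    have ih' := ih (fun p hp => h𝒬 p (Finset.mem_insert_of_mem hp))
      (fun p hp => hM p (Finset.mem_insert_of_mem hp))
      (fun p hp => hF p (Finset.mem_insert_of_mem hp))
    have hcop : Nat.Coprime (M * ∏ p ∈ s, p) a := by
      refine Nat.Coprime.mul_left (hM a (Finset.mem_insert_self _ _)) ?_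
      refine Nat.Coprime.prod_left fun p hp => ?_
      refine (Nat.coprime_primes (h𝒬 p (Finset.mem_insert_of_mem hp))
        (h𝒬 a (Finset.mem_insert_self _ _))).2 ?_
      rintro rfl
      exact ha hp
    have hper : Function.Periodic (fun n => h n * ∏ p ∈ s, F p n)
        ((M * ∏ p ∈ s, p : ℕ) : ℤ) := by
      intro n
      simp only
      congr 1
      · rw [Nat.cast_mul]
        exact hh.int_add_mul n _
      · refine Finset.prod_congr rfl fun p hp => ?_
        obtain ⟨k, hk⟩ := (Finset.dvd_prod_of_mem (fun p : ℕ => p) hp).mul_left M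
        rw [hk, Nat.cast_mul]
        exact (hF p (Finset.mem_insert_of_mem hp)).int_add_mul n _
    have := sum_range_mul_of_coprime hcop hper (hF a (Finset.mem_insert_self _ _))
    rw [Finset.prod_insert ha, Finset.prod_insert ha, mul_comm a, ← mul_assoc M,
      mul_left_comm, mul_comm (∑ n ∈ Finset.range a, F a n), ← ih', ← this]
    refine Finset.sum_congr rfl fun n _ => ?_
    rw [Finset.prod_insert ha]
    ring

/-! ### Local densities -/

/-- The number of residues `n` modulo `p` such that `p` divides none of the forms. -/
def freeCount (m : ℤ) (p : ℕ) : ℕ := ((Finset.range p).filter (fun n : ℕ => FreeAt m p n)).card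

/-- The zeros modulo `p` of the forms. -/
def formRoots (m : ℤ) (p : ℕ) : Finset (ZMod p) := {0, -2, (m : ZMod p), (m : ZMod p) + 2}

lemma forall_sieveForm {m n : ℤ} {Q : ℤ → Prop} :
    (∀ i, Q (sieveForm m n i)) ↔ Q n ∧ Q (n + 2) ∧ Q (m - n) ∧ Q (m - n + 2) := by
  constructor
  · intro h
    exact ⟨h 0, h 1, h 2, h 3⟩
  · rintro ⟨h0, h1, h2, h3⟩ i
    fin_cases i
    exacts [h0, h1, h2, h3]

lemma freeAt_iff {m : ℤ} {p : ℕ} {n : ℤ} : FreeAt m p n ↔ (n : ZMod p) ∉ formRoots m p := by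
  unfold FreeAt formRoots
  rw [forall_sieveForm (Q := fun k => ¬ (p : ℤ) ∣ k)]
  simp only [← ZMod.intCast_zmod_eq_zero_iff_dvd, Finset.mem_insert, Finset.mem_singleton,
    not_or]
  push_cast
  refine and_congr_right' (and_congr ?_ (and_congr ?_ ?_))
  · rw [eq_neg_iff_add_eq_zero]
  · rw [sub_eq_zero, eq_comm]
  · rw [← sub_eq_zero (a := (n : ZMod p)), ← neg_eq_zero]
    ring_nf

lemma sum_range_eq_sum_zmod {R : Type*} [AddCommMonoid R] (r : ℕ) [NeZero r] (g : ZMod r → R) :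
    ∑ n ∈ Finset.range r, g (n : ZMod r) = ∑ x : ZMod r, g x := by
  refine Finset.sum_nbij' (fun n => (n : ZMod r)) ZMod.val ?_ ?_ ?_ ?_ ?_
  · exact fun _ _ => Finset.mem_univ _
  · exact fun x _ => Finset.mem_range.2 (ZMod.val_lt x)
  · exact fun n hn => ZMod.val_cast_of_lt (Finset.mem_range.1 hn)
  · exact fun x _ => ZMod.natCast_zmod_val x
  · exact fun _ _ => rfl

lemma freeCount_add_card_formRoots (m : ℤ) (p : ℕ) [NeZero p] :
    freeCount m p + (formRoots m p).card = p := by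
  have h1 : freeCount m p = ((formRoots m p)ᶜ).card := by
    unfold freeCount
    rw [Finset.card_filter]
    have := sum_range_eq_sum_zmod p (fun x => if x ∈ (formRoots m p)ᶜ then 1 else 0)
    rw [Finset.sum_ite_mem, Finset.univ_inter, Finset.sum_const, smul_eq_mul, mul_one] at this
    rw [← this]
    refine Finset.sum_congr rfl fun n _ => ?_
    simp only [freeAt_iff, Finset.mem_compl, Int.cast_natCast]
  rw [h1, Finset.card_compl_add_card, ZMod.card]

lemma card_formRoots_le (m : ℤ) (p : ℕ) : (formRoots m p).card ≤ 4 := Finset.card_le_four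

lemma FreeAt.periodic (m : ℤ) (p : ℕ) : Function.Periodic (FreeAt m p) (p : ℤ) := fun n => by
  simp only [freeAt_iff]
  push_cast
  rw [ZMod.natCast_self, add_zero]

lemma dvd_sieveForm_add_mul {m n : ℤ} {d : ℤ} {i : Fin 4} (k : ℤ) :
    d ∣ sieveForm m (n + d * k) i ↔ d ∣ sieveForm m n i := by
  fin_cases i
  · exact dvd_add_left (dvd_mul_right d k)
  · change d ∣ n + d * k + 2 ↔ d ∣ n + 2
    rw [add_right_comm]
    exact dvd_add_left (dvd_mul_right d k)
  · change d ∣ m - (n + d * k) ↔ d ∣ m - n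
    rw [← sub_sub]
    exact dvd_sub_left (dvd_mul_right d k)
  · change d ∣ m - (n + d * k) + 2 ↔ d ∣ m - n + 2
    rw [show m - (n + d * k) + 2 = m - n + 2 - d * k by ring]
    exact dvd_sub_left (dvd_mul_right d k)

lemma dvdCount_periodic (m : ℤ) (p : ℕ) : Function.Periodic (dvdCount m p) (p : ℤ) := fun n => by
  unfold dvdCount
  congr 1
  refine Finset.filter_congr fun i _ => ?_
  have := dvd_sieveForm_add_mul (m := m) (n := n) (d := (p : ℤ)) (i := i) 1
  rwa [mul_one] at this

lemma majorantFactor_periodic (m : ℤ) (p q : ℕ) :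
    Function.Periodic (majorantFactor m p q) (q : ℤ) := fun n => by
  unfold majorantFactor
  simp only [FreeAt.periodic m q n, dvdCount_periodic m q n]

lemma dvdCount_eq_zero {m : ℤ} {p : ℕ} {n : ℤ} (h : FreeAt m p n) : dvdCount m p n = 0 := by
  rw [dvdCount, Finset.card_eq_zero]
  exact Finset.filter_false_of_mem fun i _ => h i

/-- The forms come in two pairs with difference 2, and such a p divides at most one form of each
pair. -/
lemma dvdCount_le_two (m : ℤ) {p : ℕ} (hp : 5 ≤ p) (n : ℤ) : dvdCount m p n ≤ 2 := by
  have h2 : ∀ k : ℤ, (p : ℤ) ∣ k → (p : ℤ) ∣ k + 2 → False := fun k h1 h2 => by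
    have := Int.le_of_dvd (by norm_num) ((dvd_add_right h1).1 h2)
    omega
  have h01 : ¬ ((p : ℤ) ∣ n ∧ (p : ℤ) ∣ n + 2) := fun h => h2 _ h.1 h.2
  have h23 : ¬ ((p : ℤ) ∣ m - n ∧ (p : ℤ) ∣ m - n + 2) := fun h => h2 _ h.1 h.2
  unfold dvdCount
  rw [Finset.card_filter, Fin.sum_univ_four]
  change (if (p : ℤ) ∣ n then 1 else 0) + (if (p : ℤ) ∣ n + 2 then 1 else 0) +
    (if (p : ℤ) ∣ m - n then 1 else 0) + (if (p : ℤ) ∣ m - n + 2 then 1 else 0) ≤ 2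
  split_ifs <;> omega

lemma card_not_freeAt (m : ℤ) (p : ℕ) [NeZero p] :
    ((Finset.range p).filter (fun n : ℕ => ¬ FreeAt m p n)).card = (formRoots m p).card := by
  have h1 := freeCount_add_card_formRoots m p
  have h2 := Finset.card_filter_add_card_filter_not (s := Finset.range p)
    (fun n : ℕ => FreeAt m p n)
  rw [Finset.card_range] at h2
  unfold freeCount at h1
  omega

lemma sum_not_freeAt_le (m : ℤ) {p : ℕ} (hp : 5 ≤ p) :
    ∑ n ∈ Finset.range p, (if FreeAt m p n then (0 : ℝ) else 3 ^ dvdCount m p n) ≤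
      9 * (formRoots m p).card := by
  have : NeZero p := ⟨by omega⟩
  rw [← card_not_freeAt, Finset.card_filter]
  push_cast
  rw [Finset.mul_sum]
  refine Finset.sum_le_sum fun n _ => ?_
  split_ifs with h
  · simp
  · calc (3 : ℝ) ^ dvdCount m p n ≤ 3 ^ 2 :=
        pow_le_pow_right₀ (by norm_num) (dvdCount_le_two m hp n)
      _ = _ := by norm_num

/-- At most four classes carry a weight of at most 9 instead of 1, an excess of at most 4 · 8 = 32.
-/
lemma sum_three_pow_dvdCount_le (m : ℤ) {p : ℕ} (hp : 5 ≤ p) :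
    ∑ n ∈ Finset.range p, (3 : ℝ) ^ dvdCount m p n ≤ p + 32 := by
  have : NeZero p := ⟨by omega⟩
  have h1 : ∑ n ∈ Finset.range p, (3 : ℝ) ^ dvdCount m p n =
      freeCount m p +
        ∑ n ∈ Finset.range p, (if FreeAt m p n then (0 : ℝ) else 3 ^ dvdCount m p n) := by
    unfold freeCount
    rw [Finset.card_filter]
    push_cast
    rw [← Finset.sum_add_distrib]
    refine Finset.sum_congr rfl fun n _ => ?_
    split_ifs with h
    · rw [dvdCount_eq_zero h]; norm_num
    · rw [zero_add]
  have h2 : (freeCount m p : ℝ) + (formRoots m p).card = p := by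
    exact_mod_cast freeCount_add_card_formRoots m p
  have h3 : ((formRoots m p).card : ℝ) ≤ 4 := by exact_mod_cast card_formRoots_le m p
  have := sum_not_freeAt_le m hp
  linarith

/-- With y = 1/q this bounds a density 1 - 4/q below by a power of the Euler factor. The worst case
is q = 5, where the exponent 7 would not be enough. -/
lemma one_sub_pow_eight_le {y : ℝ} (h0 : 0 ≤ y) (h1 : y ≤ 1 / 5) : (1 - y) ^ 8 ≤ 1 - 4 * y := by
  have e1 : (1 - y) ^ 2 ≤ 1 - 9 / 5 * y := by nlinarith
  have e2 : ((1 - y) ^ 2) ^ 2 ≤ 1 - 29 / 10 * y := by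
    calc ((1 - y) ^ 2) ^ 2 ≤ (1 - 9 / 5 * y) ^ 2 := by gcongr
      _ ≤ _ := by nlinarith
  calc (1 - y) ^ 8 = (((1 - y) ^ 2) ^ 2) ^ 2 := by ring
    _ ≤ (1 - 29 / 10 * y) ^ 2 := by gcongr
    _ ≤ _ := by nlinarith

lemma one_le_freeCount_mul {m : ℤ} {q : ℕ} (hq : 5 ≤ q) :
    (q : ℝ) ≤ freeCount m q * ((1 - 1 / (q : ℝ))⁻¹) ^ 8 := by
  have : NeZero q := ⟨by omega⟩
  have hq5 : (5 : ℝ) ≤ q := by exact_mod_cast hq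
  have h2 : (freeCount m q : ℝ) + (formRoots m q).card = q := by
    exact_mod_cast freeCount_add_card_formRoots m q
  have h3 : ((formRoots m q).card : ℝ) ≤ 4 := by exact_mod_cast card_formRoots_le m q
  have hy : 1 / (q : ℝ) ≤ 1 / 5 := one_div_le_one_div_of_le (by norm_num) hq5
  have h4 := one_sub_pow_eight_le (y := 1 / (q : ℝ)) (by positivity) hy
  have h5 : 0 < 1 - 1 / (q : ℝ) := by linarith
  rw [inv_pow, ← div_eq_mul_inv, le_div_iff₀ (by positivity)]
  calc (q : ℝ) * (1 - 1 / (q : ℝ)) ^ 8 ≤ q * (1 - 4 * (1 / (q : ℝ))) := by gcongr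
    _ = q - 4 := by field_simp
    _ ≤ _ := by linarith

/-- The exponent is 40 = 8 + 32: eight powers for the excluded classes, and 32 for the excess weight
by Bernoulli's inequality. -/
lemma add_le_freeCount_mul {m : ℤ} {q : ℕ} (hq : 5 ≤ q) :
    (q : ℝ) + 32 ≤ freeCount m q * ((1 - 1 / (q : ℝ))⁻¹) ^ 40 := by
  have hq5 : (5 : ℝ) ≤ q := by exact_mod_cast hq
  have h1 := one_le_freeCount_mul (m := m) hq
  have hinv : (1 - 1 / (q : ℝ))⁻¹ = 1 + 1 / ((q : ℝ) - 1) := by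
    have : (q : ℝ) - 1 ≠ 0 := by linarith
    have : (q : ℝ) ≠ 0 := by linarith
    field_simp
    ring
  have hb : 1 + 32 / (q : ℝ) ≤ ((1 - 1 / (q : ℝ))⁻¹) ^ 32 := by
    rw [hinv]
    have hpos : 0 < 1 / ((q : ℝ) - 1) := by
      have : 0 < (q : ℝ) - 1 := by linarith
      positivity
    have := one_add_mul_le_pow (a := 1 / ((q : ℝ) - 1)) (by linarith) 32
    refine le_trans ?_ this
    push_cast
    have : 1 / (q : ℝ) ≤ 1 / ((q : ℝ) - 1) := one_div_le_one_div_of_le (by linarith) (by linarith)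
    rw [show 32 / (q : ℝ) = 32 * (1 / (q : ℝ)) by ring]
    linarith
  have hx : 0 ≤ (1 - 1 / (q : ℝ))⁻¹ := zero_le_one.trans (one_le_inv_one_sub_inv (by linarith))
  calc (q : ℝ) + 32 = q * (1 + 32 / (q : ℝ)) := by field_simp
    _ ≤ (freeCount m q * ((1 - 1 / (q : ℝ))⁻¹) ^ 8) * ((1 - 1 / (q : ℝ))⁻¹) ^ 32 := by gcongr
    _ = _ := by ring

/-- Below p the majorant is the exact sieve. At p at most four classes of weight at most 9 survive,
giving 36/p. Above p each prime costs 40 powers of its Euler factor; the same power is allowed at p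
for uniformity. -/
lemma sum_majorantFactor_le {m : ℤ} {p q : ℕ} (hq : 5 ≤ q) :
    ∑ n ∈ Finset.range q, majorantFactor m p q n ≤
      freeCount m q * ((if q = p then 36 / (p : ℝ) else 1) *
        (if p ≤ q then ((1 - 1 / (q : ℝ))⁻¹) ^ 40 else 1)) := by
  have hq5 : (5 : ℝ) ≤ q := by exact_mod_cast hq
  have hone := one_le_inv_one_sub_inv (x := (q : ℝ)) (by linarith)
  unfold majorantFactor
  rcases lt_trichotomy q p with h | h | h
  · simp only [if_pos h, if_neg h.ne, if_neg (not_le.2 h), mul_one]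
    rw [freeCount, Finset.card_filter]
    push_cast
    exact le_rfl
  · subst h
    simp only [lt_irrefl, if_false, if_true, le_refl]
    have h1 := sum_not_freeAt_le m hq
    have h3 : ((formRoots m q).card : ℝ) ≤ 4 := by exact_mod_cast card_formRoots_le m q
    have h4 := one_le_freeCount_mul (m := m) hq
    have h5 : ((1 - 1 / (q : ℝ))⁻¹) ^ 8 ≤ ((1 - 1 / (q : ℝ))⁻¹) ^ 40 :=
      pow_le_pow_right₀ hone (by norm_num)
    calc _ ≤ 36 / (q : ℝ) * q := by
          rw [div_mul_cancel₀ _ (by linarith)]; linarith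
      _ ≤ 36 / (q : ℝ) * (freeCount m q * ((1 - 1 / (q : ℝ))⁻¹) ^ 40) := by
          gcongr
          exact h4.trans (by gcongr)
      _ = _ := by ring
  · simp only [if_neg (not_lt.2 h.le), if_neg h.ne', if_pos h.le, one_mul]
    exact (sum_three_pow_dvdCount_le m hq).trans (add_le_freeCount_mul hq)

/-! ### The fundamental lemma over a period -/

/-- The average of the majorant. -/
lemma exists_sum_majorant_le : ∃ C : ℝ, 0 < C ∧ ∀ (P : ℝ), 2 ≤ P → ∀ (m : ℤ) (𝒬 : Finset ℕ),
    (∀ p ∈ 𝒬, p.Prime ∧ 5 ≤ p ∧ (p : ℝ) < P) →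
    ∑ p ∈ 𝒬, (Real.log p / Real.log P) ^ 41 *
        ∏ q ∈ 𝒬, ∑ n ∈ Finset.range q, majorantFactor m p q n ≤
      C * ∏ q ∈ 𝒬, (freeCount m q : ℝ) := by
  obtain ⟨C₁, hC₁, hprod⟩ := exists_prod_primesBetween_le
  obtain ⟨C₂, hC₂, hsum⟩ := exists_sum_log_div_le
  refine ⟨36 * C₁ ^ 40 * C₂, by positivity, fun P hP m 𝒬 h𝒬 => ?_⟩
  have hlogP : 0 < Real.log P := Real.log_pos (by linarith)
  have hF : 0 ≤ ∏ q ∈ 𝒬, (freeCount m q : ℝ) := Finset.prod_nonneg fun _ _ => by positivity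
  have hterm : ∀ p ∈ 𝒬, (Real.log p / Real.log P) ^ 41 *
      ∏ q ∈ 𝒬, ∑ n ∈ Finset.range q, majorantFactor m p q n ≤
      (36 * C₁ ^ 40 / Real.log P * ∏ q ∈ 𝒬, (freeCount m q : ℝ)) * (Real.log p / p) := by
    intro p hp
    obtain ⟨hpp, hp5, hpP⟩ := h𝒬 p hp
    have hp5' : (5 : ℝ) ≤ p := by exact_mod_cast hp5
    have hlogp : 0 < Real.log p := Real.log_pos (by linarith)
    have h1 : ∏ q ∈ 𝒬, ∑ n ∈ Finset.range q, majorantFactor m p q n ≤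
        ∏ q ∈ 𝒬, (freeCount m q * ((if q = p then 36 / (p : ℝ) else 1) *
          (if p ≤ q then ((1 - 1 / (q : ℝ))⁻¹) ^ 40 else 1))) := by
      refine Finset.prod_le_prod (fun q _ => Finset.sum_nonneg fun n _ => ?_) fun q hq => ?_
      · exact majorantFactor_nonneg m p q n
      · exact sum_majorantFactor_le (h𝒬 q hq).2.1
    have h2 : ∏ q ∈ 𝒬, (if p ≤ q then ((1 - 1 / (q : ℝ))⁻¹) ^ 40 else 1) ≤
        (C₁ * (Real.log P / Real.log p)) ^ 40 := by
      rw [← Finset.prod_filter, Finset.prod_pow]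
      refine pow_le_pow_left₀ (Finset.prod_nonneg fun q hq => ?_) ?_ 40
      · have := (h𝒬 q (Finset.mem_filter.1 hq).1).1.two_le
        exact zero_le_one.trans (one_le_inv_one_sub_inv (by exact_mod_cast this))
      · refine le_trans ?_ (hprod P p hpp.two_le hpP.le)
        refine Finset.prod_le_prod_of_subset_of_one_le ?_ ?_ ?_
        · intro q hq
          obtain ⟨hq1, hq2⟩ := Finset.mem_filter.1 hq
          exact mem_primesBetween.2 ⟨(h𝒬 q hq1).1, hq2, (h𝒬 q hq1).2.2⟩
        · intro q hq
          have := (h𝒬 q (Finset.mem_filter.1 hq).1).1.two_le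
          exact zero_le_one.trans (one_le_inv_one_sub_inv (by exact_mod_cast this))
        · intro q hq _
          exact one_le_inv_one_sub_inv (two_le_of_mem_primesBetween hq)
    rw [Finset.prod_mul_distrib, Finset.prod_mul_distrib,
      Finset.prod_ite_eq' 𝒬 p, if_pos hp] at h1
    -- The power 41 absorbs the loss (log P / log p)^40 and leaves one factor log p / log P, so that
    -- the sum over p is Mertens' sum of log p / p divided by log P.
    calc _ ≤ (Real.log p / Real.log P) ^ 41 * ((∏ q ∈ 𝒬, (freeCount m q : ℝ)) *
          (36 / (p : ℝ) * (C₁ * (Real.log P / Real.log p)) ^ 40)) := by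
          refine mul_le_mul_of_nonneg_left (h1.trans ?_) (by positivity)
          gcongr
      _ = _ := by
          field_simp
  refine (Finset.sum_le_sum hterm).trans ?_
  rw [← Finset.mul_sum]
  have h3 : ∑ p ∈ 𝒬, Real.log p / p ≤ C₂ * Real.log P := by
    refine le_trans (Finset.sum_le_sum_of_subset_of_nonneg ?_ ?_) (hsum P hP)
    · intro p hp
      exact mem_primesBetween.2 ⟨(h𝒬 p hp).1, (h𝒬 p hp).1.two_le, (h𝒬 p hp).2.2⟩
    · intro p _ _
      exact div_nonneg (Real.log_natCast_nonneg p) (by positivity)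
  calc _ ≤ (36 * C₁ ^ 40 / Real.log P * ∏ q ∈ 𝒬, (freeCount m q : ℝ)) * (C₂ * Real.log P) := by
        refine mul_le_mul_of_nonneg_left h3 (mul_nonneg (by positivity) hF)
    _ = _ := by field_simp

/-- The fundamental lemma, over a full period, for a product of four beta sieves. -/
lemma exists_abs_sum_prod_sieveSum_sub_le : ∃ C : ℝ, 0 < C ∧
    ∀ (S : Fin 4 → Set ℕ), (∀ i, ∀ h ∈ S i, 2 ≤ h → h - 2 ∈ S i) →
    ∀ (P D : ℝ), 2 ≤ P → P ^ 202 < D → ∀ (m : ℤ) (𝒬 : Finset ℕ),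
    (∀ p ∈ 𝒬, p.Prime ∧ 5 ≤ p ∧ (p : ℝ) < P) → ∀ (M : ℕ), (∀ p ∈ 𝒬, Nat.Coprime M p) →
    ∀ (h : ℤ → ℝ), Function.Periodic h (M : ℤ) → (∀ n, 0 ≤ h n) →
    |∑ n ∈ Finset.range (M * ∏ p ∈ 𝒬, p), h n *
          ∏ i, sieveSum (betaSieveSet (S i) 200 D) 𝒬 (sieveForm m n i) -
        (∑ n ∈ Finset.range M, h n) * ∏ p ∈ 𝒬, (freeCount m p : ℝ)| ≤
      C * Real.exp (-(Real.log D / (10 * Real.log P))) *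
        ((∑ n ∈ Finset.range M, h n) * ∏ p ∈ 𝒬, (freeCount m p : ℝ)) := by
  obtain ⟨C, hC, hmaj⟩ := exists_sum_majorant_le
  refine ⟨(2 + Real.exp 20) ^ 4 * C, by positivity, ?_⟩
  intro S hS P D hP hD m 𝒬 h𝒬 M hM h hper hnn
  have hprimes : ∀ p ∈ 𝒬, p.Prime := fun p hp => (h𝒬 p hp).1
  have hH : 0 ≤ ∑ n ∈ Finset.range M, h n := Finset.sum_nonneg fun n _ => hnn n
  -- The main term is the same sum with exact sieves, so the pointwise comparison can be applied
  -- term by term.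
  have hfree : (∑ n ∈ Finset.range M, h n) * ∏ p ∈ 𝒬, (freeCount m p : ℝ) =
      ∑ n ∈ Finset.range (M * ∏ p ∈ 𝒬, p), h n * ∏ q ∈ 𝒬, (if FreeAt m q n then 1 else 0) := by
    rw [sum_range_mul_prod hper hprimes hM (F := fun q n => if FreeAt m q n then (1 : ℝ) else 0)
      (fun p _ n => by simp only [FreeAt.periodic m p n])]
    congr 1
    refine Finset.prod_congr rfl fun p _ => ?_
    rw [freeCount, Finset.card_filter]
    push_cast
    rfl
  set ε := Real.exp (-(Real.log D / (10 * Real.log P))) with hε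
  have hε0 : 0 < ε := Real.exp_pos _
  rw [hfree, ← Finset.sum_sub_distrib, ← hfree]
  refine (Finset.abs_sum_le_sum_abs _ _).trans ?_
  have hpt : ∀ n ∈ Finset.range (M * ∏ p ∈ 𝒬, p),
      |h n * ∏ i, sieveSum (betaSieveSet (S i) 200 D) 𝒬 (sieveForm m n i) -
        h n * ∏ q ∈ 𝒬, (if FreeAt m q n then 1 else 0)| ≤
      (2 + Real.exp 20) ^ 4 * ε * ∑ p ∈ 𝒬, (Real.log p / Real.log P) ^ 41 *
        (h n * ∏ q ∈ 𝒬, majorantFactor m p q n) := by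
    intro n _
    rw [← mul_sub, abs_mul, abs_of_nonneg (hnn n)]
    refine (mul_le_mul_of_nonneg_left (abs_prod_sieveSum_sub_le hS hP hD
      (fun p hp => ⟨(h𝒬 p hp).1, (h𝒬 p hp).2.2⟩) m n) (hnn n)).trans (le_of_eq ?_)
    rw [mul_left_comm, Finset.mul_sum (a := h n)]
    congr 1
    exact Finset.sum_congr rfl fun p _ => by ring
  refine (Finset.sum_le_sum hpt).trans ?_
  rw [← Finset.mul_sum, Finset.sum_comm]
  have hswap : ∀ p ∈ 𝒬, ∑ n ∈ Finset.range (M * ∏ p ∈ 𝒬, p), (Real.log p / Real.log P) ^ 41 *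
        (h n * ∏ q ∈ 𝒬, majorantFactor m p q n) =
      (∑ n ∈ Finset.range M, h n) * ((Real.log p / Real.log P) ^ 41 *
        ∏ q ∈ 𝒬, ∑ n ∈ Finset.range q, majorantFactor m p q n) := fun p _ => by
    rw [← Finset.mul_sum, sum_range_mul_prod hper hprimes hM
      (fun q _ => majorantFactor_periodic m p q)]
    ring
  rw [Finset.sum_congr rfl hswap, ← Finset.mul_sum]
  calc _ ≤ (2 + Real.exp 20) ^ 4 * ε * ((∑ n ∈ Finset.range M, h n) *
        (C * ∏ q ∈ 𝒬, (freeCount m q : ℝ))) := by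
        gcongr
        exact hmaj P hP m 𝒬 h𝒬
    _ = _ := by ring

/-! ### From a period to an interval -/

/-- The condition selects one residue class modulo ℓ. The vanishing of e when ℓ divides b makes the
count over a full period exact. -/
lemma card_filter_range_of_iff_dvd {p : ℤ → Prop} [DecidablePred p] {ℓ : ℕ} (hℓ : 0 < ℓ) {n₀ : ℤ}
    (hp : ∀ n, p n ↔ (ℓ : ℤ) ∣ n - n₀) (b : ℕ) :
    ∃ e : ℕ, e ≤ 1 ∧ (ℓ ∣ b → e = 0) ∧
      ((Finset.range b).filter (fun n : ℕ => p n)).card = b / ℓ + e := by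
  have hℓ' : (0 : ℤ) < ℓ := by exact_mod_cast hℓ
  obtain ⟨v, hv⟩ := Int.eq_ofNat_of_zero_le (Int.emod_nonneg n₀ hℓ'.ne')
  have hiff : ∀ n : ℕ, p n ↔ n ≡ v [MOD ℓ] := fun n => by
    rw [hp, ← Int.natCast_modEq_iff, ← hv, Int.ModEq, Int.emod_emod_of_dvd _ dvd_rfl]
    exact (Int.modEq_iff_dvd.symm).trans ⟨Eq.symm, Eq.symm⟩
  have hc := Nat.count_modEq_card b hℓ v
  rw [Nat.count_eq_card_filter_range] at hc
  refine ⟨if v % ℓ < b % ℓ then 1 else 0, by split_ifs <;> omega, fun hb => ?_, ?_⟩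
  · rw [Nat.mod_eq_zero_of_dvd hb]
    simp
  · rw [← hc]
    congr 1
    exact Finset.filter_congr fun n _ => hiff n

/-- Both counts have the main term X / ℓ. The bounded error comes from the incomplete last block,
from the floor of X, and from starting the interval at 1 instead of 0. -/
lemma abs_card_filter_sub_le {p : ℤ → Prop} [DecidablePred p] {Z : ℕ} (hZ : 0 < Z)
    (hp : (∀ n, ¬ p n) ∨ ∃ (ℓ : ℕ) (n₀ : ℤ), ℓ ∣ Z ∧ ∀ n, p n ↔ (ℓ : ℤ) ∣ n - n₀)
    {X : ℝ} (hX : 0 ≤ X) :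
    |(((Finset.Icc 1 ⌊X⌋₊).filter (fun n : ℕ => p n)).card : ℝ) -
      X / Z * ((Finset.range Z).filter (fun n : ℕ => p n)).card| ≤ 4 := by
  rcases hp with hp | ⟨ℓ, n₀, hℓZ, hp⟩
  · simp [hp]
  have hℓ : 0 < ℓ := Nat.pos_of_dvd_of_pos hℓZ hZ
  obtain ⟨e, he, -, hc⟩ := card_filter_range_of_iff_dvd hℓ hp (⌊X⌋₊ + 1)
  obtain ⟨e', -, he', hc'⟩ := card_filter_range_of_iff_dvd hℓ hp Z
  rw [he' hℓZ, add_zero] at hc'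
  have hIcc : ∃ e'' : ℕ, e'' ≤ 1 ∧
      ((Finset.range (⌊X⌋₊ + 1)).filter (fun n : ℕ => p n)).card =
      ((Finset.Icc 1 ⌊X⌋₊).filter (fun n : ℕ => p n)).card + e'' := by
    have : Finset.range (⌊X⌋₊ + 1) = insert 0 (Finset.Icc 1 ⌊X⌋₊) := by
      ext n
      simp only [Finset.mem_range, Finset.mem_insert, Finset.mem_Icc]
      omega
    rw [this, Finset.filter_insert]
    split_ifs
    · exact ⟨1, le_rfl, Finset.card_insert_of_notMem (by simp)⟩
    · exact ⟨0, zero_le_one, rfl⟩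
  obtain ⟨e'', he'', hcI⟩ := hIcc
  rw [hc]at hcI
  have hℓ' : (0 : ℝ) < ℓ := by exact_mod_cast hℓ
  have hℓ1 : (1 : ℝ) ≤ ℓ := by exact_mod_cast hℓ
  have hZ' : (Z : ℝ) ≠ 0 := by positivity
  have h1 : X / Z * ((Z / ℓ : ℕ) : ℝ) = X / ℓ := by
    rw [Nat.cast_div hℓZ hℓ'.ne']
    field_simp
  rw [hc', h1]
  have h2 : (((⌊X⌋₊ + 1) / ℓ : ℕ) : ℝ) + e =
      ((Finset.Icc 1 ⌊X⌋₊).filter (fun n : ℕ => p n)).card + e'' := by exact_mod_cast hcI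
  have h3 : (((⌊X⌋₊ + 1) / ℓ : ℕ) : ℝ) ≤ ((⌊X⌋₊ : ℝ) + 1) / ℓ := by
    have := @Nat.cast_div_le ℝ _ _ _ (⌊X⌋₊ + 1) ℓ
    push_cast at this ⊢
    exact this
  have h4 : ((⌊X⌋₊ : ℝ) + 1) / ℓ ≤ (((⌊X⌋₊ + 1) / ℓ : ℕ) : ℝ) + 1 := by
    have := (Nat.lt_floor_add_one (((⌊X⌋₊ + 1 : ℕ) : ℝ) / ℓ)).le
    rw [Nat.floor_div_eq_div] at this
    push_cast at this ⊢
    exact this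
  have h5 : X / ℓ ≤ ((⌊X⌋₊ : ℝ) + 1) / ℓ := by
    gcongr
    exact (Nat.lt_floor_add_one X).le
  have h6 : ((⌊X⌋₊ : ℝ) + 1) / ℓ ≤ X / ℓ + 1 := by
    rw [div_add_one hℓ'.ne']
    gcongr
    exact Nat.floor_le hX
  have h7 : (e : ℝ) ≤ 1 := by exact_mod_cast he
  have h8 : (e'' : ℝ) ≤ 1 := by exact_mod_cast he''
  have h9 : (0 : ℝ) ≤ e := by positivity
  have h10 : (0 : ℝ) ≤ e'' := by positivity
  rw [abs_le]
  constructor <;> linarith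

lemma dvd_sieveForm_iff_of_dvd {m n n₀ d : ℤ} {i : Fin 4} (h : d ∣ sieveForm m n₀ i) :
    d ∣ sieveForm m n i ↔ d ∣ n - n₀ := by
  constructor
  · intro h'
    have h2 := dvd_sub h' h
    fin_cases i
    · exact h2
    · change d ∣ (n + 2) - (n₀ + 2) at h2
      rwa [show (n + 2) - (n₀ + 2) = n - n₀ by ring] at h2
    · change d ∣ (m - n) - (m - n₀) at h2
      rwa [show (m - n) - (m - n₀) = -(n - n₀) by ring, dvd_neg] at h2
    · change d ∣ (m - n + 2) - (m - n₀ + 2) at h2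
      rwa [show (m - n + 2) - (m - n₀ + 2) = -(n - n₀) by ring, dvd_neg] at h2
  · rintro ⟨k, hk⟩
    rw [show n = n₀ + d * k by linarith]
    exact (dvd_sieveForm_add_mul k).2 h

/-- A system of congruences, each satisfied by all or by one class of integers. -/
lemma forall_not_or_exists_iff_dvd {m a : ℤ} {M Z : ℕ} (hMZ : M ∣ Z) {𝒬 : Finset ℕ}
    (hZ : ∀ p ∈ 𝒬, p ∣ Z) (C : Fin 4 → Finset ℕ) (hC : ∀ i, C i ⊆ 𝒬) :
    (∀ n : ℤ, ¬ ((M : ℤ) ∣ n - a ∧ ∀ i, ∀ p ∈ C i, (p : ℤ) ∣ sieveForm m n i)) ∨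
    ∃ (ℓ : ℕ) (n₀ : ℤ), ℓ ∣ Z ∧
      ∀ n : ℤ, ((M : ℤ) ∣ n - a ∧ ∀ i, ∀ p ∈ C i, (p : ℤ) ∣ sieveForm m n i) ↔
        (ℓ : ℤ) ∣ n - n₀ := by
  classical
  by_cases h : ∀ n : ℤ, ¬ ((M : ℤ) ∣ n - a ∧ ∀ i, ∀ p ∈ C i, (p : ℤ) ∣ sieveForm m n i)
  · exact Or.inl h
  right
  push Not at h
  obtain ⟨n₀, h0, h1⟩ := h
  set U := Finset.univ.biUnion C with hU
  -- Any one solution n₀ determines the class, and each congruence becomes a divisibility of n - n₀.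
  -- A least common multiple is needed because several forms may involve the same prime.
  refine ⟨Nat.lcm M (U.lcm id), n₀, ?_, fun n => ?_⟩
  · refine Nat.lcm_dvd hMZ (Finset.lcm_dvd fun p hp => ?_)
    obtain ⟨i, -, hi⟩ := Finset.mem_biUnion.1 hp
    exact hZ p (hC i hi)
  · have e1 : ((M : ℤ) ∣ n - a) ↔ (M : ℤ) ∣ n - n₀ := by
      rw [show n - a = (n - n₀) + (n₀ - a) by ring]
      exact dvd_add_left h0
    have e2 : (∀ i, ∀ p ∈ C i, (p : ℤ) ∣ sieveForm m n i) ↔ ∀ p ∈ U, (p : ℤ) ∣ n - n₀ := by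
      constructor
      · intro h p hp
        obtain ⟨i, -, hi⟩ := Finset.mem_biUnion.1 hp
        exact (dvd_sieveForm_iff_of_dvd (h1 i p hi)).1 (h i p hi)
      · intro h i p hp
        exact (dvd_sieveForm_iff_of_dvd (h1 i p hp)).2
          (h p (Finset.mem_biUnion.2 ⟨i, Finset.mem_univ i, hp⟩))
    rw [e1, e2]
    simp only [Int.natCast_dvd]
    rw [Nat.lcm_dvd_iff, Finset.lcm_dvd_iff]
    rfl

open Classical in
/-- The sets of primes that index the sieve weights. -/
noncomputable def sieveSupport (𝒟 : Set ℕ) (𝒬 : Finset ℕ) : Finset (Finset ℕ) :=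
  𝒬.powerset.filter (fun C => ∏ p ∈ C, p ∈ 𝒟)

open Classical in
lemma sieveSum_eq_sum_sieveSupport (𝒟 : Set ℕ) (𝒬 : Finset ℕ) (k : ℤ) :
    sieveSum 𝒟 𝒬 k =
      ∑ C ∈ sieveSupport 𝒟 𝒬, (-1 : ℝ) ^ C.card * (if ∀ p ∈ C, (p : ℤ) ∣ k then 1 else 0) := by
  unfold sieveSum sieveSupport
  simp only [mul_ite, mul_one, mul_zero]
  rw [← Finset.sum_filter]
  refine Finset.sum_congr ?_ fun _ _ => rfl
  ext C
  simp only [Finset.mem_filter, Finset.mem_powerset, Finset.subset_iff]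
  constructor
  · rintro ⟨h1, h2⟩
    exact ⟨⟨fun p hp => (h1 hp).1, h2⟩, fun p hp => (h1 hp).2⟩
  · rintro ⟨⟨h1, h2⟩, h3⟩
    exact ⟨fun p hp => ⟨h1 hp, h3 p hp⟩, h2⟩

-- Expanding all four sieves and splitting n by its class modulo M turns the sum into signed counts
-- of solutions of congruence systems. The set s stays arbitrary, so the identity serves both the
-- interval and the period.
open Classical in
lemma sum_mul_prod_sieveSum_eq {M : ℕ} (hM : 0 < M) {h : ℤ → ℝ}
    (hper : Function.Periodic h (M : ℤ)) (𝒟 : Fin 4 → Set ℕ) (𝒬 : Finset ℕ) (m : ℤ)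
    (s : Finset ℕ) :
    ∑ n ∈ s, h n * ∏ i, sieveSum (𝒟 i) 𝒬 (sieveForm m n i) =
      ∑ a ∈ Finset.range M, ∑ C ∈ Fintype.piFinset (fun i => sieveSupport (𝒟 i) 𝒬),
        h a * (∏ i, (-1 : ℝ) ^ (C i).card) *
          ((s.filter (fun n : ℕ => (M : ℤ) ∣ n - a ∧
            ∀ i, ∀ p ∈ C i, (p : ℤ) ∣ sieveForm m n i)).card : ℝ) := by
  have h1 : ∀ n ∈ s, h n * ∏ i, sieveSum (𝒟 i) 𝒬 (sieveForm m n i) =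
      ∑ a ∈ Finset.range M, ∑ C ∈ Fintype.piFinset (fun i => sieveSupport (𝒟 i) 𝒬),
        h a * (∏ i, (-1 : ℝ) ^ (C i).card) * (if (M : ℤ) ∣ n - a ∧
            ∀ i, ∀ p ∈ C i, (p : ℤ) ∣ sieveForm m n i then 1 else 0) := fun n _ => by
    simp only [sieveSum_eq_sum_sieveSupport]
    rw [Finset.prod_univ_sum]
    have hmod : ((n % M : ℕ) : ℤ) = (n : ℤ) % M := by push_cast; rfl
    rw [Finset.sum_eq_single_of_mem (n % M) (Finset.mem_range.2 (Nat.mod_lt _ hM))]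
    · rw [hper.int_map_mod_nat, Finset.mul_sum]
      refine Finset.sum_congr rfl fun C _ => ?_
      rw [mul_assoc, Finset.prod_mul_distrib]
      congr 2
      have hd : (M : ℤ) ∣ n - ((n % M : ℕ) : ℤ) := by
        rw [hmod]
        exact Int.dvd_self_sub_emod
      simp only [hd, true_and]
      split_ifs with h2
      · exact Finset.prod_eq_one fun i _ => if_pos (h2 i)
      · push Not at h2
        obtain ⟨i, hi⟩ := h2
        refine Finset.prod_eq_zero (Finset.mem_univ i) (if_neg ?_)
        push Not
        exact hi
    · intro a ha hne
      refine Finset.sum_eq_zero fun C _ => ?_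
      rw [if_neg, mul_zero]
      rintro ⟨hd, -⟩
      apply hne
      have : (n : ℤ) ≡ a [ZMOD M] := (Int.modEq_iff_dvd.2 hd).symm
      rw [Int.natCast_modEq_iff] at this
      unfold Nat.ModEq at this
      rw [this, Nat.mod_eq_of_lt (Finset.mem_range.1 ha)]
  rw [Finset.sum_congr rfl h1, Finset.sum_comm]
  refine Finset.sum_congr rfl fun a _ => ?_
  rw [Finset.sum_comm]
  refine Finset.sum_congr rfl fun C _ => ?_
  rw [← Finset.mul_sum, Finset.card_filter]
  push_cast
  rfl

/-- The sum of a product of four sieves over an interval is given by the sum over a period. -/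
lemma abs_sum_Icc_sub_sum_range_le {M : ℕ} (hM : 0 < M) {h : ℤ → ℝ}
    (hper : Function.Periodic h (M : ℤ)) (hh : ∀ n, 0 ≤ h n ∧ h n ≤ 1) (𝒟 : Fin 4 → Set ℕ)
    {𝒬 : Finset ℕ} (h𝒬 : ∀ p ∈ 𝒬, p.Prime) (m : ℤ) {X : ℝ} (hX : 0 ≤ X) :
    |∑ n ∈ Finset.Icc 1 ⌊X⌋₊, h n * ∏ i, sieveSum (𝒟 i) 𝒬 (sieveForm m n i) -
      X / (M * ∏ p ∈ 𝒬, p : ℕ) *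
        ∑ n ∈ Finset.range (M * ∏ p ∈ 𝒬, p), h n * ∏ i, sieveSum (𝒟 i) 𝒬 (sieveForm m n i)| ≤
      4 * (M * ∏ i, ((sieveSupport (𝒟 i) 𝒬).card : ℝ)) := by
  classical
  have hZ : 0 < M * ∏ p ∈ 𝒬, p :=
    Nat.mul_pos hM (Finset.prod_pos fun p hp => (h𝒬 p hp).pos)
  rw [sum_mul_prod_sieveSum_eq hM hper, sum_mul_prod_sieveSum_eq hM hper, Finset.mul_sum,
    ← Finset.sum_sub_distrib]
  have hbd : ∀ a ∈ Finset.range M,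
      |∑ C ∈ Fintype.piFinset (fun i => sieveSupport (𝒟 i) 𝒬),
        h a * (∏ i, (-1 : ℝ) ^ (C i).card) *
          (((Finset.Icc 1 ⌊X⌋₊).filter (fun n : ℕ => (M : ℤ) ∣ n - a ∧
            ∀ i, ∀ p ∈ C i, (p : ℤ) ∣ sieveForm m n i)).card : ℝ) -
        X / (M * ∏ p ∈ 𝒬, p : ℕ) * ∑ C ∈ Fintype.piFinset (fun i => sieveSupport (𝒟 i) 𝒬),
        h a * (∏ i, (-1 : ℝ) ^ (C i).card) *
          (((Finset.range (M * ∏ p ∈ 𝒬, p)).filter (fun n : ℕ => (M : ℤ) ∣ n - a ∧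
            ∀ i, ∀ p ∈ C i, (p : ℤ) ∣ sieveForm m n i)).card : ℝ)| ≤
        4 * ∏ i, ((sieveSupport (𝒟 i) 𝒬).card : ℝ) := fun a _ => by
    rw [Finset.mul_sum, ← Finset.sum_sub_distrib]
    refine (Finset.abs_sum_le_sum_abs _ _).trans ?_
    have : ∀ C ∈ Fintype.piFinset (fun i => sieveSupport (𝒟 i) 𝒬),
        |h a * (∏ i, (-1 : ℝ) ^ (C i).card) *
          (((Finset.Icc 1 ⌊X⌋₊).filter (fun n : ℕ => (M : ℤ) ∣ n - a ∧
            ∀ i, ∀ p ∈ C i, (p : ℤ) ∣ sieveForm m n i)).card : ℝ) -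
        X / (M * ∏ p ∈ 𝒬, p : ℕ) * (h a * (∏ i, (-1 : ℝ) ^ (C i).card) *
          (((Finset.range (M * ∏ p ∈ 𝒬, p)).filter (fun n : ℕ => (M : ℤ) ∣ n - a ∧
            ∀ i, ∀ p ∈ C i, (p : ℤ) ∣ sieveForm m n i)).card : ℝ))| ≤ 4 := fun C hC => by
      have hC' : ∀ i, C i ⊆ 𝒬 := fun i => by
        have := Fintype.mem_piFinset.1 hC i
        exact Finset.mem_powerset.1 (Finset.mem_filter.1 this).1
      have hcnt := abs_card_filter_sub_le hZ
        (forall_not_or_exists_iff_dvd (m := m) (a := a) (dvd_mul_right M (∏ p ∈ 𝒬, p))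
          (fun p hp => (Finset.dvd_prod_of_mem (fun p : ℕ => p) hp).mul_left M) C hC') hX
      rw [mul_left_comm, ← mul_sub, abs_mul, abs_mul, Finset.abs_prod]
      have h1 : ∏ i, |(-1 : ℝ) ^ (C i).card| = 1 :=
        Finset.prod_eq_one fun i _ => by rw [abs_pow, abs_neg, abs_one, one_pow]
      rw [h1, mul_one, abs_of_nonneg (hh a).1]
      calc _ ≤ 1 * (4 : ℝ) := mul_le_mul (hh a).2 hcnt (abs_nonneg _) zero_le_one
        _ = 4 := one_mul 4
    refine (Finset.sum_le_sum this).trans ?_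
    rw [Finset.sum_const, Fintype.card_piFinset, nsmul_eq_mul]
    push_cast
    rw [mul_comm]
  refine (Finset.abs_sum_le_sum_abs _ _).trans ((Finset.sum_le_sum hbd).trans ?_)
  rw [Finset.sum_const, Finset.card_range, nsmul_eq_mul]
  exact le_of_eq (by ring)

/-- The support of the beta sieve weights is contained in `[1, D)`. -/
lemma card_sieveSupport_le {S : Set ℕ} (hS : ∀ h, h ∈ S ∨ h + 1 ∈ S) {P D : ℝ} (hP : 2 ≤ P)
    (hD : P ^ 202 < D) {𝒬 : Finset ℕ} (h𝒬 : ∀ p ∈ 𝒬, p.Prime ∧ (p : ℝ) < P) :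
    ((sieveSupport (betaSieveSet S 200 D) 𝒬).card : ℝ) ≤ D := by
  classical
  have hPD : P < D := lt_of_le_of_lt (by
    calc P = P ^ 1 := (pow_one P).symm
      _ ≤ P ^ 202 := pow_le_pow_right₀ (by linarith) (by norm_num)) hD
  have hsub : ∀ C ∈ sieveSupport (betaSieveSet S 200 D) 𝒬, (∀ p ∈ C, p ∈ 𝒬) ∧
      SieveAdmissible S 200 D C := fun C hC => by
    obtain ⟨h1, h2⟩ := Finset.mem_filter.1 hC
    rw [Finset.mem_powerset] at h1
    exact ⟨fun p hp => h1 hp, (prod_mem_betaSieveSet_iff fun p hp => (h𝒬 p (h1 hp)).1).1 h2⟩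
  have hlt : ∀ C ∈ sieveSupport (betaSieveSet S 200 D) 𝒬, ((∏ p ∈ C, p : ℕ) : ℝ) < D := by
    intro C hC
    obtain ⟨hC𝒬, hadm⟩ := hsub C hC
    have hone : ∀ p ∈ C, (1 : ℝ) ≤ p := fun p hp => by
      exact_mod_cast (h𝒬 p (hC𝒬 p hp)).1.one_le
    rcases C.eq_empty_or_nonempty with rfl | hne
    · simp
      linarith
    obtain ⟨p, B, rfl, hpB, hlp⟩ := exists_insert_min hne
    have hself : (insert p B).filter (fun q => p ≤ q) = insert p B := by
      refine Finset.filter_true_of_mem fun q hq => ?_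
      rcases Finset.mem_insert.1 hq with rfl | hq
      · exact le_rfl
      · exact (hlp q hq).le
    have hp1 := hone p (Finset.mem_insert_self _ _)
    -- The set `S` meets every pair of consecutive positions. Either the condition at the second
    -- smallest prime q applies, and p < q is absorbed into q^200, or the condition at p itself
    -- bounds the product. A single prime is below P < D.
    rcases hS B.card with hB | hB
    · rcases B.eq_empty_or_nonempty with rfl | hne'
      · simpa using ((h𝒬 p (hC𝒬 p (Finset.mem_insert_self _ _))).2.trans hPD)
      obtain ⟨q, hq⟩ : ∃ q, q = B.min' hne' := ⟨_, rfl⟩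
      have hqB : q ∈ B := hq ▸ B.min'_mem hne'
      have h1 := hadm.of_insert hlp q hqB
      rw [Finset.filter_true_of_mem fun y hy => by rw [hq]; exact B.min'_le y hy] at h1
      refine lt_of_le_of_lt ?_ (h1 hB)
      rw [Finset.prod_insert hpB, mul_comm p]
      push_cast
      have hpq : (p : ℝ) ≤ q := by exact_mod_cast (hlp q hqB).le
      have hq1 := hone q (Finset.mem_insert_of_mem hqB)
      refine mul_le_mul_of_nonneg_left ?_ (Finset.prod_nonneg fun _ _ => by positivity)
      exact hpq.trans (le_self_pow₀ hq1 (by norm_num))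
    · have h1 := hadm p (Finset.mem_insert_self _ _)
      rw [hself, Finset.card_insert_of_notMem hpB] at h1
      refine lt_of_le_of_lt ?_ (h1 hB)
      exact le_mul_of_one_le_right (by positivity) (one_le_pow₀ hp1)
  have hinj : Set.InjOn (fun C : Finset ℕ => ∏ p ∈ C, p)
      (sieveSupport (betaSieveSet S 200 D) 𝒬 : Set (Finset ℕ)) := fun C hC C' hC' heq => by
    have e1 := Nat.primeFactors_prod fun p hp => (h𝒬 p ((hsub C hC).1 p hp)).1
    have e2 := Nat.primeFactors_prod fun p hp => (h𝒬 p ((hsub C' hC').1 p hp)).1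
    simp only at heq
    rw [← e1, ← e2, heq]
  have hcard := Finset.card_le_card_of_injOn (t := Finset.Icc 1 ⌊D⌋₊)
    (fun C : Finset ℕ => ∏ p ∈ C, p) (fun C hC => by
      refine Finset.mem_coe.2 (Finset.mem_Icc.2 ⟨?_, Nat.le_floor (hlt C hC).le⟩)
      exact Finset.prod_pos fun p hp => (h𝒬 p ((hsub C hC).1 p hp)).1.pos) hinj
  rw [Nat.card_Icc, Nat.add_sub_cancel] at hcard
  refine le_trans (by exact_mod_cast hcard) (Nat.floor_le (by linarith))

lemma abs_sieveSum_le_card (𝒟 : Set ℕ) (𝒬 : Finset ℕ) (k : ℤ) :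
    |sieveSum 𝒟 𝒬 k| ≤ (sieveSupport 𝒟 𝒬).card := by
  classical
  rw [sieveSum_eq_sum_sieveSupport]
  refine (Finset.abs_sum_le_sum_abs _ _).trans ?_
  have : ∀ C ∈ sieveSupport 𝒟 𝒬,
      |(-1 : ℝ) ^ C.card * (if ∀ p ∈ C, (p : ℤ) ∣ k then 1 else 0)| ≤ 1 := fun C _ => by
    rw [abs_mul, abs_pow, abs_neg, abs_one, one_pow, one_mul]
    split_ifs <;> simp
  refine (Finset.sum_le_sum this).trans ?_
  simp

/-- The pre-sieve in terms of the sum over sets of primes. -/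
lemma preSieve_eq (𝒟 : Set ℕ) (P : ℝ) (n : ℕ) :
    preSieve 𝒟 P n =
      if Nat.Coprime n 6 then eulerProd P * sieveSum 𝒟 (primesBetween 5 P) n else 0 := by
  classical
  unfold preSieve eulerProd sieveSum
  congr 2
  have hpr : ∀ p ∈ primesBetween 5 P, p.Prime := fun p hp => (mem_primesBetween.1 hp).1
  have hsq : Squarefree (∏ p ∈ primesBetween 5 P, p) := by
    refine Finset.squarefree_prod_of_pairwise_isCoprime (fun p hp q hq hpq => ?_)
      fun p hp => (hpr p hp).prime.squarefree
    exact Nat.coprime_iff_isRelPrime.1 ((Nat.coprime_primes (hpr p hp) (hpr q hq)).2 hpq)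
  have hne : ∏ p ∈ primesBetween 5 P, p ≠ 0 := hsq.ne_zero
  symm
  refine Finset.sum_nbij' (fun C => ∏ p ∈ C, p) Nat.primeFactors ?_ ?_ ?_ ?_ ?_
  · intro C hC
    simp only [Finset.mem_filter, Finset.mem_powerset, Finset.subset_iff] at hC
    refine Finset.mem_filter.2 ⟨Nat.mem_divisors.2 ⟨?_, hne⟩, ?_, hC.2⟩
    · exact Finset.prod_dvd_prod_of_subset _ _ _ fun p hp => (hC.1 hp).1
    · refine Finset.prod_primes_dvd n (fun p hp => (hpr p (hC.1 hp).1).prime) fun p hp => ?_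
      exact_mod_cast (hC.1 hp).2
  · intro d hd
    simp only [Finset.mem_filter, Nat.mem_divisors] at hd
    have hd0 : Squarefree d := hsq.squarefree_of_dvd hd.1.1
    refine Finset.mem_filter.2 ⟨Finset.mem_powerset.2 fun p hp => ?_, ?_⟩
    · have hp' := Nat.mem_primeFactors.1 hp
      refine Finset.mem_filter.2 ⟨?_, ?_⟩
      · obtain ⟨q, hq, hpq⟩ := (hp'.1.prime.dvd_finsetProd_iff _).1 (hp'.2.1.trans hd.1.1)
        rwa [(Nat.prime_dvd_prime_iff_eq hp'.1 (hpr q hq)).1 hpq]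
      · exact_mod_cast hp'.2.1.trans hd.2.1
    · rw [Nat.prod_primeFactors_of_squarefree hd0]
      exact hd.2.2
  · intro C hC
    simp only [Finset.mem_filter, Finset.mem_powerset, Finset.subset_iff] at hC
    exact Nat.primeFactors_prod fun p hp => hpr p (hC.1 hp).1
  · intro d hd
    simp only [Finset.mem_filter, Nat.mem_divisors] at hd
    exact Nat.prod_primeFactors_of_squarefree (hsq.squarefree_of_dvd hd.1.1)
  · intro C hC
    simp only [Finset.mem_filter, Finset.mem_powerset, Finset.subset_iff] at hC
    have hC' : ∀ p ∈ C, p.Prime := fun p hp => hpr p (hC.1 hp).1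
    rw [ArithmeticFunction.isMultiplicative_moebius.map_prod_of_prime C hC', Finset.prod_congr rfl
      fun p hp => ArithmeticFunction.moebius_apply_prime (hC' p hp), Finset.prod_const]
    push_cast
    rfl

/-! ### The singular series -/

/-- The deviation from `1` of the factors of the Euler product in the singular series. -/
noncomputable def singularDefect (x : ℝ) : ℝ := (6 * x ^ 2 - 4 * x + 1) / (x - 1) ^ 4

lemma singularDefect_nonneg {x : ℝ} (hx : 5 ≤ x) : 0 ≤ singularDefect x := by
  have : 0 ≤ 6 * x ^ 2 - 4 * x + 1 := by nlinarith
  unfold singularDefect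
  positivity

lemma singularDefect_le {x : ℝ} (hx : 5 ≤ x) : singularDefect x ≤ 15 / x ^ 2 := by
  have hx0 : 0 < x := by linarith
  have hx1 : 0 < x - 1 := by linarith
  unfold singularDefect
  rw [div_le_div_iff₀ (by positivity) (by positivity)]
  have h1 : 16 / 25 * x ^ 2 ≤ (x - 1) ^ 2 := by nlinarith
  have h2 : (16 / 25 * x ^ 2) ^ 2 ≤ ((x - 1) ^ 2) ^ 2 := by gcongr
  have h3 : 6 * x ^ 2 - 4 * x + 1 ≤ 6 * x ^ 2 := by linarith
  have h4 : (6 * x ^ 2 - 4 * x + 1) * x ^ 2 ≤ 6 * x ^ 2 * x ^ 2 := by gcongr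
  nlinarith [sq_nonneg (x ^ 2)]

/-- The defect is at most 15/x² ≤ 3/5, so dividing it by 1 minus itself gives at most (75/2)/x² ≤
38/x². -/
lemma exp_le_one_sub_singularDefect {x : ℝ} (hx : 5 ≤ x) :
    Real.exp (-(38 * (x ^ 2)⁻¹)) ≤ 1 - singularDefect x := by
  have hx0 : 0 < x := by linarith
  have h0 := singularDefect_nonneg hx
  have h1 := singularDefect_le hx
  rw [div_eq_mul_inv] at h1
  have hi : (x ^ 2)⁻¹ ≤ 1 / 25 := by
    rw [one_div]
    exact inv_anti₀ (by norm_num) (by nlinarith)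
  have h2 : 0 < 1 - singularDefect x := by linarith
  have h3 : (1 - singularDefect x)⁻¹ ≤ Real.exp (38 * (x ^ 2)⁻¹) := by
    have h4 : (1 - singularDefect x)⁻¹ = singularDefect x / (1 - singularDefect x) + 1 := by
      field_simp
      ring
    have h5 : singularDefect x / (1 - singularDefect x) ≤ 38 * (x ^ 2)⁻¹ := by
      rw [div_le_iff₀ h2]
      have : (x ^ 2)⁻¹ * (2 / 5) ≤ (x ^ 2)⁻¹ * (1 - singularDefect x) := by
        gcongr
        linarith
      have : 0 ≤ (x ^ 2)⁻¹ := by positivity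
      linarith
    rw [h4]
    exact (Real.add_one_le_exp _).trans (Real.exp_le_exp.2 h5)
  rw [Real.exp_neg]
  exact inv_le_of_inv_le₀ h2 h3

/-- Truncation of the Euler product in the singular series. -/
lemma exists_tprod_eq {P : ℝ} (hP : 2 ≤ P) :
    ∃ t : ℝ, Real.exp (-(76 / P)) ≤ t ∧ t ≤ 1 ∧
      ∏' p : {p : ℕ // p.Prime ∧ 5 ≤ p},
        (1 - (6 * (p : ℝ) ^ 2 - 4 * (p : ℝ) + 1) / ((p : ℝ) - 1) ^ 4) =
      t * ∏ p ∈ primesBetween 5 P, (1 - singularDefect p) := by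
  set f : {p : ℕ // p.Prime ∧ 5 ≤ p} → ℝ := fun p =>
    1 - (6 * (p : ℝ) ^ 2 - 4 * (p : ℝ) + 1) / ((p : ℝ) - 1) ^ 4 with hf
  have hf5 : ∀ p : {p : ℕ // p.Prime ∧ 5 ≤ p}, (5 : ℝ) ≤ ((p : ℕ) : ℝ) := fun p => by
    exact_mod_cast p.2.2
  have hf0 : ∀ p : {p : ℕ // p.Prime ∧ 5 ≤ p}, Real.exp (-(38 * (((p : ℕ) : ℝ) ^ 2)⁻¹)) ≤ f p := fun p =>
    exp_le_one_sub_singularDefect (hf5 p)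
  have hf1 : ∀ p, f p ≤ 1 := fun p => by
    have := singularDefect_nonneg (hf5 p)
    simp only [hf]
    unfold singularDefect at this
    linarith
  have hfpos : ∀ p, 0 < f p := fun p => (Real.exp_pos _).trans_le (hf0 p)
  set s₀ := (primesBetween 5 P).subtype (fun p => p.Prime ∧ 5 ≤ p) with hs₀
  have hprod₀ : ∏ p ∈ s₀, f p = ∏ p ∈ primesBetween 5 P, (1 - singularDefect p) :=
    Finset.prod_subtype_of_mem (fun p : ℕ => 1 - singularDefect p) fun p hp =>
      ⟨(mem_primesBetween.1 hp).1, (mem_primesBetween.1 hp).2.1⟩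
  have hpos₀ : 0 < ∏ p ∈ s₀, f p := Finset.prod_pos fun p _ => hfpos p
  have htend : Filter.Tendsto (fun s : Finset {p : ℕ // p.Prime ∧ 5 ≤ p} => ∏ p ∈ s, f p)
      Filter.atTop (nhds (∏' p, f p)) := multipliable_singularSeries.hasProd
  have hbounds : ∀ s : Finset {p : ℕ // p.Prime ∧ 5 ≤ p}, s₀ ⊆ s →
      Real.exp (-(76 / P)) * ∏ p ∈ s₀, f p ≤ ∏ p ∈ s, f p ∧
        ∏ p ∈ s, f p ≤ ∏ p ∈ s₀, f p := fun s hs => by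
    rw [← Finset.prod_sdiff hs]
    -- The primes outside `s₀` are at least P, and the sum of inverse squares of all integers from
    -- ⌈P⌉ on is at most 2/⌈P⌉. With 38 per prime this gives 76/P.
    have hsum : ∑ p ∈ s \ s₀, (((p : ℕ) : ℝ) ^ 2)⁻¹ ≤ 2 / P := by
      have hceil : 1 ≤ ⌈P⌉₊ := Nat.one_le_ceil_iff.2 (by linarith)
      set N := (s.sup (fun p => (p : ℕ))) + 1 with hN
      have h1 := sum_Ioo_inv_sq_le (α := ℝ) (⌈P⌉₊ - 1) N
      have h2 : (((⌈P⌉₊ - 1 : ℕ) : ℝ) + 1) = ⌈P⌉₊ := by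
        rw [Nat.cast_sub hceil]
        simp
      rw [h2] at h1
      have h3 : ∑ p ∈ s \ s₀, (((p : ℕ) : ℝ) ^ 2)⁻¹ ≤
          ∑ i ∈ Finset.Ioo (⌈P⌉₊ - 1) N, ((i : ℝ) ^ 2)⁻¹ := by
        have hmap : ∑ p ∈ s \ s₀, (((p : ℕ) : ℝ) ^ 2)⁻¹ =
            ∑ i ∈ (s \ s₀).map (Function.Embedding.subtype _), ((i : ℝ) ^ 2)⁻¹ := by
          rw [Finset.sum_map]
          rfl
        rw [hmap]
        refine Finset.sum_le_sum_of_subset_of_nonneg ?_ fun _ _ _ => by positivity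
        intro i hi
        obtain ⟨p, hp, rfl⟩ := Finset.mem_map.1 hi
        obtain ⟨hps, hps₀⟩ := Finset.mem_sdiff.1 hp
        have hPp : P ≤ (p : ℕ) := by
          by_contra hlt
          apply hps₀
          rw [hs₀, Finset.mem_subtype, mem_primesBetween]
          exact ⟨p.2.1, p.2.2, not_le.1 hlt⟩
        have hle : (p : ℕ) ≤ s.sup (fun p => (p : ℕ)) :=
          Finset.le_sup (f := fun p : {p : ℕ // p.Prime ∧ 5 ≤ p} => (p : ℕ)) hps
        have hcp : ⌈P⌉₊ ≤ (p : ℕ) := Nat.ceil_le.2 hPp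
        simp only [Function.Embedding.subtype_apply, Finset.mem_Ioo]
        omega
      refine (h3.trans h1).trans ?_
      gcongr
      exact Nat.le_ceil P
    constructor
    · refine mul_le_mul_of_nonneg_right ?_ hpos₀.le
      calc Real.exp (-(76 / P)) ≤
            Real.exp (∑ p ∈ s \ s₀, -(38 * (((p : ℕ) : ℝ) ^ 2)⁻¹)) := by
            rw [Finset.sum_neg_distrib, ← Finset.mul_sum]
            gcongr
            rw [show 76 / P = 38 * (2 / P) by ring]
            gcongr
        _ = ∏ p ∈ s \ s₀, Real.exp (-(38 * (((p : ℕ) : ℝ) ^ 2)⁻¹)) := Real.exp_sum _ _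
        _ ≤ _ := Finset.prod_le_prod (fun _ _ => (Real.exp_pos _).le) fun p _ => hf0 p
    · exact mul_le_of_le_one_left hpos₀.le
        (Finset.prod_le_one (fun p _ => (hfpos p).le) fun p _ => hf1 p)
  have hlow : Real.exp (-(76 / P)) * ∏ p ∈ s₀, f p ≤ ∏' p, f p :=
    ge_of_tendsto htend (Filter.eventually_atTop.2 ⟨s₀, fun s hs => (hbounds s hs).1⟩)
  have hup : ∏' p, f p ≤ ∏ p ∈ s₀, f p :=
    le_of_tendsto htend (Filter.eventually_atTop.2 ⟨s₀, fun s hs => (hbounds s hs).2⟩)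
  refine ⟨(∏' p, f p) / ∏ p ∈ s₀, f p, ?_, ?_, ?_⟩
  · rwa [le_div_iff₀ hpos₀]
  · exact (div_le_one hpos₀).2 hup
  · rw [← hprod₀, div_mul_cancel₀ _ hpos₀.ne']

/-- Modulo 2 all four roots coincide, since m is even. Modulo 3, where m ≡ 1, they coincide in
pairs. -/
lemma freeCount_two {m : ℕ} (hm : m ≡ 4 [MOD 6]) : freeCount m 2 = 1 := by
  have h := freeCount_add_card_formRoots (m : ℤ) 2
  have hm2 : ((m : ℤ) : ZMod 2) = 0 := by
    rw [Int.cast_natCast, ZMod.natCast_eq_zero_iff]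
    have : m % 6 = 4 := hm
    omega
  have hr : (formRoots m 2).card = 1 := by
    unfold formRoots
    rw [hm2]
    decide
  omega

lemma freeCount_three {m : ℕ} (hm : m ≡ 4 [MOD 6]) : freeCount m 3 = 1 := by
  have h := freeCount_add_card_formRoots (m : ℤ) 3
  have hm2 : ((m : ℤ) : ZMod 3) = 1 := by
    rw [Int.cast_natCast]
    have h3 : m ≡ 1 [MOD 3] := by
      have : m % 6 = 4 := hm
      change m % 3 = 1 % 3
      omega
    have := (ZMod.natCast_eq_natCast_iff m 1 3).2 h3
    simpa using this
  have hr : (formRoots m 3).card = 2 := by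
    unfold formRoots
    rw [hm2]
    decide
  omega

/-- The roots 0, -2, m, m + 2 are distinct unless m is congruent to 0 or -4, when there are three,
or to -2, when there are two. So p - 4 becomes p - 3 or p - 2. -/
lemma freeCount_of_five_le (m : ℕ) {p : ℕ} (hp : p.Prime) (hp5 : 5 ≤ p) :
    (freeCount m p : ℝ) =
      (p - 4) * (if p ∣ m * (m + 4) then 1 + 1 / ((p : ℝ) - 4) else 1) *
        (if p ∣ m + 2 then 1 + 2 / ((p : ℝ) - 4) else 1) := by
  have : Fact p.Prime := ⟨hp⟩
  have h := freeCount_add_card_formRoots (m : ℤ) p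
  have hp5' : (5 : ℝ) ≤ p := by exact_mod_cast hp5
  have h4 : (p : ℝ) - 4 ≠ 0 := by linarith
  have hne : ∀ k : ℕ, 0 < k → k < 5 → (k : ZMod p) ≠ 0 := fun k h0 h1 hk => by
    rw [ZMod.natCast_eq_zero_iff] at hk
    have := Nat.le_of_dvd h0 hk
    omega
  have n2 : (2 : ZMod p) ≠ 0 := by exact_mod_cast hne 2 (by norm_num) (by norm_num)
  have n4 : (4 : ZMod p) ≠ 0 := by exact_mod_cast hne 4 (by norm_num) (by norm_num)
  have d0 : p ∣ m * (m + 4) ↔ (m : ZMod p) = 0 ∨ (m : ZMod p) = -4 := by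
    rw [hp.dvd_mul, ← ZMod.natCast_eq_zero_iff, ← ZMod.natCast_eq_zero_iff, eq_neg_iff_add_eq_zero]
    push_cast
    rfl
  have d2 : p ∣ m + 2 ↔ (m : ZMod p) = -2 := by
    rw [← ZMod.natCast_eq_zero_iff, eq_neg_iff_add_eq_zero]
    push_cast
    rfl
  have hroots : formRoots m p = {0, -2, (m : ZMod p), (m : ZMod p) + 2} := by
    simp [formRoots]
  have e1 : (0 : ZMod p) ≠ -2 := fun h => n2 (by linear_combination h)
  have e2 : (0 : ZMod p) ≠ 2 := fun h => n2 h.symm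
  have e3 : (-2 : ZMod p) ≠ 2 := fun h => n4 (by linear_combination -h)
  have hreal : (freeCount m p : ℝ) = p - (formRoots m p).card := by
    have : (freeCount m p : ℝ) + (formRoots m p).card = p := by exact_mod_cast h
    linarith
  rw [hreal, hroots]
  by_cases c0 : (m : ZMod p) = 0
  · have hd2 : ¬ p ∣ m + 2 := fun h => e1 (by rw [← c0]; exact d2.1 h)
    rw [if_pos (d0.2 (Or.inl c0)), if_neg hd2, c0,
      show ({0, -2, 0, 0 + 2} : Finset (ZMod p)) = {0, -2, 2} by ext; simp; tauto,
      Finset.card_eq_three.2 ⟨0, -2, 2, e1, e2, e3, rfl⟩]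
    push_cast
    field_simp
    ring
  by_cases c4 : (m : ZMod p) = -4
  · have hd2 : ¬ p ∣ m + 2 := fun h => n2 (by
      have := d2.1 h
      linear_combination c4 - this)
    have e4 : (0 : ZMod p) ≠ -4 := fun h => c0 (c4.trans h.symm)
    have e5 : (-2 : ZMod p) ≠ -4 := fun h => n2 (by linear_combination h)
    rw [if_pos (d0.2 (Or.inr c4)), if_neg hd2, c4,
      show (-4 + 2 : ZMod p) = -2 by ring,
      show ({0, -2, -4, -2} : Finset (ZMod p)) = {0, -2, -4} by ext; simp; tauto,
      Finset.card_eq_three.2 ⟨0, -2, -4, e1, e4, e5, rfl⟩]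
    push_cast
    field_simp
    ring
  have hd0 : ¬ p ∣ m * (m + 4) := fun h => (d0.1 h).elim c0 c4
  by_cases c2 : (m : ZMod p) = -2
  · rw [if_neg hd0, if_pos (d2.2 c2), c2, show (-2 + 2 : ZMod p) = 0 by ring,
      show ({0, -2, -2, 0} : Finset (ZMod p)) = {0, -2} by ext; simp; tauto,
      Finset.card_pair e1]
    push_cast
    field_simp
    ring
  · have hd2 : ¬ p ∣ m + 2 := fun h => c2 (d2.1 h)
    rw [if_neg hd0, if_neg hd2, Finset.card_insert_of_notMem, Finset.card_insert_of_notMem,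
      Finset.card_pair]
    · push_cast
      ring
    · exact fun h => n2 (by linear_combination -h)
    · simp only [Finset.mem_insert, Finset.mem_singleton, not_or]
      exact ⟨fun h => c2 h.symm, fun h => c4 (by linear_combination -h)⟩
    · simp only [Finset.mem_insert, Finset.mem_singleton, not_or]
      exact ⟨e1, fun h => c0 h.symm, fun h => c2 (by linear_combination -h)⟩

/-- This identifies the normalised local density with the local factor of the singular series,
through (p - 4) p³ = (p - 1)⁴ - (6p² - 4p + 1). -/
lemma freeCount_div_mul_pow (m : ℕ) {p : ℕ} (hp : p.Prime) (hp5 : 5 ≤ p) :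
    (freeCount m p : ℝ) / p * ((1 - 1 / (p : ℝ))⁻¹) ^ 4 =
      (1 - singularDefect p) * (if p ∣ m * (m + 4) then 1 + 1 / ((p : ℝ) - 4) else 1) *
        (if p ∣ m + 2 then 1 + 2 / ((p : ℝ) - 4) else 1) := by
  have hp5' : (5 : ℝ) ≤ p := by exact_mod_cast hp5
  rw [freeCount_of_five_le m hp hp5]
  have h1 : ((p : ℝ) - 4) / p * ((1 - 1 / (p : ℝ))⁻¹) ^ 4 = 1 - singularDefect p := by
    have h0 : (p : ℝ) ≠ 0 := by linarith
    have h1 : (p : ℝ) - 1 ≠ 0 := by linarith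
    have hinv : (1 - 1 / (p : ℝ))⁻¹ = p / (p - 1) := by field_simp
    unfold singularDefect
    rw [hinv]
    field_simp
    ring
  rw [← h1]
  ring

lemma freeCount_div_le_one (m : ℤ) {p : ℕ} (hp : 0 < p) : (freeCount m p : ℝ) / p ≤ 1 := by
  have : NeZero p := ⟨hp.ne'⟩
  have h := freeCount_add_card_formRoots m p
  rw [div_le_one (by exact_mod_cast hp)]
  exact_mod_cast (by omega : freeCount m p ≤ p)

lemma exp_le_freeCount_div (m : ℤ) {p : ℕ} (hp5 : 5 ≤ p) :
    Real.exp (-(16 / p)) ≤ (freeCount m p : ℝ) / p := by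
  have hp5' : (5 : ℝ) ≤ p := by exact_mod_cast hp5
  have h0 : (p : ℝ) ≠ 0 := by linarith
  have h1 : (p : ℝ) - 1 ≠ 0 := by linarith
  have h := one_le_freeCount_mul (m := m) hp5
  have hinv : (1 - 1 / (p : ℝ))⁻¹ = 1 / ((p : ℝ) - 1) + 1 := by
    field_simp
    ring
  have h2 : (1 - 1 / (p : ℝ))⁻¹ ≤ Real.exp (2 / p) := by
    rw [hinv]
    refine (Real.add_one_le_exp _).trans (Real.exp_le_exp.2 ?_)
    rw [div_le_div_iff₀ (by linarith) (by linarith)]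
    linarith
  have hx : 0 ≤ (1 - 1 / (p : ℝ))⁻¹ := zero_le_one.trans (one_le_inv_one_sub_inv (by linarith))
  have h3 : ((1 - 1 / (p : ℝ))⁻¹) ^ 8 ≤ Real.exp (16 / p) := by
    calc ((1 - 1 / (p : ℝ))⁻¹) ^ 8 ≤ Real.exp (2 / p) ^ 8 := by gcongr
      _ = Real.exp (16 / p) := by
        rw [← Real.exp_nat_mul]
        congr 1
        push_cast
        ring
  rw [le_div_iff₀ (by linarith), Real.exp_neg, inv_mul_le_iff₀ (Real.exp_pos _), mul_comm]
  exact h.trans (by gcongr)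

lemma card_primeFactors_mul_log_two_le {n : ℕ} (hn : n ≠ 0) :
    (n.primeFactors.card : ℝ) * Real.log 2 ≤ Real.log n := by
  refine le_trans ?_ (sum_log_primeFactors_le hn)
  rw [← nsmul_eq_mul]
  refine Finset.card_nsmul_le_sum _ _ _ fun p hp => ?_
  exact Real.log_le_log (by norm_num)
    (by exact_mod_cast (Nat.prime_of_mem_primeFactors hp).two_le)

/-- The factor a collects the primes p ≥ P dividing n. There are at most log n / log 2 of them, each
contributing at most e^{10/P} because p - 4 ≥ p/5, and 10 / log 2 < 15. -/
lemma prod_filter_primeFactors_eq {n : ℕ} (hn : n ≠ 0) (P c : ℝ) (hc0 : 0 ≤ c) (hc : c ≤ 2)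
    (hP : 2 ≤ P) :
    ∃ a : ℝ, 1 ≤ a ∧ a ≤ Real.exp (15 * Real.log n / P) ∧
      ∏ p ∈ n.primeFactors.filter (fun p => 5 ≤ p), (1 + c / ((p : ℝ) - 4)) =
        a * ∏ p ∈ primesBetween 5 P, (if p ∣ n then 1 + c / ((p : ℝ) - 4) else 1) := by
  set F := n.primeFactors.filter (fun p => 5 ≤ p) with hF
  have hF5 : ∀ p ∈ F, (5 : ℝ) ≤ p := fun p hp => by
    exact_mod_cast (Finset.mem_filter.1 hp).2
  have hfac : ∀ p ∈ F, 0 ≤ c / ((p : ℝ) - 4) := fun p hp => by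
    have := hF5 p hp
    exact div_nonneg hc0 (by linarith)
  refine ⟨∏ p ∈ F.filter (fun p : ℕ => ¬ (p : ℝ) < P), (1 + c / ((p : ℝ) - 4)), ?_, ?_, ?_⟩
  · refine Finset.one_le_prod fun p hp => ?_
    have := hfac p (Finset.mem_filter.1 hp).1
    linarith
  · have h1 : ∀ p ∈ F.filter (fun p : ℕ => ¬ (p : ℝ) < P),
        1 + c / ((p : ℝ) - 4) ≤ Real.exp (10 / P) := fun p hp => by
      obtain ⟨hp1, hp2⟩ := Finset.mem_filter.1 hp
      have h5 := hF5 p hp1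
      rw [add_comm]
      refine (Real.add_one_le_exp _).trans (Real.exp_le_exp.2 ?_)
      rw [div_le_div_iff₀ (by linarith) (by linarith)]
      have : P ≤ p := not_lt.1 hp2
      nlinarith
    refine (Finset.prod_le_prod (fun p hp => ?_) h1).trans ?_
    · have := hfac p (Finset.mem_filter.1 hp).1
      linarith
    · rw [Finset.prod_const, ← Real.exp_nat_mul, Real.exp_le_exp]
      have hcard : (F.filter (fun p : ℕ => ¬ (p : ℝ) < P)).card ≤ n.primeFactors.card :=
        (Finset.card_filter_le _ _).trans (Finset.card_filter_le _ _)
      have hcard' : ((F.filter (fun p : ℕ => ¬ (p : ℝ) < P)).card : ℝ) ≤ n.primeFactors.card := by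
        exact_mod_cast hcard
      have h2 := card_primeFactors_mul_log_two_le hn
      have h3 := Real.log_two_gt_d9
      have h4 : (0 : ℝ) ≤ n.primeFactors.card := by positivity
      rw [mul_div_assoc', div_le_div_iff_of_pos_right (by linarith)]
      nlinarith
  · rw [← Finset.prod_filter_mul_prod_filter_not F (fun p : ℕ => (p : ℝ) < P), mul_comm]
    congr 1
    rw [← Finset.prod_filter]
    refine Finset.prod_congr ?_ fun _ _ => rfl
    ext p
    simp only [hF, Finset.mem_filter, Nat.mem_primeFactors, mem_primesBetween]
    tauto

/-- The primes that occur in the local analysis of the sifted sum. -/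
noncomputable def localPrimes (r : ℕ) (P : ℝ) : Finset ℕ :=
  {2, 3} ∪ primesBetween 5 P ∪ r.primeFactors

/-- The factor w comes from the primes 2 and 3: it is (2 · 3/2)^4 = 81 when both lie below P.
Together with the densities 1/2 and 1/3 this gives the constant 27/2 = 81/6. -/
lemma exists_eulerProd_pow_eq {P : ℝ} :
    ∃ w : ℝ, 0 ≤ w ∧ w ≤ 81 ∧ (3 < P → w = 81) ∧
      eulerProd P ^ 4 = w * ∏ p ∈ primesBetween 5 P, ((1 - 1 / (p : ℝ))⁻¹) ^ 4 := by
  have hmem : ∀ p ∈ (primesBetween 2 P).filter (fun p => ¬ 5 ≤ p), p = 2 ∨ p = 3 := by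
    intro p hp
    obtain ⟨h1, h2⟩ := Finset.mem_filter.1 hp
    have hpr := (mem_primesBetween.1 h1).1
    have h3 := hpr.two_le
    have : p ≠ 4 := by
      rintro rfl
      exact absurd hpr (by decide)
    omega
  have hsub : (primesBetween 2 P).filter (fun p => ¬ 5 ≤ p) ⊆ {2, 3} := fun p hp => by
    simpa using hmem p hp
  have hpair : ∏ p ∈ ({2, 3} : Finset ℕ), (1 - 1 / (p : ℝ))⁻¹ = 3 := by
    rw [Finset.prod_pair (by norm_num)]
    norm_num
  have hone : ∀ p ∈ ({2, 3} : Finset ℕ), 1 ≤ (1 - 1 / (p : ℝ))⁻¹ := fun p hp => by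
    refine one_le_inv_one_sub_inv ?_
    have : p = 2 ∨ p = 3 := by simpa using hp
    rcases this with rfl | rfl <;> norm_num
  have hnn : 0 ≤ ∏ p ∈ (primesBetween 2 P).filter (fun p => ¬ 5 ≤ p), (1 - 1 / (p : ℝ))⁻¹ :=
    Finset.prod_nonneg fun p hp => zero_le_one.trans (hone p (hsub hp))
  refine ⟨(∏ p ∈ (primesBetween 2 P).filter (fun p => ¬ 5 ≤ p), (1 - 1 / (p : ℝ))⁻¹) ^ 4,
    by positivity, ?_, fun hP => ?_, ?_⟩
  · have : ∏ p ∈ (primesBetween 2 P).filter (fun p => ¬ 5 ≤ p), (1 - 1 / (p : ℝ))⁻¹ ≤ 3 := by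
      rw [← hpair]
      exact Finset.prod_le_prod_of_subset_of_one_le hsub
        (fun p hp => zero_le_one.trans (hone p (hsub hp))) fun p hp _ => hone p hp
    calc _ ≤ (3 : ℝ) ^ 4 := by gcongr
      _ = 81 := by norm_num
  · have : (primesBetween 2 P).filter (fun p => ¬ 5 ≤ p) = {2, 3} := by
      refine Finset.Subset.antisymm hsub fun p hp => ?_
      have : p = 2 ∨ p = 3 := by simpa using hp
      rw [Finset.mem_filter, mem_primesBetween]
      rcases this with rfl | rfl
      · refine ⟨⟨Nat.prime_two, le_rfl, ?_⟩, by norm_num⟩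
        norm_num
        linarith
      · exact ⟨⟨Nat.prime_three, by norm_num, by exact_mod_cast hP⟩, by norm_num⟩
    rw [this, hpair]
    norm_num
  · rw [Finset.prod_pow, ← mul_pow]
    congr 1
    unfold eulerProd
    rw [← Finset.prod_filter_mul_prod_filter_not _ (fun p => 5 ≤ p), mul_comm]
    congr 1
    refine Finset.prod_congr ?_ fun _ _ => rfl
    ext p
    simp only [Finset.mem_filter, mem_primesBetween]
    constructor
    · rintro ⟨⟨h1, h2, h3⟩, h4⟩
      exact ⟨h1, h4, h3⟩
    · rintro ⟨h1, h2, h3⟩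
      exact ⟨⟨h1, by omega, h3⟩, h2⟩

/-- The factor b comes from the primes dividing r that are at least 5 and at least P. There are at
most log r / log 2 of them, each of density at least e^{-16/P}, and 16 / log 2 < 24. -/
lemma exists_prod_localPrimes_eq {m : ℕ} (hm : m ≡ 4 [MOD 6]) {r : ℕ} (hr : r ≠ 0) {P : ℝ}
    (hP : 2 ≤ P) :
    ∃ b : ℝ, Real.exp (-(24 * Real.log r / P)) ≤ b ∧ b ≤ 1 ∧
      ∏ p ∈ localPrimes r P, (freeCount m p : ℝ) / p =
        1 / 6 * b * ∏ p ∈ primesBetween 5 P, (freeCount m p : ℝ) / p := by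
  set B := r.primeFactors \ ({2, 3} ∪ primesBetween 5 P) with hB
  have hB5 : ∀ p ∈ B, 5 ≤ p ∧ P ≤ p := fun p hp => by
    obtain ⟨h1, h2⟩ := Finset.mem_sdiff.1 hp
    have hpr := Nat.prime_of_mem_primeFactors h1
    simp only [Finset.mem_union, Finset.mem_insert, Finset.mem_singleton, mem_primesBetween,
      not_or, not_and, not_lt] at h2
    have h3 := hpr.two_le
    have h4 : p ≠ 4 := by
      rintro rfl
      exact absurd hpr (by decide)
    have h5 : 5 ≤ p := by omega
    exact ⟨h5, h2.2 hpr h5⟩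
  refine ⟨∏ p ∈ B, (freeCount m p : ℝ) / p, ?_, ?_, ?_⟩
  · have h1 : ∀ p ∈ B, Real.exp (-(16 / P)) ≤ (freeCount m p : ℝ) / p := fun p hp => by
      refine le_trans ?_ (exp_le_freeCount_div m (hB5 p hp).1)
      rw [Real.exp_le_exp, neg_le_neg_iff]
      exact div_le_div_of_nonneg_left (by norm_num) (by linarith) (hB5 p hp).2
    refine le_trans ?_ (Finset.prod_le_prod (fun _ _ => (Real.exp_pos _).le) h1)
    rw [Finset.prod_const, ← Real.exp_nat_mul, Real.exp_le_exp]
    have hcard : (B.card : ℝ) ≤ r.primeFactors.card := by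
      exact_mod_cast Finset.card_le_card Finset.sdiff_subset
    have h2 := card_primeFactors_mul_log_two_le hr
    have h3 := Real.log_two_gt_d9
    have h4 : (0 : ℝ) ≤ r.primeFactors.card := by positivity
    rw [mul_neg, neg_le_neg_iff, mul_div_assoc', div_le_div_iff_of_pos_right (by linarith)]
    nlinarith
  · exact Finset.prod_le_one (fun _ _ => by positivity)
      fun p hp => freeCount_div_le_one m (by have := (hB5 p hp).1; omega)
  · have hunion : localPrimes r P = ({2, 3} ∪ primesBetween 5 P) ∪ B := by
      rw [hB, Finset.union_sdiff_self_eq_union]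
      rfl
    rw [hunion, Finset.prod_union Finset.disjoint_sdiff, Finset.prod_union,
      Finset.prod_pair (by norm_num), freeCount_two hm, freeCount_three hm]
    · push_cast
      ring
    · rw [Finset.disjoint_left]
      intro p hp hp'
      have h5 := (mem_primesBetween.1 hp').2.1
      have : p = 2 ∨ p = 3 := by simpa using hp
      omega

lemma singularSeries_pos {m : ℕ} (hm : m ≡ 4 [MOD 6]) : 0 < singularSeries m := by
  obtain ⟨t, ht, -, heq⟩ := exists_tprod_eq (P := 2) le_rfl
  have htpos : 0 < t := (Real.exp_pos _).trans_le ht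
  have hpos : ∀ (n : ℕ) (c : ℝ), 0 ≤ c →
      0 < ∏ p ∈ n.primeFactors.filter (fun p => 5 ≤ p), (1 + c / ((p : ℝ) - 4)) := by
    intro n c hc
    refine Finset.prod_pos fun p hp => ?_
    have : (5 : ℝ) ≤ p := by exact_mod_cast (Finset.mem_filter.1 hp).2
    have : 0 ≤ c / ((p : ℝ) - 4) := div_nonneg hc (by linarith)
    linarith
  unfold singularSeries
  rw [if_pos hm, heq]
  have h1 := hpos (m * (m + 4)) 1 zero_le_one
  have h2 := hpos (m + 2) 2 zero_le_two
  have h3 : 0 < ∏ p ∈ primesBetween 5 (2 : ℝ), (1 - singularDefect p) :=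
    Finset.prod_pos fun p hp => (Real.exp_pos _).trans_le
      (exp_le_one_sub_singularDefect (by exact_mod_cast (mem_primesBetween.1 hp).2.1))
  positivity

lemma singularSeries_le (m : ℕ) (hm0 : 0 < m) : singularSeries m ≤ 405 / 2 * (m : ℝ) ^ 3 := by
  have hbd : ∀ (n : ℕ) (c : ℝ), n ≠ 0 → 0 ≤ c → c ≤ 2 →
      ∏ p ∈ n.primeFactors.filter (fun p => 5 ≤ p), (1 + c / ((p : ℝ) - 4)) ≤ n ∧
      0 ≤ ∏ p ∈ n.primeFactors.filter (fun p => 5 ≤ p), (1 + c / ((p : ℝ) - 4)) := by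
    intro n c hn hc hc2
    have h5 : ∀ p ∈ n.primeFactors.filter (fun p => 5 ≤ p), (5 : ℝ) ≤ p := fun p hp => by
      exact_mod_cast (Finset.mem_filter.1 hp).2
    have h0 : ∀ p ∈ n.primeFactors.filter (fun p => 5 ≤ p), 0 ≤ 1 + c / ((p : ℝ) - 4) :=
      fun p hp => by
        have := h5 p hp
        have : 0 ≤ c / ((p : ℝ) - 4) := div_nonneg hc (by linarith)
        linarith
    refine ⟨?_, Finset.prod_nonneg h0⟩
    calc _ ≤ ∏ p ∈ n.primeFactors.filter (fun p => 5 ≤ p), (p : ℝ) :=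
          Finset.prod_le_prod h0 fun p hp => by
            have := h5 p hp
            have : c / ((p : ℝ) - 4) ≤ 2 := by
              rw [div_le_iff₀ (by linarith)]
              linarith
            linarith
      _ ≤ ∏ p ∈ n.primeFactors, (p : ℝ) :=
          Finset.prod_le_prod_of_subset_of_one_le (Finset.filter_subset _ _)
            (fun p _ => by positivity) fun p hp _ => by
              exact_mod_cast (Nat.prime_of_mem_primeFactors hp).one_le
      _ = ((∏ p ∈ n.primeFactors, p : ℕ) : ℝ) := by push_cast; rfl
      _ ≤ n := by
          exact_mod_cast Nat.le_of_dvd (Nat.pos_of_ne_zero hn) (Nat.prod_primeFactors_dvd n)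
  have hm1 : (1 : ℝ) ≤ m := by exact_mod_cast hm0
  unfold singularSeries
  split_ifs with h
  · obtain ⟨t, ht, ht1, heq⟩ := exists_tprod_eq (P := 2) le_rfl
    have hprod : ∏ p ∈ primesBetween 5 (2 : ℝ), (1 - singularDefect p) = 1 := by
      refine Finset.prod_eq_one fun p hp => ?_
      have h1 := (mem_primesBetween.1 hp).2
      have h2 : (5 : ℝ) ≤ p := by exact_mod_cast h1.1
      linarith
    rw [hprod, mul_one] at heq
    rw [heq]
    have htpos : 0 < t := (Real.exp_pos _).trans_le ht
    have h1 := hbd (m * (m + 4)) 1 (by positivity) zero_le_one one_le_two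
    have h2 := hbd (m + 2) 2 (by positivity) zero_le_two le_rfl
    calc _ ≤ 27 / 2 * 1 * ((m * (m + 4) : ℕ) : ℝ) * ((m + 2 : ℕ) : ℝ) := by
          have := h1.2
          have := h2.2
          gcongr
          · exact h1.1
          · exact h2.1
      _ ≤ 27 / 2 * 1 * (5 * (m : ℝ) ^ 2) * (3 * m) := by
          have e1 : ((m * (m + 4) : ℕ) : ℝ) ≤ 5 * (m : ℝ) ^ 2 := by
            push_cast
            nlinarith
          have e2 : ((m + 2 : ℕ) : ℝ) ≤ 3 * m := by
            push_cast
            linarith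
          gcongr
      _ = _ := by ring
  · positivity

/-- Comparison of the truncated local densities with the singular series. -/
lemma exists_ratio_singularSeries : ∃ C : ℝ, 0 < C ∧
    ∀ (m r : ℕ) (P : ℝ), m ≡ 4 [MOD 6] → r ≠ 0 → 2 ≤ P →
      ∃ ρ : ℝ, 0 ≤ ρ ∧ ρ ≤ C ∧
        eulerProd P ^ 4 * ∏ p ∈ localPrimes r P, (freeCount m p : ℝ) / p =
          ρ * singularSeries m ∧
        (r ≤ m ^ 4 → |ρ - 1| ≤ C * (Real.log m / P)) := by
  have hE : 1 ≤ Real.exp 38 := Real.one_le_exp (by norm_num)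
  refine ⟨200 * Real.exp 38, by positivity, fun m r P hm hr hP => ?_⟩
  obtain ⟨t, ht, ht1, hteq⟩ := exists_tprod_eq hP
  obtain ⟨w, hw0, hw, hw3, hweq⟩ := exists_eulerProd_pow_eq (P := P)
  obtain ⟨b, hb, hb1, hbeq⟩ := exists_prod_localPrimes_eq hm hr hP
  have hm6 : m % 6 = 4 := hm
  have hm4 : 4 ≤ m := by omega
  obtain ⟨a₁, ha₁, ha₁', ha₁eq⟩ := prod_filter_primeFactors_eq (n := m * (m + 4)) (by positivity)
    P 1 zero_le_one one_le_two hP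
  obtain ⟨a₂, ha₂, ha₂', ha₂eq⟩ := prod_filter_primeFactors_eq (n := m + 2) (by positivity)
    P 2 zero_le_two le_rfl hP
  have hP0 : 0 < P := by linarith
  have htpos : 0 < t := (Real.exp_pos _).trans_le ht
  have hbpos : 0 < b := (Real.exp_pos _).trans_le hb
  have ha12 : 1 ≤ a₁ * a₂ := one_le_mul_of_one_le_of_one_le ha₁ ha₂
  set Q := ∏ p ∈ primesBetween 5 P, ((freeCount m p : ℝ) / p * ((1 - 1 / (p : ℝ))⁻¹) ^ 4) with hQ
  have hS : singularSeries m = 27 / 2 * t * a₁ * a₂ * Q := by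
    have hQ' : Q = (∏ p ∈ primesBetween 5 P, (1 - singularDefect p)) *
        (∏ p ∈ primesBetween 5 P, (if p ∣ m * (m + 4) then 1 + 1 / ((p : ℝ) - 4) else 1)) *
        ∏ p ∈ primesBetween 5 P, (if p ∣ m + 2 then 1 + 2 / ((p : ℝ) - 4) else 1) := by
      rw [hQ, ← Finset.prod_mul_distrib, ← Finset.prod_mul_distrib]
      exact Finset.prod_congr rfl fun p hp =>
        freeCount_div_mul_pow m (mem_primesBetween.1 hp).1 (mem_primesBetween.1 hp).2.1
    unfold singularSeries
    rw [if_pos hm, hteq, ha₁eq, ha₂eq, hQ']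
    ring
  -- The four factors correct for the primes 2 and 3 when P is small, for large primes dividing r,
  -- for the tail of the Euler product, and for large primes dividing m(m + 4)(m + 2).
  set ρ := w / 81 * b * t⁻¹ * (a₁ * a₂)⁻¹ with hρ
  have hρ0 : 0 ≤ ρ := by positivity
  have htinv : t⁻¹ ≤ Real.exp (76 / P) := by
    rw [Real.exp_neg] at ht
    exact inv_le_of_inv_le₀ (Real.exp_pos _) ht
  have hainv : (a₁ * a₂)⁻¹ ≤ 1 := inv_le_one_of_one_le₀ ha12
  have hρle : ρ ≤ Real.exp (76 / P) := by
    calc ρ ≤ 1 * 1 * Real.exp (76 / P) * 1 := by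
          rw [hρ]
          gcongr
          rw [div_le_one (by norm_num)]
          exact hw
      _ = _ := by ring
  have h76 : Real.exp (76 / P) ≤ Real.exp 38 := by
    rw [Real.exp_le_exp, div_le_iff₀ hP0]
    linarith
  have hlogm : 1 ≤ Real.log m := by
    rw [Real.le_log_iff_exp_le (by positivity)]
    have h1 := Real.exp_one_lt_d9
    have h2 : (4 : ℝ) ≤ m := by exact_mod_cast hm4
    linarith
  refine ⟨ρ, hρ0, (hρle.trans h76).trans (by linarith), ?_, fun hrm => ?_⟩
  · have hQw : eulerProd P ^ 4 * ∏ p ∈ localPrimes r P, (freeCount m p : ℝ) / p =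
        w * (1 / 6 * b) * Q := by
      rw [hbeq, hweq, hQ, Finset.prod_mul_distrib]
      ring
    rw [hQw, hS, hρ]
    field_simp
    ring
  have hlogP : 1 / P ≤ Real.log m / P := by gcongr
  rw [abs_le]
  constructor
  -- For P ≤ 3 the factor w may differ from 81, but then log m / P ≥ 1/3 and the lower bound is
  -- trivial.
  · rcases le_or_gt P 3 with h3 | h3
    · have : 1 / 3 ≤ Real.log m / P := by
        rw [div_le_div_iff₀ (by norm_num) hP0]
        nlinarith
      have : 1 / 3 ≤ Real.exp 38 * (Real.log m / P) := by nlinarith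
      linarith
    · have hlr : Real.log r ≤ 4 * Real.log m := by
        have h1 : (r : ℝ) ≤ (m : ℝ) ^ 4 := by exact_mod_cast hrm
        have h2 := Real.log_le_log (by positivity) h1
        rw [Real.log_pow] at h2
        exact_mod_cast h2
      have hl3 : ∀ n : ℕ, n ≠ 0 → n ≤ m ^ 3 → Real.log n ≤ 3 * Real.log m := fun n hn h => by
        have h1 : (n : ℝ) ≤ (m : ℝ) ^ 3 := by exact_mod_cast h
        have h2 := Real.log_le_log (by positivity) h1
        rw [Real.log_pow] at h2
        exact_mod_cast h2
      have hl1 := hl3 (m * (m + 4)) (by positivity) (by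
        calc m * (m + 4) ≤ m * (m * m) := Nat.mul_le_mul_left _ (by nlinarith)
          _ = m ^ 3 := by ring)
      have hl2 := hl3 (m + 2) (by positivity) (by
        calc m + 2 ≤ m * 2 := by omega
          _ ≤ m * (m * m) := Nat.mul_le_mul_left _ (by nlinarith)
          _ = m ^ 3 := by ring)
      -- Here 186 = 96 + 90: 24 · 4 from b, by log r ≤ 4 log m, and 15 · (3 + 3) from a₁ and a₂.
      have hK : Real.exp (-(186 * (Real.log m / P))) ≤ ρ := by
        rw [hρ, hw3 h3]
        have e1 : Real.exp (-(96 * (Real.log m / P))) ≤ b := by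
          refine le_trans ?_ hb
          rw [Real.exp_le_exp, neg_le_neg_iff, mul_div_assoc']
          exact div_le_div_of_nonneg_right (by linarith) hP0.le
        have e2 : Real.exp (-(90 * (Real.log m / P))) ≤ (a₁ * a₂)⁻¹ := by
          rw [Real.exp_neg]
          refine inv_anti₀ (by positivity) ?_
          calc a₁ * a₂ ≤ Real.exp (15 * Real.log (m * (m + 4) : ℕ) / P) *
                Real.exp (15 * Real.log (m + 2 : ℕ) / P) := by gcongr
            _ ≤ _ := by
              rw [← Real.exp_add, Real.exp_le_exp, ← add_div, mul_div_assoc']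
              exact div_le_div_of_nonneg_right (by linarith) hP0.le
        have e3 : 1 ≤ t⁻¹ := (one_le_inv₀ htpos).2 ht1
        calc Real.exp (-(186 * (Real.log m / P))) = 81 / 81 * Real.exp (-(96 * (Real.log m / P))) *
              1 * Real.exp (-(90 * (Real.log m / P))) := by
              rw [div_self (by norm_num), one_mul, mul_one, ← Real.exp_add]
              congr 1
              ring
          _ ≤ _ := by gcongr
      have := Real.add_one_le_exp (-(186 * (Real.log m / P)))
      have h0 : 0 ≤ Real.log m / P := by positivity
      have := le_mul_of_one_le_left h0 hE
      linarith
  · have h1 : Real.exp (76 / P) - 1 ≤ 76 / P * Real.exp (76 / P) := by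
      have := Real.add_one_le_exp (-(76 / P))
      have h2 : Real.exp (-(76 / P)) * Real.exp (76 / P) = 1 := by
        rw [← Real.exp_add]
        simp
      nlinarith [Real.exp_pos (76 / P)]
    have h2 : 76 / P * Real.exp (76 / P) ≤ 76 * (Real.log m / P) * Real.exp 38 := by
      have hx : 76 / P ≤ 76 * (Real.log m / P) := by
        have : 76 / P = 76 * (1 / P) := by ring
        linarith
      exact mul_le_mul hx h76 (Real.exp_pos _).le (by positivity)
    have h0 : 0 ≤ Real.exp 38 * (Real.log m / P) := by positivity
    linarith

/-! ### Character sums over sifted residues -/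

lemma sum_range_mul_of_periodic {R : Type*} [CommSemiring R] {d : ℕ} {F : ℤ → R}
    (hF : Function.Periodic F (d : ℤ)) (k : ℕ) :
    ∑ n ∈ Finset.range (d * k), F n = k * ∑ n ∈ Finset.range d, F n := by
  induction k with
  | zero => simp
  | succ k ih =>
    rw [mul_add_one, Finset.sum_range_add, ih]
    have : ∀ x ∈ Finset.range d, F ((d * k + x : ℕ) : ℤ) = F x := fun x _ => by
      rw [add_comm]
      push_cast
      exact hF.int_add_mul x k
    rw [Finset.sum_congr rfl this]
    push_cast
    ring

/-- The number of residues modulo `r` with prescribed residues modulo some primes dividing `r`. -/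
lemma sum_range_prod_eq {r : ℕ} {T : Finset ℕ} (hT : T ⊆ r.primeFactors) {F : ℕ → ℤ → ℝ}
    (hF : ∀ p ∈ T, Function.Periodic (F p) (p : ℤ)) :
    ∑ n ∈ Finset.range r, ∏ p ∈ T, F p n =
      ((r / ∏ p ∈ T, p : ℕ) : ℝ) * ∏ p ∈ T, ∑ n ∈ Finset.range p, F p n := by
  have hpr : ∀ p ∈ T, p.Prime := fun p hp => Nat.prime_of_mem_primeFactors (hT hp)
  have hd : ∏ p ∈ T, p ∣ r :=
    (Finset.prod_dvd_prod_of_subset _ _ _ hT).trans (Nat.prod_primeFactors_dvd r)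
  have h1 := sum_range_mul_prod (M := 1) (h := fun _ => (1 : ℝ)) (fun _ => rfl) hpr
    (fun p _ => Nat.coprime_one_left p) hF
  simp only [one_mul, Finset.range_one, Finset.sum_singleton] at h1
  have hper : Function.Periodic (fun n : ℤ => ∏ p ∈ T, F p n) ((∏ p ∈ T, p : ℕ) : ℤ) := by
    intro n
    refine Finset.prod_congr rfl fun p hp => ?_
    obtain ⟨k, hk⟩ := Finset.dvd_prod_of_mem (fun p : ℕ => p) hp
    rw [hk, Nat.cast_mul]
    exact (hF p hp).int_add_mul n _
  have h2 := sum_range_mul_of_periodic hper (r / ∏ p ∈ T, p)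
  rw [Nat.mul_div_cancel' hd, h1] at h2
  exact h2

lemma natCast_cast_zmod {r p : ℕ} (h : p ∣ r) (n : ℕ) :
    (ZMod.cast ((n : ℕ) : ZMod r) : ZMod p) = (n : ZMod p) := ZMod.cast_natCast h n

lemma card_filter_cast_mem_le {r : ℕ} [NeZero r] {T : Finset ℕ} (hT : T ⊆ r.primeFactors)
    (Z : (p : ℕ) → Finset (ZMod p)) {k : ℕ} (hZ : ∀ p ∈ r.primeFactors, (Z p).card ≤ k) :
    (((Finset.univ : Finset (ZMod r)).filter
      (fun x => ∀ p ∈ T, (ZMod.cast x : ZMod p) ∈ Z p)).card : ℝ) ≤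
      ((r / ∏ p ∈ T, p : ℕ) : ℝ) * k ^ T.card := by
  have hdvd : ∀ p ∈ T, p ∣ r := fun p hp => Nat.dvd_of_mem_primeFactors (hT hp)
  rw [Finset.card_filter]
  push_cast
  rw [← sum_range_eq_sum_zmod r
    (fun x : ZMod r => if ∀ p ∈ T, (ZMod.cast x : ZMod p) ∈ Z p then (1 : ℝ) else 0)]
  have h1 : ∀ n ∈ Finset.range r,
      (if ∀ p ∈ T, (ZMod.cast ((n : ℕ) : ZMod r) : ZMod p) ∈ Z p then (1 : ℝ) else 0) =
      ∏ p ∈ T, (if (((n : ℕ) : ℤ) : ZMod p) ∈ Z p then (1 : ℝ) else 0) := fun n _ => by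
    rw [Finset.prod_ite_zero, Finset.prod_const_one]
    refine if_congr (forall₂_congr fun p hp => ?_) rfl rfl
    rw [natCast_cast_zmod (hdvd p hp), Int.cast_natCast]
  rw [Finset.sum_congr rfl h1, sum_range_prod_eq hT
    (F := fun p n => if ((n : ℤ) : ZMod p) ∈ Z p then (1 : ℝ) else 0) (fun p _ n => by simp)]
  refine mul_le_mul_of_nonneg_left ?_ (Nat.cast_nonneg _)
  rw [← Finset.prod_const]
  refine Finset.prod_le_prod (fun p _ => Finset.sum_nonneg fun n _ => by positivity) fun p hp => ?_
  have : NeZero p := ⟨(Nat.prime_of_mem_primeFactors (hT hp)).ne_zero⟩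
  have h2 := sum_range_eq_sum_zmod p (fun x => if x ∈ Z p then (1 : ℝ) else 0)
  simp only [Int.cast_natCast]
  rw [h2, Finset.sum_ite_mem, Finset.univ_inter, Finset.sum_const, nsmul_one]
  exact_mod_cast hZ p (hT hp)

open Classical in
/-- A sum over sifted residues, of a function which is multiplied by a constant `≠ 1` by
permutations that preserve the residues modulo the small divisors of `r`. -/
lemma norm_sum_sifted_le {r : ℕ} [NeZero r] {ψ : ZMod r → ℂ} (hψ : ∀ x, ‖ψ x‖ ≤ 1)
    (Z : (p : ℕ) → Finset (ZMod p)) {k : ℕ} (hk : 1 ≤ k)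
    (hZ : ∀ p ∈ r.primeFactors, (Z p).card ≤ k)
    (hinv : ∀ d, d ∣ r → Squarefree d → 2 * d < r →
      ∃ (e : ZMod r ≃ ZMod r) (ω : ℂ), ω ≠ 1 ∧ (∀ x, ψ (e x) = ω * ψ x) ∧
        ∀ x, ∀ p, p.Prime → p ∣ d → (ZMod.cast (e x) : ZMod p) = ZMod.cast x) :
    ‖∑ x, if ∀ p ∈ r.primeFactors, (ZMod.cast x : ZMod p) ∉ Z p then ψ x else 0‖ ≤
      4 * (k : ℝ) ^ r.primeFactors.card := by
  have hr : r ≠ 0 := NeZero.ne r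
  set S : Finset ℕ → ℂ := fun T =>
    ∑ x, if ∀ p ∈ T, (ZMod.cast x : ZMod p) ∈ Z p then ψ x else 0 with hS
  have hprod : ∀ T ∈ r.primeFactors.powerset, ∏ p ∈ T, p ∣ r ∧ Squarefree (∏ p ∈ T, p) ∧
      (∏ p ∈ T, p).primeFactors = T := fun T hT => by
    rw [Finset.mem_powerset] at hT
    have hpr : ∀ p ∈ T, p.Prime := fun p hp => Nat.prime_of_mem_primeFactors (hT hp)
    refine ⟨(Finset.prod_dvd_prod_of_subset _ _ _ hT).trans (Nat.prod_primeFactors_dvd r), ?_,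
      Nat.primeFactors_prod hpr⟩
    refine Finset.squarefree_prod_of_pairwise_isCoprime (fun p hp q hq hpq => ?_)
      fun p hp => (hpr p hp).prime.squarefree
    exact Nat.coprime_iff_isRelPrime.1 ((Nat.coprime_primes (hpr p hp) (hpr q hq)).2 hpq)
  -- Inclusion-exclusion over the sets T of primes dividing r at which x falls in an excluded class.
  have hexpand : (∑ x, if ∀ p ∈ r.primeFactors, (ZMod.cast x : ZMod p) ∉ Z p then ψ x else 0) =
      ∑ T ∈ r.primeFactors.powerset, (-1 : ℂ) ^ T.card * S T := by
    simp only [hS, Finset.mul_sum]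
    rw [Finset.sum_comm]
    refine Finset.sum_congr rfl fun x _ => ?_
    have h1 : (if ∀ p ∈ r.primeFactors, (ZMod.cast x : ZMod p) ∉ Z p then (1 : ℂ) else 0) =
        ∏ p ∈ r.primeFactors, (1 + if (ZMod.cast x : ZMod p) ∈ Z p then (-1 : ℂ) else 0) := by
      rw [← Finset.prod_const_one (s := r.primeFactors), ← Finset.prod_ite_zero]
      refine Finset.prod_congr rfl fun p _ => ?_
      split_ifs <;> simp_all
    have h2 : (if ∀ p ∈ r.primeFactors, (ZMod.cast x : ZMod p) ∉ Z p then ψ x else 0) =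
        (if ∀ p ∈ r.primeFactors, (ZMod.cast x : ZMod p) ∉ Z p then (1 : ℂ) else 0) * ψ x := by
      rw [ite_mul, one_mul, zero_mul]
    rw [h2, h1, Finset.prod_one_add, Finset.sum_mul]
    refine Finset.sum_congr rfl fun T _ => ?_
    rw [Finset.prod_ite_zero, Finset.prod_const]
    split_ifs <;> simp
  -- The permutation preserves the conditions defining `S T` and multiplies its summands by ω ≠ 1.
  have hzero : ∀ T ∈ r.primeFactors.powerset, 2 * ∏ p ∈ T, p < r → S T = 0 := by
    intro T hT hlt
    obtain ⟨h1, h2, h3⟩ := hprod T hT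
    obtain ⟨e, ω, hω, he, hcast⟩ := hinv _ h1 h2 hlt
    have hmul : S T = ω * S T := by
      simp only [hS]
      conv_lhs => rw [← Equiv.sum_comp e]
      rw [Finset.mul_sum]
      refine Finset.sum_congr rfl fun x _ => ?_
      rw [he, mul_ite, mul_zero]
      refine if_congr (forall₂_congr fun p hp => ?_) rfl rfl
      rw [← h3] at hp
      rw [hcast x p (Nat.prime_of_mem_primeFactors hp) (Nat.dvd_of_mem_primeFactors hp)]
    have : (1 - ω) * S T = 0 := by linear_combination hmul
    rcases mul_eq_zero.1 this with h | h
    · exact absurd (sub_eq_zero.1 h).symm hω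
    · exact h
  have hbound : ∀ T ∈ r.primeFactors.powerset, ¬ 2 * ∏ p ∈ T, p < r →
      ‖S T‖ ≤ 2 * (k : ℝ) ^ r.primeFactors.card := by
    intro T hT hlt
    obtain ⟨h1, h2, h3⟩ := hprod T hT
    rw [Finset.mem_powerset] at hT
    have h4 : ‖S T‖ ≤ (((Finset.univ : Finset (ZMod r)).filter
        (fun x => ∀ p ∈ T, (ZMod.cast x : ZMod p) ∈ Z p)).card : ℝ) := by
      refine (norm_sum_le _ _).trans ?_
      rw [Finset.card_filter]
      push_cast
      refine Finset.sum_le_sum fun x _ => ?_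
      split_ifs
      · exact hψ x
      · simp
    have hd0 : 0 < ∏ p ∈ T, p := Nat.pos_of_ne_zero h2.ne_zero
    have h5 : r / ∏ p ∈ T, p ≤ 2 := Nat.div_le_of_le_mul (by omega)
    refine (h4.trans (card_filter_cast_mem_le hT Z hZ)).trans ?_
    have hk' : (1 : ℝ) ≤ k := by exact_mod_cast hk
    gcongr
    exact_mod_cast h5
  -- For the remaining sets the quotient of r by the product is 1 or 2, and the quotient determines
  -- the set.
  have hcard : (r.primeFactors.powerset.filter (fun T => ¬ 2 * ∏ p ∈ T, p < r)).card ≤ 2 := by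
    have hinj : Set.InjOn (fun T : Finset ℕ => r / ∏ p ∈ T, p)
        (r.primeFactors.powerset.filter (fun T => ¬ 2 * ∏ p ∈ T, p < r) : Set (Finset ℕ)) := by
      intro T hT T' hT' heq
      have hT1 := hprod T (Finset.mem_filter.1 hT).1
      have hT2 := hprod T' (Finset.mem_filter.1 hT').1
      have e1 : ∏ p ∈ T, p = ∏ p ∈ T', p := by
        have a1 := Nat.div_mul_cancel hT1.1
        have a2 := Nat.div_mul_cancel hT2.1
        simp only at heq
        rw [heq] at a1
        have : 0 < r / ∏ p ∈ T', p :=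
          Nat.div_pos (Nat.le_of_dvd (Nat.pos_of_ne_zero hr) hT2.1)
            (Nat.pos_of_ne_zero hT2.2.1.ne_zero)
        exact Nat.eq_of_mul_eq_mul_left this (a1.trans a2.symm)
      rw [← hT1.2.2, ← hT2.2.2, e1]
    have := Finset.card_le_card_of_injOn (t := Finset.Icc 1 2) _ (fun T hT => by
      obtain ⟨hT1, hT2⟩ := Finset.mem_filter.1 hT
      have hT3 := hprod T hT1
      refine Finset.mem_coe.2 (Finset.mem_Icc.2 ⟨?_, Nat.div_le_of_le_mul (by omega)⟩)
      exact Nat.div_pos (Nat.le_of_dvd (Nat.pos_of_ne_zero hr) hT3.1)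
        (Nat.pos_of_ne_zero hT3.2.1.ne_zero)) hinj
    simpa using this
  rw [hexpand]
  refine (norm_sum_le _ _).trans ?_
  have hterm : ∀ T ∈ r.primeFactors.powerset, ‖(-1 : ℂ) ^ T.card * S T‖ ≤
      if ¬ 2 * ∏ p ∈ T, p < r then 2 * (k : ℝ) ^ r.primeFactors.card else 0 := fun T hT => by
    rw [norm_mul, norm_pow, norm_neg, norm_one, one_pow, one_mul]
    split_ifs with h
    · rw [hzero T hT h, norm_zero]
    · exact hbound T hT h
  refine (Finset.sum_le_sum hterm).trans ?_
  rw [← Finset.sum_filter, Finset.sum_const, nsmul_eq_mul]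
  calc _ ≤ (2 : ℝ) * (2 * (k : ℝ) ^ r.primeFactors.card) := by
        refine mul_le_mul_of_nonneg_right ?_ (by positivity)
        exact_mod_cast hcard
    _ = _ := by ring

section

variable {r : ℕ} [NeZero r] {χ : DirichletCharacter ℂ r}

/-- A primitive character is nontrivial on the units that are `1` modulo a proper divisor. -/
lemma DirichletCharacter.IsPrimitive.exists_unit_ne_one (hχ : χ.IsPrimitive) {d : ℕ} (hd : d ∣ r)
    (hlt : d < r) : ∃ u : (ZMod r)ˣ, (u : ZMod r).val ≡ 1 [MOD d] ∧ χ u ≠ 1 := by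
  by_contra hcon
  push Not at hcon
  have hf : χ.FactorsThrough d := by
    rw [DirichletCharacter.factorsThrough_iff_ker_unitsMap hd]
    intro u hu
    rw [MonoidHom.mem_ker] at hu ⊢
    have h1 : (u : ZMod r).val ≡ 1 [MOD d] := by
      have h2 := congrArg Units.val hu
      rw [ZMod.unitsMap_val, Units.val_one, ZMod.cast_eq_val] at h2
      rw [← ZMod.natCast_eq_natCast_iff, h2, Nat.cast_one]
    have h3 := hcon u h1
    ext
    rw [MulChar.coe_toUnitHom, h3, Units.val_one]
  have h1 : χ.conductor ≤ d := Nat.sInf_le hf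
  rw [DirichletCharacter.isPrimitive_def] at hχ
  omega

lemma zmod_cast_sub_one_eq_zero {u : ZMod r} {d p : ℕ} (hd : d ∣ r) (hp : p ∣ d)
    (hu : u.val ≡ 1 [MOD d]) : (ZMod.cast (u - 1) : ZMod p) = 0 := by
  have hpr : p ∣ r := hp.trans hd
  rw [ZMod.cast_sub hpr, ZMod.cast_one hpr, ZMod.cast_eq_val,
    (ZMod.natCast_eq_natCast_iff _ _ p).2 (hu.of_dvd hp), Nat.cast_one, sub_self]

/-- Sums of a character over the values of a linear polynomial. -/
lemma norm_sum_sifted_linear_le {α β : ZMod r}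
    (hα : ∀ d, d ∣ r → Squarefree d → 2 * d < r → ∃ h : ZMod r, IsUnit (1 + α * h) ∧
      χ (1 + α * h) ≠ 1 ∧ ∀ p, p.Prime → p ∣ d → (ZMod.cast h : ZMod p) = 0)
    (Z : (p : ℕ) → Finset (ZMod p)) (hZ : ∀ p ∈ r.primeFactors, (Z p).card ≤ 4)
    [DecidablePred fun x : ZMod r => ∀ p ∈ r.primeFactors, (ZMod.cast x : ZMod p) ∉ Z p] :
    ‖∑ x, if ∀ p ∈ r.primeFactors, (ZMod.cast x : ZMod p) ∉ Z p then χ (α * x + β) else 0‖ ≤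
      4 * (4 : ℝ) ^ r.primeFactors.card := by
  have := norm_sum_sifted_le (ψ := fun x => χ (α * x + β)) (fun x => χ.norm_le_one _) Z
    (k := 4) (by norm_num) hZ (fun d hd hsq hlt => by
      obtain ⟨h, ⟨u, hu⟩, hne, hcast⟩ := hα d hd hsq hlt
      -- The substitution x ↦ (1 + αh)x + hβ multiplies αx + β by 1 + αh, and it fixes x modulo
      -- every prime dividing d because h vanishes there.
      refine ⟨(Units.mulLeft u).trans (Equiv.addRight (h * β)), χ (1 + α * h), hne, fun x => ?_,
        fun x p hp hpd => ?_⟩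
      · rw [← map_mul]
        congr 1
        simp only [Equiv.trans_apply, Units.mulLeft_apply, Equiv.coe_addRight, hu]
        ring
      · have hpr : p ∣ r := hpd.trans hd
        simp only [Equiv.trans_apply, Units.mulLeft_apply, Equiv.coe_addRight, hu]
        rw [ZMod.cast_add hpr, ZMod.cast_mul hpr, ZMod.cast_add hpr, ZMod.cast_mul hpr,
          ZMod.cast_mul hpr, hcast p hp hpd, ZMod.cast_one hpr]
        ring)
  rw [Nat.cast_ofNat] at this
  convert this

/-- As α is its own inverse, h = α(u - 1) solves 1 + αh = u for a unit u ≡ 1 (mod d) with χ(u) ≠ 1.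
The cases used are α = 1 and α = -1. -/
lemma exists_shift_of_mul_self_eq_one (hχ : χ.IsPrimitive) {α : ZMod r} (hα : α * α = 1) :
    ∀ d, d ∣ r → Squarefree d → 2 * d < r → ∃ h : ZMod r, IsUnit (1 + α * h) ∧
      χ (1 + α * h) ≠ 1 ∧ ∀ p, p.Prime → p ∣ d → (ZMod.cast h : ZMod p) = 0 := by
  intro d hd _ hlt
  obtain ⟨u, hu, hne⟩ := hχ.exists_unit_ne_one hd (by omega)
  have heq : 1 + α * (α * ((u : ZMod r) - 1)) = u := by
    rw [← mul_assoc, hα]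
    ring
  refine ⟨α * ((u : ZMod r) - 1), ?_, ?_, fun p _ hpd => ?_⟩
  · rw [heq]
    exact u.isUnit
  · rwa [heq]
  · rw [ZMod.cast_mul (hpd.trans hd), zmod_cast_sub_one_eq_zero hd hpd hu, mul_zero]

/-- A primitive character has no conductor `≡ 2 (mod 4)`. -/
lemma DirichletCharacter.IsPrimitive.not_two_mod_four (hχ : χ.IsPrimitive) : r % 4 ≠ 2 := by
  intro h4
  have hd : r / 2 ∣ r := ⟨2, by omega⟩
  obtain ⟨u, hu, hne⟩ := hχ.exists_unit_ne_one hd (by omega)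
  apply hne
  have hodd : (u : ZMod r).val ≡ 1 [MOD 2] := by
    have hc : Nat.Coprime (u : ZMod r).val r := ZMod.val_coe_unit_coprime u
    have h2 : ¬ 2 ∣ (u : ZMod r).val := fun h =>
      Nat.not_coprime_of_dvd_of_dvd (by norm_num) h (by omega : 2 ∣ r) hc
    change _ % 2 = 1 % 2
    omega
  -- The unit is 1 modulo r/2 and odd. As r/2 is odd, it is 1 modulo r, which contradicts χ(u) ≠ 1.
  have hcop : Nat.Coprime (r / 2) 2 := by
    rw [Nat.coprime_two_right, Nat.odd_iff]
    omega
  have h1 := (Nat.modEq_and_modEq_iff_modEq_mul hcop).1 ⟨hu, hodd⟩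
  rw [show r / 2 * 2 = r by omega, ← ZMod.natCast_eq_natCast_iff, ZMod.natCast_zmod_val,
    Nat.cast_one] at h1
  rw [h1, map_one]

/-- For odd r one inverts 2. For even r, the exclusion of r ≡ 2 (mod 4) and the squarefreeness of d
give 2d ∣ r, and a unit u ≡ 1 (mod 2d) has the form 1 + 2h with d ∣ h. This is why the excluded
range is 2d ≥ r rather than d = r. -/
lemma exists_shift_two (hχ : χ.IsPrimitive) :
    ∀ d, d ∣ r → Squarefree d → 2 * d < r → ∃ h : ZMod r, IsUnit (1 + 2 * h) ∧
      χ (1 + 2 * h) ≠ 1 ∧ ∀ p, p.Prime → p ∣ d → (ZMod.cast h : ZMod p) = 0 := by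
  intro d hd hsq hlt
  by_cases hodd : r % 2 = 1
  · obtain ⟨u, hu, hne⟩ := hχ.exists_unit_ne_one hd (by omega)
    have h2 : (2 : ZMod r) * (2 : ZMod r)⁻¹ = 1 := by
      have : IsUnit ((2 : ℕ) : ZMod r) :=
        (ZMod.isUnit_iff_coprime 2 r).2 (Nat.coprime_two_left.2 (Nat.odd_iff.2 hodd))
      exact ZMod.mul_inv_of_unit _ (by exact_mod_cast this)
    have heq : 1 + 2 * (2⁻¹ * ((u : ZMod r) - 1)) = u := by
      rw [← mul_assoc, h2]
      ring
    refine ⟨2⁻¹ * ((u : ZMod r) - 1), ?_, ?_, fun p _ hpd => ?_⟩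
    · rw [heq]
      exact u.isUnit
    · rwa [heq]
    · rw [ZMod.cast_mul (hpd.trans hd), zmod_cast_sub_one_eq_zero hd hpd hu, mul_zero]
  · have h2d : 2 * d ∣ r := by
      obtain ⟨k, hk⟩ := hd
      rcases Nat.even_or_odd k with ⟨j, hj⟩ | ⟨j, hj⟩
      · exact ⟨j, by rw [hk, hj]; ring⟩
      · exfalso
        have hde : d % 2 = 0 := by
          by_contra hdo
          have : r % 2 = 1 := by
            rw [hk, Nat.mul_mod, hj]
            have : d % 2 = 1 := by omega
            rw [this]
            omega
          omega
        have hd4 : d % 4 ≠ 0 := fun h => by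
          have : 2 * 2 ∣ d := Nat.dvd_of_mod_eq_zero h
          exact absurd (hsq 2 this) (by decide)
        apply hχ.not_two_mod_four
        rw [hk, Nat.mul_mod]
        have h1 : d % 4 = 2 := by omega
        have h3 : k % 4 = 1 ∨ k % 4 = 3 := by omega
        rw [h1]
        rcases h3 with h3 | h3 <;> rw [h3]
    obtain ⟨u, hu, hne⟩ := hχ.exists_unit_ne_one h2d hlt
    have hr1 : 1 < r := by
      have : 0 < d := Nat.pos_of_ne_zero hsq.ne_zero
      omega
    have hval : 1 ≤ (u : ZMod r).val := by
      have hc : Nat.Coprime (u : ZMod r).val r := ZMod.val_coe_unit_coprime u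
      rcases Nat.eq_zero_or_pos (u : ZMod r).val with h | h
      · rw [h, Nat.coprime_zero_left] at hc
        omega
      · exact h
    obtain ⟨j, hj⟩ := (Nat.modEq_iff_dvd' hval).1 hu.symm
    have heq : 1 + 2 * ((d * j : ℕ) : ZMod r) = u := by
      rw [← ZMod.natCast_zmod_val (u : ZMod r), show (u : ZMod r).val = 1 + 2 * (d * j) by
        rw [← mul_assoc, ← hj]; omega]
      push_cast
      ring
    refine ⟨((d * j : ℕ) : ZMod r), ?_, ?_, fun p _ hpd => ?_⟩
    · rw [heq]
      exact u.isUnit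
    · rwa [heq]
    · rw [natCast_cast_zmod (hpd.trans hd), ZMod.natCast_eq_zero_iff]
      exact hpd.mul_right j

end

/-! ### Sifted residues and the values of the quadratic character -/

/-- The residues `x` modulo `r` such that `x, x + 2, m - x, m - x + 2` are units. -/
def IsSifted (r : ℕ) (m : ℤ) (x : ZMod r) : Prop :=
  ∀ p ∈ r.primeFactors, (ZMod.cast x : ZMod p) ∉ formRoots m p

lemma isSifted_intCast {r : ℕ} {m n : ℤ} :
    IsSifted r m (n : ZMod r) ↔ ∀ p ∈ r.primeFactors, FreeAt m p n := by
  refine forall₂_congr fun p hp => ?_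
  rw [freeAt_iff, ZMod.cast_intCast (Nat.dvd_of_mem_primeFactors hp)]

/-- A quadratic character takes the values `± 1` on units. -/
lemma MulChar.IsQuadratic.eq_one_or_eq_neg_one {r : ℕ}
    {χ : DirichletCharacter ℂ r} (hq : χ.IsQuadratic) {x : ZMod r}
    (hx : IsUnit x) : χ x = 1 ∨ χ x = -1 := by
  rcases hq x with h | h | h
  · exact absurd h (hx.map χ).ne_zero
  · exact Or.inl h
  · exact Or.inr h

section

variable {r : ℕ} [NeZero r] {χ : DirichletCharacter ℂ r}

open Classical in
/-- The sum of `ψ` over the sifted residues. -/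
noncomputable def siftedCharSum (m : ℤ) (ψ : ZMod r → ℂ) : ℂ :=
  ∑ x, if IsSifted r m x then ψ x else 0

open Classical in
/-- The number of sifted residues. -/
noncomputable def siftedCount (r : ℕ) [NeZero r] (m : ℤ) : ℕ :=
  ((Finset.univ : Finset (ZMod r)).filter (fun x => IsSifted r m x)).card

lemma isUnit_iff_forall_cast_ne_zero {x : ZMod r} :
    IsUnit x ↔ ∀ p ∈ r.primeFactors, (ZMod.cast x : ZMod p) ≠ 0 := by
  rw [← ZMod.natCast_zmod_val x, ZMod.isUnit_iff_coprime]
  have hr : r ≠ 0 := NeZero.ne r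
  constructor
  · intro h p hp h0
    rw [natCast_cast_zmod (Nat.dvd_of_mem_primeFactors hp), ZMod.natCast_eq_zero_iff] at h0
    have hpp := Nat.prime_of_mem_primeFactors hp
    exact Nat.not_coprime_of_dvd_of_dvd hpp.one_lt h0 (Nat.dvd_of_mem_primeFactors hp) h
  · intro h
    refine Nat.Coprime.symm (Nat.coprime_of_dvd fun p hpp hpr hpx => ?_)
    have hp : p ∈ r.primeFactors := Nat.mem_primeFactors.2 ⟨hpp, hpr, hr⟩
    refine h p hp ?_
    rw [natCast_cast_zmod hpr, ZMod.natCast_eq_zero_iff]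
    exact hpx

lemma IsSifted.isUnit {m : ℤ} {x : ZMod r} (hx : IsSifted r m x) :
    IsUnit x ∧ IsUnit (x + 2) ∧ IsUnit ((m : ZMod r) - x) ∧ IsUnit ((m : ZMod r) - x + 2) := by
  simp only [isUnit_iff_forall_cast_ne_zero]
  have h : ∀ p ∈ r.primeFactors, p ∣ r ∧ (ZMod.cast x : ZMod p) ≠ 0 ∧
      (ZMod.cast x : ZMod p) ≠ -2 ∧ (ZMod.cast x : ZMod p) ≠ m ∧
      (ZMod.cast x : ZMod p) ≠ m + 2 := fun p hp => by
    have := hx p hp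
    simp only [formRoots, Finset.mem_insert, Finset.mem_singleton, not_or] at this
    exact ⟨Nat.dvd_of_mem_primeFactors hp, this⟩
  have h2 : ∀ p, p ∣ r → (ZMod.cast (2 : ZMod r) : ZMod p) = 2 := fun p hp => by
    have := natCast_cast_zmod hp 2
    exact_mod_cast this
  refine ⟨fun p hp => (h p hp).2.1, fun p hp h0 => ?_, fun p hp h0 => ?_, fun p hp h0 => ?_⟩
  · obtain ⟨hpr, -, h1, -⟩ := h p hp
    rw [ZMod.cast_add hpr, h2 p hpr] at h0
    exact h1 (eq_neg_of_add_eq_zero_left h0)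
  · obtain ⟨hpr, -, -, h1, -⟩ := h p hp
    rw [ZMod.cast_sub hpr, ZMod.cast_intCast hpr] at h0
    exact h1 (sub_eq_zero.1 h0).symm
  · obtain ⟨hpr, -, -, -, h1⟩ := h p hp
    rw [ZMod.cast_add hpr, ZMod.cast_sub hpr, ZMod.cast_intCast hpr, h2 p hpr] at h0
    exact h1 (by linear_combination -h0)

lemma siftedCount_eq (m : ℤ) :
    (siftedCount r m : ℝ) = r * ∏ p ∈ r.primeFactors, (freeCount m p : ℝ) / p := by
  classical
  have hr : r ≠ 0 := NeZero.ne r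
  unfold siftedCount
  rw [Finset.card_filter]
  push_cast
  rw [← sum_range_eq_sum_zmod r (fun x : ZMod r => if IsSifted r m x then (1 : ℝ) else 0)]
  have h1 : ∀ n ∈ Finset.range r, (if IsSifted r m ((n : ℕ) : ZMod r) then (1 : ℝ) else 0) =
      ∏ p ∈ r.primeFactors, (if FreeAt m p ((n : ℕ) : ℤ) then (1 : ℝ) else 0) := fun n _ => by
    rw [Finset.prod_ite_zero, Finset.prod_const_one]
    refine if_congr ?_ rfl rfl
    rw [← Int.cast_natCast (R := ZMod r), isSifted_intCast]
  rw [Finset.sum_congr rfl h1, sum_range_prod_eq (Finset.Subset.refl _)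
    (F := fun p n => if FreeAt m p n then (1 : ℝ) else 0)
    (fun p _ n => by simp only [FreeAt.periodic m p n])]
  have h2 : ∀ p ∈ r.primeFactors,
      ∑ n ∈ Finset.range p, (if FreeAt m p n then (1 : ℝ) else 0) = freeCount m p := fun p _ => by
    rw [freeCount, Finset.card_filter]
    push_cast
    rfl
  have hne : ∏ p ∈ r.primeFactors, (p : ℝ) ≠ 0 := Finset.prod_ne_zero_iff.2 fun p hp => by
    exact_mod_cast (Nat.prime_of_mem_primeFactors hp).ne_zero
  rw [Finset.prod_congr rfl h2, Finset.prod_div_distrib,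
    Nat.cast_div (Nat.prod_primeFactors_dvd r) (by push_cast; exact hne)]
  push_cast
  ring

lemma one_fifth_le_freeCount_div {m : ℕ} (hm : m ≡ 4 [MOD 6]) {p : ℕ} (hp : p.Prime) :
    1 / 5 ≤ (freeCount m p : ℝ) / p := by
  have hp0 : (0 : ℝ) < p := by exact_mod_cast hp.pos
  by_cases h5 : 5 ≤ p
  · have : NeZero p := ⟨hp.ne_zero⟩
    have h2 : (freeCount m p : ℝ) + (formRoots m p).card = p := by
      exact_mod_cast freeCount_add_card_formRoots (m : ℤ) p
    have h3 : ((formRoots m p).card : ℝ) ≤ 4 := by exact_mod_cast card_formRoots_le (m : ℤ) p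
    have h5' : (5 : ℝ) ≤ p := by exact_mod_cast h5
    rw [div_le_div_iff₀ (by norm_num) hp0]
    linarith
  · have h2 := hp.two_le
    have : p ≠ 4 := by
      rintro rfl
      exact absurd hp (by decide)
    have : p = 2 ∨ p = 3 := by omega
    rcases this with rfl | rfl
    · rw [freeCount_two hm]; norm_num
    · rw [freeCount_three hm]; norm_num

/-- Every local density is at least 1/5, with 1/5 possible at p = 5; the condition on m is needed
for 2 and 3. Dividing a sum bounded by 4 · 4^ω by this count gives 4 · 20^ω / r. -/
lemma le_siftedCount {m : ℕ} (hm : m ≡ 4 [MOD 6]) :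
    (r : ℝ) / 5 ^ r.primeFactors.card ≤ siftedCount r m := by
  rw [siftedCount_eq, div_eq_mul_inv, ← inv_pow, ← one_div, ← Finset.prod_const]
  refine mul_le_mul_of_nonneg_left ?_ (Nat.cast_nonneg r)
  exact Finset.prod_le_prod (fun _ _ => by norm_num)
    fun p hp => one_fifth_le_freeCount_div hm (Nat.prime_of_mem_primeFactors hp)

lemma siftedCharSum_one (m : ℤ) : siftedCharSum (r := r) m (fun _ => 1) = siftedCount r m := by
  classical
  unfold siftedCharSum siftedCount
  rw [Finset.card_filter]
  push_cast
  rfl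

lemma norm_siftedCharSum_le (m : ℤ) {ψ : ZMod r → ℂ} {ψ' : ZMod r → ℝ}
    (h : ∀ x, IsSifted r m x → ‖ψ x‖ ≤ ψ' x) :
    ‖siftedCharSum m ψ‖ ≤ ‖siftedCharSum m (fun x => (ψ' x : ℂ))‖ := by
  classical
  unfold siftedCharSum
  have h1 : (∑ x, if IsSifted r m x then (ψ' x : ℂ) else 0) =
      ((∑ x, if IsSifted r m x then ψ' x else 0 : ℝ) : ℂ) := by
    rw [Complex.ofReal_sum]
    refine Finset.sum_congr rfl fun x _ => ?_
    split_ifs <;> simp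
  rw [h1, Complex.norm_real]
  refine (norm_sum_le _ _).trans (le_trans (Finset.sum_le_sum fun x _ => ?_) (le_abs_self _))
  split_ifs with hx
  · exact h x hx
  · simp

lemma norm_siftedCharSum_linear_le (hχ : χ.IsPrimitive) (m : ℤ) {α β : ZMod r}
    (hα : α * α = 1) {ψ : ZMod r → ℂ} (hψ : ∀ x, ψ x = χ (α * x + β)) :
    ‖siftedCharSum m ψ‖ ≤ 4 * 4 ^ r.primeFactors.card := by
  classical
  have := norm_sum_sifted_linear_le (χ := χ) (α := α) (β := β)
    (exists_shift_of_mul_self_eq_one hχ hα) (fun p => formRoots m p)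
    (fun p _ => card_formRoots_le m p)
  unfold siftedCharSum
  simp only [hψ]
  convert this using 4
  exact Iff.rfl

/-- The substitution `x = 1 / y` turns `χ(x) χ(x + 2)` into `χ(1 + 2 y)`. -/
lemma norm_siftedCharSum_mul_add_two_le (hχ : χ.IsPrimitive) (hq : χ.IsQuadratic) (m : ℤ) :
    ‖siftedCharSum m (fun x => χ x * χ (x + 2))‖ ≤ 4 * 4 ^ r.primeFactors.card := by
  classical
  have hbd := norm_sum_sifted_linear_le (χ := χ) (α := 2) (β := 1) (exists_shift_two hχ)
    (fun p => (formRoots m p).image (fun y => y⁻¹))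
    (fun p _ => Finset.card_image_le.trans (card_formRoots_le m p))
  refine le_trans (le_of_eq ?_) hbd
  congr 1
  unfold siftedCharSum
  rw [← Finset.sum_filter, ← Finset.sum_filter]
  have hinv : ∀ x : ZMod r, IsUnit x → x * x⁻¹ = 1 := fun x hx => ZMod.mul_inv_of_unit x hx
  have hcast : ∀ x : ZMod r, IsUnit x → ∀ p ∈ r.primeFactors,
      (ZMod.cast x⁻¹ : ZMod p) = (ZMod.cast x : ZMod p)⁻¹ := fun x hx p hp => by
    have : Fact p.Prime := ⟨Nat.prime_of_mem_primeFactors hp⟩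
    have hpr := Nat.dvd_of_mem_primeFactors hp
    refine eq_inv_of_mul_eq_one_right ?_
    rw [← ZMod.cast_mul hpr, hinv x hx, ZMod.cast_one hpr]
  have hmem : ∀ p ∈ r.primeFactors, ∀ y : ZMod p,
      y ∈ (formRoots m p).image (fun y => y⁻¹) ↔ y⁻¹ ∈ formRoots m p := fun p hp y => by
    have : Fact p.Prime := ⟨Nat.prime_of_mem_primeFactors hp⟩
    rw [Finset.mem_image]
    constructor
    · rintro ⟨z, hz, rfl⟩
      rwa [inv_inv]
    · exact fun h => ⟨y⁻¹, h, inv_inv y⟩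
  have hinvinv : ∀ x : ZMod r, IsUnit x → IsUnit x⁻¹ ∧ (x⁻¹)⁻¹ = x := fun x hx => by
    have h1 : IsUnit x⁻¹ := IsUnit.of_mul_eq_one x (by rw [mul_comm]; exact hinv x hx)
    refine ⟨h1, ?_⟩
    have h2 := hinv x⁻¹ h1
    calc (x⁻¹)⁻¹ = (x * x⁻¹) * (x⁻¹)⁻¹ := by rw [hinv x hx, one_mul]
      _ = x := by rw [mul_assoc, h2, mul_one]
  have hunit' : ∀ y : ZMod r, (∀ p ∈ r.primeFactors,
      (ZMod.cast y : ZMod p) ∉ (formRoots m p).image (fun y => y⁻¹)) → IsUnit y := fun y hy => by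
    rw [isUnit_iff_forall_cast_ne_zero]
    intro p hp h0
    have : Fact p.Prime := ⟨Nat.prime_of_mem_primeFactors hp⟩
    refine hy p hp ((hmem p hp _).2 ?_)
    rw [h0, inv_zero]
    simp [formRoots]
  refine Finset.sum_nbij' (fun x => x⁻¹) (fun x => x⁻¹) ?_ ?_ ?_ ?_ ?_
  · intro x hx
    rw [Finset.mem_filter] at hx ⊢
    refine ⟨Finset.mem_univ _, fun p hp => ?_⟩
    have : Fact p.Prime := ⟨Nat.prime_of_mem_primeFactors hp⟩
    rw [hmem p hp, hcast x hx.2.isUnit.1 p hp, inv_inv]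
    exact hx.2 p hp
  · intro y hy
    rw [Finset.mem_filter] at hy ⊢
    refine ⟨Finset.mem_univ _, fun p hp => ?_⟩
    have h1 := hy.2 p hp
    rw [hmem p hp, ← hcast y (hunit' y hy.2) p hp] at h1
    exact h1
  · intro x hx
    exact (hinvinv x (Finset.mem_filter.1 hx).2.isUnit.1).2
  · intro y hy
    exact (hinvinv y (hunit' y (Finset.mem_filter.1 hy).2)).2
  · intro x hx
    have hu := (Finset.mem_filter.1 hx).2.isUnit.1
    have h1 : x + 2 = x * (2 * x⁻¹ + 1) := by
      have := hinv x hu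
      linear_combination (-2 : ZMod r) * this
    have h2 : χ x * χ x = 1 := by
      rw [← sq, ← MulChar.pow_apply' χ (by norm_num), hq.sq_eq_one, MulChar.one_apply hu]
    rw [h1, map_mul, ← mul_assoc, h2, one_mul]

lemma siftedCharSum_add (m : ℤ) (ψ ψ' : ZMod r → ℂ) :
    siftedCharSum m (fun x => ψ x + ψ' x) = siftedCharSum m ψ + siftedCharSum m ψ' := by
  classical
  unfold siftedCharSum
  rw [← Finset.sum_add_distrib]
  refine Finset.sum_congr rfl fun x _ => ?_
  split_ifs <;> simp

lemma siftedCharSum_sub (m : ℤ) (ψ ψ' : ZMod r → ℂ) :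
    siftedCharSum m (fun x => ψ x - ψ' x) = siftedCharSum m ψ - siftedCharSum m ψ' := by
  classical
  unfold siftedCharSum
  rw [← Finset.sum_sub_distrib]
  refine Finset.sum_congr rfl fun x _ => ?_
  split_ifs <;> simp

lemma siftedCharSum_const_mul (m : ℤ) (c : ℂ) (ψ : ZMod r → ℂ) :
    siftedCharSum m (fun x => c * ψ x) = c * siftedCharSum m ψ := by
  classical
  unfold siftedCharSum
  rw [Finset.mul_sum]
  refine Finset.sum_congr rfl fun x _ => ?_
  split_ifs <;> simp

lemma siftedCharSum_congr (m : ℤ) {ψ ψ' : ZMod r → ℂ} (h : ∀ x, IsSifted r m x → ψ x = ψ' x) :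
    siftedCharSum m ψ = siftedCharSum m ψ' := by
  classical
  unfold siftedCharSum
  refine Finset.sum_congr rfl fun x _ => ?_
  split_ifs with hx
  · exact h x hx
  · rfl

open Classical in
/-- The proportions of the sifted residues with prescribed values of a quadratic character. The
cubic character sum need not be estimated: together with one of the quadratic ones it is an average
with nonnegative weights `1 + χ(x)`, hence is absorbed into `σ₂`. -/
lemma exists_siftedCharSum_approx (hχ : χ.IsPrimitive) (hq : χ.IsQuadratic) :
    ∃ σ₁ σ₂ : ℕ → ℂ, (∀ m, ‖σ₁ m‖ ≤ 1) ∧ (∀ m, ‖σ₂ m‖ ≤ 1) ∧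
      ∀ m : ℕ, m ≡ 4 [MOD 6] →
        ‖siftedCharSum (m : ℤ) (fun x : ZMod r => if χ x = -1 ∧ χ (((m : ℤ) : ZMod r) - x) = -1
            then 1 else 0) / siftedCount r m - (1 + σ₁ m) / 4‖ ≤
          4 * 20 ^ r.primeFactors.card / r ∧
        ‖siftedCharSum (m : ℤ) (fun x : ZMod r => if χ x = 1 ∧ χ (x + 2) = 1 ∧
            χ (((m : ℤ) : ZMod r) - x) = -1 then 1 else 0) / siftedCount r m -
              (1 - σ₁ m - σ₂ m) / 8‖ ≤
          4 * 20 ^ r.primeFactors.card / r := by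
  set a : ℕ → ℂ := fun m => siftedCharSum (m : ℤ) (fun x => χ x) / siftedCount r m with ha
  set B : ℕ → ℂ := fun m => siftedCharSum (m : ℤ)
    (fun x => (1 + χ x) * (χ (x + 2) * χ (((m : ℤ) : ZMod r) - x))) / siftedCount r m with hB
  have hcount : ∀ m : ℕ, ‖(siftedCount r m : ℂ)‖ = siftedCount r m := fun m => by simp
  -- On sifted residues 1 + χ(x) is 0 or 2, so it equals its modulus and its average is 1 + a.
  have hBle : ∀ m : ℕ, ‖B m‖ ≤ 1 + ‖a m‖ := fun m => by
    have h1 : ‖siftedCharSum (m : ℤ)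
        (fun x => (1 + χ x) * (χ (x + 2) * χ (((m : ℤ) : ZMod r) - x)))‖ ≤
        ‖siftedCharSum (m : ℤ) (fun x => ((‖1 + χ x‖ : ℝ) : ℂ))‖ := by
      refine norm_siftedCharSum_le _ fun x _ => ?_
      rw [norm_mul, norm_mul]
      refine mul_le_of_le_one_right (norm_nonneg _) ?_
      exact mul_le_one₀ (χ.norm_le_one _) (norm_nonneg _) (χ.norm_le_one _)
    have h2 : siftedCharSum (m : ℤ) (fun x => ((‖1 + χ x‖ : ℝ) : ℂ)) =
        siftedCount r m + siftedCharSum (m : ℤ) (fun x => χ x) := by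
      rw [← siftedCharSum_one, ← siftedCharSum_add]
      refine siftedCharSum_congr _ fun x hx => ?_
      rcases hq.eq_one_or_eq_neg_one hx.isUnit.1 with h | h
      · rw [h]
        norm_num
      · rw [h]
        norm_num
    rw [h2] at h1
    simp only [hB, ha, norm_div, hcount]
    rcases Nat.eq_zero_or_pos (siftedCount r m) with h0 | h0
    · rw [h0]
      simp
    · have h0' : (0 : ℝ) < siftedCount r m := by exact_mod_cast h0
      rw [div_le_iff₀ h0', add_mul, one_mul, div_mul_cancel₀ _ h0'.ne']
      refine h1.trans ((norm_add_le _ _).trans ?_)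
      rw [hcount]
  refine ⟨fun m => siftedCharSum (m : ℤ) (fun x => χ x * χ (((m : ℤ) : ZMod r) - x)) /
      siftedCount r m, fun m => B m / ((1 + ‖a m‖ : ℝ) : ℂ), fun m => ?_, fun m => ?_,
    fun m hm => ?_⟩
  · have h1 : ‖siftedCharSum (m : ℤ) (fun x => χ x * χ (((m : ℤ) : ZMod r) - x))‖ ≤
        ‖siftedCharSum (r := r) (m : ℤ) (fun _ => ((1 : ℝ) : ℂ))‖ := by
      refine norm_siftedCharSum_le _ fun x _ => ?_
      rw [norm_mul]
      exact mul_le_one₀ (χ.norm_le_one _) (norm_nonneg _) (χ.norm_le_one _)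
    rw [Complex.ofReal_one, siftedCharSum_one, hcount] at h1
    rw [norm_div, hcount]
    exact div_le_one_of_le₀ h1 (Nat.cast_nonneg _)
  · rw [norm_div, Complex.norm_real, Real.norm_of_nonneg (by positivity)]
    exact div_le_one_of_le₀ (hBle m) (by positivity)
  have hr0 : (0 : ℝ) < r := by exact_mod_cast Nat.pos_of_ne_zero (NeZero.ne r)
  set w := r.primeFactors.card with hw
  have hN0 : (0 : ℝ) < siftedCount r m := lt_of_lt_of_le (by positivity) (le_siftedCount hm)
  have hNc : (siftedCount r m : ℂ) ≠ 0 := by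
    have : siftedCount r m ≠ 0 := by
      intro h
      rw [h] at hN0
      simp at hN0
    exact_mod_cast this
  have hsmall : ∀ ψ : ZMod r → ℂ, ‖siftedCharSum (m : ℤ) ψ‖ ≤ 4 * 4 ^ w →
      ‖siftedCharSum (m : ℤ) ψ / siftedCount r m‖ ≤ 4 * 20 ^ w / r := fun ψ hψ => by
    rw [norm_div, hcount, div_le_div_iff₀ hN0 hr0]
    have h1 := le_siftedCount (r := r) hm
    rw [div_le_iff₀ (by positivity)] at h1
    calc ‖siftedCharSum (m : ℤ) ψ‖ * r ≤ (4 * 4 ^ w) * (siftedCount r m * 5 ^ w) := by gcongr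
      _ = 4 * 20 ^ w * siftedCount r m := by
        rw [show (20 : ℝ) = 4 * 5 by norm_num, mul_pow]
        ring
  have b1 : ‖a m‖ ≤ 4 * 20 ^ w / r :=
    hsmall _ (norm_siftedCharSum_linear_le hχ m (α := 1) (β := 0) (one_mul 1) fun x => by
      rw [one_mul, add_zero])
  set a₂ := siftedCharSum (m : ℤ) (fun x => χ (x + 2)) / siftedCount r m with ha₂
  have b2 : ‖a₂‖ ≤ 4 * 20 ^ w / r :=
    hsmall _ (norm_siftedCharSum_linear_le hχ m (α := 1) (β := 2) (one_mul 1) fun x => by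
      rw [one_mul])
  set a₃ := siftedCharSum (m : ℤ) (fun x => χ (((m : ℤ) : ZMod r) - x)) / siftedCount r m with ha₃
  have b3 : ‖a₃‖ ≤ 4 * 20 ^ w / r :=
    hsmall _ (norm_siftedCharSum_linear_le hχ m (α := -1) (β := ((m : ℤ) : ZMod r)) (by ring)
      fun x => by congr 1; ring)
  set a₄ := siftedCharSum (m : ℤ) (fun x => χ x * χ (x + 2)) / siftedCount r m with ha₄
  have b4 : ‖a₄‖ ≤ 4 * 20 ^ w / r := hsmall _ (norm_siftedCharSum_mul_add_two_le hχ hq m)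
  set E := 4 * (20 : ℝ) ^ w / r with hE
  have hE0 : 0 ≤ E := by positivity
  constructor
  -- On sifted residues the indicator is (1 - χ(x))(1 - χ(m - x)) / 4.
  · have h1 : siftedCharSum (m : ℤ) (fun x : ZMod r =>
        if χ x = -1 ∧ χ (((m : ℤ) : ZMod r) - x) = -1 then (1 : ℂ) else 0) =
        1 / 4 * (siftedCount r m - siftedCharSum (m : ℤ) (fun x => χ x) -
          siftedCharSum (m : ℤ) (fun x => χ (((m : ℤ) : ZMod r) - x)) +
          siftedCharSum (m : ℤ) (fun x => χ x * χ (((m : ℤ) : ZMod r) - x))) := by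
      rw [← siftedCharSum_one, ← siftedCharSum_sub, ← siftedCharSum_sub, ← siftedCharSum_add,
        ← siftedCharSum_const_mul]
      refine siftedCharSum_congr _ fun x hx => ?_
      rcases hq.eq_one_or_eq_neg_one hx.isUnit.1 with h | h <;>
        rcases hq.eq_one_or_eq_neg_one hx.isUnit.2.2.1 with h' | h' <;>
          rw [h, h'] <;> norm_num
    have h2 : siftedCharSum (m : ℤ) (fun x : ZMod r =>
        if χ x = -1 ∧ χ (((m : ℤ) : ZMod r) - x) = -1 then (1 : ℂ) else 0) / siftedCount r m -
        (1 + siftedCharSum (m : ℤ) (fun x => χ x * χ (((m : ℤ) : ZMod r) - x)) /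
          siftedCount r m) / 4 = -(1 / 4) * (a m + a₃) := by
      rw [h1]
      simp only [ha, ha₃]
      field_simp
      ring
    rw [h2, norm_mul]
    have := norm_add_le (a m) a₃
    norm_num
    linarith
  · set s₁ := siftedCharSum (m : ℤ) (fun x => χ x * χ (((m : ℤ) : ZMod r) - x)) /
      siftedCount r m with hs₁
    -- The indicator is (1 + χ(x))(1 + χ(x + 2))(1 - χ(m - x)) / 8. The term χ(x + 2)χ(m - x) and
    -- the cubic term are grouped with the common factor 1 + χ(x).
    have h1 : siftedCharSum (m : ℤ) (fun x : ZMod r =>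
        if χ x = 1 ∧ χ (x + 2) = 1 ∧ χ (((m : ℤ) : ZMod r) - x) = -1 then (1 : ℂ) else 0) =
        1 / 8 * (siftedCount r m + siftedCharSum (m : ℤ) (fun x => χ x) +
          siftedCharSum (m : ℤ) (fun x => χ (x + 2)) +
          siftedCharSum (m : ℤ) (fun x => χ x * χ (x + 2)) -
          siftedCharSum (m : ℤ) (fun x => χ (((m : ℤ) : ZMod r) - x)) -
          siftedCharSum (m : ℤ) (fun x => χ x * χ (((m : ℤ) : ZMod r) - x)) -
          siftedCharSum (m : ℤ)
            (fun x => (1 + χ x) * (χ (x + 2) * χ (((m : ℤ) : ZMod r) - x)))) := by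
      rw [← siftedCharSum_one, ← siftedCharSum_add, ← siftedCharSum_add, ← siftedCharSum_add,
        ← siftedCharSum_sub, ← siftedCharSum_sub, ← siftedCharSum_sub, ← siftedCharSum_const_mul]
      refine siftedCharSum_congr _ fun x hx => ?_
      rcases hq.eq_one_or_eq_neg_one hx.isUnit.1 with h | h <;>
        rcases hq.eq_one_or_eq_neg_one hx.isUnit.2.1 with h' | h' <;>
          rcases hq.eq_one_or_eq_neg_one hx.isUnit.2.2.1 with h'' | h'' <;>
            rw [h, h', h''] <;> norm_num
    -- Rescaling to modulus at most 1 changes the average by no more than |a|, which is one of the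
    -- small sums.
    have hBσ : ‖B m / ((1 + ‖a m‖ : ℝ) : ℂ) - B m‖ ≤ ‖a m‖ := by
      have hpos : (0 : ℝ) < 1 + ‖a m‖ := by positivity
      have hc : ((1 + ‖a m‖ : ℝ) : ℂ) ≠ 0 := by exact_mod_cast hpos.ne'
      have heq : B m / ((1 + ‖a m‖ : ℝ) : ℂ) - B m =
          -(B m / ((1 + ‖a m‖ : ℝ) : ℂ)) * ((‖a m‖ : ℝ) : ℂ) := by
        field_simp
        push_cast
        ring
      rw [heq, norm_mul, norm_neg, norm_div, Complex.norm_real, Complex.norm_real,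
        Real.norm_of_nonneg hpos.le, norm_norm]
      exact mul_le_of_le_one_left (norm_nonneg _) (div_le_one_of_le₀ (hBle m) hpos.le)
    have h2 : siftedCharSum (m : ℤ) (fun x : ZMod r =>
        if χ x = 1 ∧ χ (x + 2) = 1 ∧ χ (((m : ℤ) : ZMod r) - x) = -1 then (1 : ℂ) else 0) /
          siftedCount r m - (1 - s₁ - B m / ((1 + ‖a m‖ : ℝ) : ℂ)) / 8 =
        1 / 8 * (a m + a₂ + a₄ - a₃ + (B m / ((1 + ‖a m‖ : ℝ) : ℂ) - B m)) := by
      rw [h1]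
      generalize B m / ((1 + ‖a m‖ : ℝ) : ℂ) = t
      simp only [ha, ha₂, ha₃, ha₄, hs₁, hB]
      field_simp
      ring
    rw [h2, norm_mul]
    have e1 := norm_add_le (a m + a₂ + a₄ - a₃) (B m / ((1 + ‖a m‖ : ℝ) : ℂ) - B m)
    have e2 := norm_sub_le (a m + a₂ + a₄) a₃
    have e3 := norm_add_le (a m + a₂) a₄
    have e4 := norm_add_le (a m) a₂
    have e5 : ‖(1 / 8 : ℂ)‖ = 1 / 8 := by norm_num
    rw [e5]
    linarith

end

/-! ### The sifted sum -/

/-- Only two properties of the even or odd positions are used: stability under h ↦ h - 2, for the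
fundamental lemma, and meeting every pair of consecutive positions, for the level of support. Lower
and upper sieves are thereby treated alike. -/
lemma exists_preSieve_eq {P D : ℝ} {f : Fin 4 → ℕ → ℝ}
    (hf : ∀ i, f i = lowerPreSieve P D ∨ f i = upperPreSieve P D) :
    ∃ S : Fin 4 → Set ℕ, (∀ i, f i = preSieve (betaSieveSet (S i) 200 D) P) ∧
      (∀ i, ∀ h ∈ S i, 2 ≤ h → h - 2 ∈ S i) ∧ ∀ i h, h ∈ S i ∨ h + 1 ∈ S i := by
  have : ∀ i, ∃ S : Set ℕ, f i = preSieve (betaSieveSet S 200 D) P ∧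
      (∀ h ∈ S, 2 ≤ h → h - 2 ∈ S) ∧ ∀ h, h ∈ S ∨ h + 1 ∈ S := fun i => by
    rcases hf i with h | h
    · refine ⟨{h | Even h}, h, fun k hk h2 => ?_, fun k => ?_⟩
      · exact (Nat.even_sub h2).2 ⟨fun _ => even_two, fun _ => hk⟩
      · rcases Nat.even_or_odd k with hk | hk
        · exact Or.inl hk
        · exact Or.inr hk.add_one
    · refine ⟨{h | Odd h}, h, fun k hk h2 => ?_, fun k => ?_⟩
      · exact (Nat.odd_sub h2).2 ⟨fun _ => even_two, fun _ => hk⟩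
      · rcases Nat.even_or_odd k with hk | hk
        · exact Or.inr hk.add_one
        · exact Or.inl hk
  choose S h1 h2 h3 using this
  exact ⟨S, h1, h2, h3⟩

lemma sieveSum_congr {𝒟 : Set ℕ} {𝒬 𝒬' : Finset ℕ} {k : ℤ}
    (h : 𝒬.filter (fun p : ℕ => (p : ℤ) ∣ k) = 𝒬'.filter (fun p : ℕ => (p : ℤ) ∣ k)) :
    sieveSum 𝒟 𝒬 k = sieveSum 𝒟 𝒬' k := by
  unfold sieveSum
  rw [h]

lemma coprime_six_iff (n : ℕ) :
    Nat.Coprime n 6 ↔ ∀ p ∈ ({2, 3} : Finset ℕ), ¬ (p : ℤ) ∣ (n : ℤ) := by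
  rw [show 6 = 2 * 3 from rfl, Nat.coprime_mul_iff_right, Nat.coprime_comm,
    Nat.coprime_comm (n := n) (m := 3), Nat.Prime.coprime_iff_not_dvd Nat.prime_two,
    Nat.Prime.coprime_iff_not_dvd Nat.prime_three]
  simp only [Finset.mem_insert, Finset.mem_singleton, forall_eq_or_imp, forall_eq]
  rw [Int.natCast_dvd_natCast, Int.natCast_dvd_natCast]

/-- Freeness at 2 makes n and m - n odd, and freeness at 3 makes both of them 2 modulo 3. For other
m the sifted sum is thus empty, matching a vanishing singular series. -/
lemma modEq_four_of_freeAt {m : ℕ} {n : ℤ} (h2 : FreeAt m 2 n) (h3 : FreeAt m 3 n) :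
    m ≡ 4 [MOD 6] := by
  have a := (forall_sieveForm (Q := fun k => ¬ ((2 : ℕ) : ℤ) ∣ k)).1 h2
  have b := (forall_sieveForm (Q := fun k => ¬ ((3 : ℕ) : ℤ) ∣ k)).1 h3
  have h1 : n % 3 = 2 := by omega
  have h2 : (m - n) % 3 = 2 := by omega
  have h3 : (m : ℤ) % 2 = 0 := by omega
  unfold Nat.ModEq
  omega

/-- The primes among `2` and `3` that do not divide `r`. -/
def smallPrimes (r : ℕ) : Finset ℕ :=
  ({2, 3} : Finset ℕ).filter (fun p => ¬ p ∣ r)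

/-- The primes `5 ≤ p < P` that do not divide `r`. -/
noncomputable def mediumPrimes (r : ℕ) (P : ℝ) : Finset ℕ :=
  (primesBetween 5 P).filter (fun p => ¬ p ∣ r)

lemma mem_smallPrimes {r p : ℕ} (hp : p ∈ smallPrimes r) :
    p.Prime ∧ ¬ p ∣ r ∧ (p = 2 ∨ p = 3) := by
  simp only [smallPrimes, Finset.mem_filter, Finset.mem_insert, Finset.mem_singleton] at hp
  refine ⟨?_, hp.2, hp.1⟩
  rcases hp.1 with rfl | rfl
  exacts [Nat.prime_two, Nat.prime_three]

lemma mem_mediumPrimes {r : ℕ} {P : ℝ} {p : ℕ} (hp : p ∈ mediumPrimes r P) :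
    p.Prime ∧ ¬ p ∣ r ∧ 5 ≤ p ∧ (p : ℝ) < P := by
  obtain ⟨h1, h2⟩ := Finset.mem_filter.1 hp
  obtain ⟨h3, h4, h5⟩ := mem_primesBetween.1 h1
  exact ⟨h3, h2, h4, h5⟩

lemma prod_smallPrimes_le (r : ℕ) : ∏ p ∈ smallPrimes r, p ≤ 6 := by
  calc ∏ p ∈ smallPrimes r, p ≤ ∏ p ∈ ({2, 3} : Finset ℕ), p :=
        Finset.prod_le_prod_of_subset_of_one_le' (Finset.filter_subset _ _) (by simp)
    _ = 6 := rfl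

open Classical in
/-- The indicator function of the integers `n` whose residue modulo `r` is sifted and satisfies
`R`, and such that `2` and `3` divide none of the forms. -/
noncomputable def baseWeight (r : ℕ) (m : ℤ) (R : ZMod r → Prop) (n : ℤ) : ℝ :=
  (if IsSifted r m (n : ZMod r) ∧ R n then 1 else 0) *
    ∏ p ∈ smallPrimes r, if FreeAt m p n then 1 else 0

lemma periodic_baseWeight {r : ℕ} (m : ℤ) (R : ZMod r → Prop) :
    Function.Periodic (baseWeight r m R) ((r * ∏ p ∈ smallPrimes r, p : ℕ) : ℤ) := by
  intro n
  unfold baseWeight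
  congr 1
  · have : ((n + ((r * ∏ p ∈ smallPrimes r, p : ℕ) : ℤ) : ℤ) : ZMod r) = n := by
      push_cast
      rw [ZMod.natCast_self, zero_mul, add_zero]
    rw [this]
  · refine Finset.prod_congr rfl fun p hp => ?_
    obtain ⟨k, hk⟩ := Finset.dvd_prod_of_mem (fun p : ℕ => p) hp
    have h1 := (FreeAt.periodic m p).int_add_mul n (r * k : ℕ)
    have h2 : ((r * ∏ p ∈ smallPrimes r, p : ℕ) : ℤ) = p * ((r * k : ℕ) : ℤ) := by
      rw [hk]
      push_cast
      ring
    rw [h2]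
    simp only [h1]

lemma baseWeight_mem_Icc (r : ℕ) (m : ℤ) (R : ZMod r → Prop) (n : ℤ) :
    0 ≤ baseWeight r m R n ∧ baseWeight r m R n ≤ 1 := by
  unfold baseWeight
  rw [Finset.prod_ite_zero, Finset.prod_const_one]
  split_ifs <;> norm_num

lemma baseWeight_eq {r : ℕ} (hr : r ≠ 0) (m : ℤ) (R : ZMod r → Prop) (n : ℤ)
    [Decidable ((IsSifted r m (n : ZMod r) ∧ R n) ∧ FreeAt m 2 n ∧ FreeAt m 3 n)] :
    baseWeight r m R n =
      if (IsSifted r m (n : ZMod r) ∧ R n) ∧ FreeAt m 2 n ∧ FreeAt m 3 n then 1 else 0 := by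
  classical
  unfold baseWeight
  rw [Finset.prod_ite_zero, Finset.prod_const_one, ite_zero_mul_ite_zero, one_mul]
  refine if_congr (and_congr_right fun h => ?_) rfl rfl
  have hs := isSifted_intCast.1 h.1
  have hp : ∀ p : ℕ, p.Prime → p ∣ r → FreeAt m p n := fun p hp hpr =>
    hs p (Nat.mem_primeFactors.2 ⟨hp, hpr, hr⟩)
  simp only [smallPrimes, Finset.mem_filter, Finset.mem_insert, Finset.mem_singleton]
  constructor
  · intro h'
    refine ⟨?_, ?_⟩
    · by_cases h2 : 2 ∣ r
      · exact hp 2 Nat.prime_two h2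
      · exact h' 2 ⟨Or.inl rfl, h2⟩
    · by_cases h3 : 3 ∣ r
      · exact hp 3 Nat.prime_three h3
      · exact h' 3 ⟨Or.inr rfl, h3⟩
  · rintro ⟨h2, h3⟩ p ⟨rfl | rfl, -⟩
    exacts [h2, h3]

/-- For a sifted n no prime dividing r divides a form, so the sieves see only the primes not
dividing r. This makes the remaining sieve moduli coprime to the period of the weight. -/
lemma siftedSum_eq {r : ℕ} (hr : r ≠ 0) {P D : ℝ} {S : Fin 4 → Set ℕ} {f : Fin 4 → ℕ → ℝ}
    (hf : ∀ i, f i = preSieve (betaSieveSet (S i) 200 D) P) {m : ℕ} {X : ℝ} (hX : 0 ≤ X)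
    (hXm : X ≤ m) {Q : ℕ → Prop} {R : ZMod r → Prop}
    (hQ : ∀ n ≤ m, Q n ↔ IsSifted r m ((n : ℤ) : ZMod r) ∧ R ((n : ℤ) : ZMod r)) :
    siftedSum f Q m X = eulerProd P ^ 4 * ∑ n ∈ Finset.Icc 1 ⌊X⌋₊, baseWeight r m R n *
      ∏ i, sieveSum (betaSieveSet (S i) 200 D) (mediumPrimes r P) (sieveForm m n i) := by
  classical
  unfold siftedSum
  rw [Finset.sum_filter, Finset.mul_sum]
  refine Finset.sum_congr rfl fun n hn => ?_
  have hnm : n ≤ m := by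
    have h1 : (n : ℝ) ≤ X := (Nat.le_floor_iff hX).1 (Finset.mem_Icc.1 hn).2
    exact_mod_cast h1.trans hXm
  rw [baseWeight_eq hr]
  by_cases hQn : Q n
  swap
  · rw [if_neg hQn, if_neg fun h => hQn ((hQ n hnm).2 h.1), zero_mul, mul_zero]
  rw [if_pos hQn]
  have hsR := (hQ n hnm).1 hQn
  have hs := isSifted_intCast.1 hsR.1
  set a : Fin 4 → ℕ := ![n, n + 2, m - n, m - n + 2] with ha
  have hcast : ∀ i, (a i : ℤ) = sieveForm m n i := by
    intro i
    fin_cases i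
    · rfl
    · change ((n + 2 : ℕ) : ℤ) = n + 2
      push_cast
      rfl
    · change ((m - n : ℕ) : ℤ) = m - n
      push_cast [hnm]
      rfl
    · change ((m - n + 2 : ℕ) : ℤ) = m - n + 2
      push_cast [hnm]
      rfl
  have hprod : f 0 n * f 1 (n + 2) * f 2 (m - n) * f 3 (m - n + 2) = ∏ i, f i (a i) := by
    rw [Fin.prod_univ_four]
    rfl
  have hterm : ∀ i ∈ Finset.univ, f i (a i) = if Nat.Coprime (a i) 6 then eulerProd P *
      sieveSum (betaSieveSet (S i) 200 D) (mediumPrimes r P) (sieveForm m n i) else 0 :=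
    fun i _ => by
      rw [hf i, preSieve_eq, hcast]
      congr 2
      refine sieveSum_congr ?_
      rw [mediumPrimes, Finset.filter_filter]
      refine Finset.filter_congr fun p hp => ⟨fun h => ⟨fun hpr => ?_, h⟩, fun h => h.2⟩
      exact hs p (Nat.mem_primeFactors.2 ⟨(mem_primesBetween.1 hp).1, hpr, hr⟩) i h
  rw [hprod, Finset.prod_congr rfl hterm, Finset.prod_ite_zero, Finset.prod_mul_distrib,
    Finset.prod_const, Finset.card_univ, Fintype.card_fin]
  have hiff : (∀ i ∈ Finset.univ, Nat.Coprime (a i) 6) ↔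
      (IsSifted r m ((n : ℤ) : ZMod r) ∧ R ((n : ℤ) : ZMod r)) ∧
        FreeAt m 2 n ∧ FreeAt m 3 n := by
    simp only [coprime_six_iff, hcast, Finset.mem_univ, true_imp_iff, Finset.mem_insert,
      Finset.mem_singleton, forall_eq_or_imp, forall_eq]
    rw [forall_and]
    exact ⟨fun h => ⟨hsR, h⟩, fun h => h.2⟩
  simp only [hiff]
  split_ifs
  · rw [one_mul]
  · rw [zero_mul, mul_zero]

open Classical in
/-- The number of sifted residues satisfying `R`. -/
noncomputable def siftedCountOf {r : ℕ} [NeZero r] (m : ℤ) (R : ZMod r → Prop) : ℕ :=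
  ((Finset.univ : Finset (ZMod r)).filter (fun x => IsSifted r m x ∧ R x)).card

section

variable {r : ℕ} [NeZero r]

lemma siftedCountOf_le (m : ℤ) (R : ZMod r → Prop) : siftedCountOf m R ≤ siftedCount r m := by
  classical
  exact Finset.card_le_card (Finset.monotone_filter_right _ fun _ _ h => h.1)

lemma siftedCharSum_indicator (m : ℤ) (R : ZMod r → Prop) [DecidablePred R] :
    siftedCharSum m (fun x => if R x then 1 else 0) = siftedCountOf m R := by
  classical
  unfold siftedCharSum siftedCountOf
  rw [Finset.card_filter]
  push_cast
  refine Finset.sum_congr rfl fun x _ => ?_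
  split_ifs <;> simp_all

lemma sum_range_baseWeight (m : ℤ) (R : ZMod r → Prop) :
    ∑ n ∈ Finset.range (r * ∏ p ∈ smallPrimes r, p), baseWeight r m R n =
      siftedCountOf m R * ∏ p ∈ smallPrimes r, (freeCount m p : ℝ) := by
  classical
  unfold baseWeight
  have hper : Function.Periodic
      (fun n : ℤ => if IsSifted r m (n : ZMod r) ∧ R n then (1 : ℝ) else 0) (r : ℤ) := by
    intro n
    simp
  have h1 := sum_range_mul_prod hper (𝒬 := smallPrimes r) (fun p hp => (mem_smallPrimes hp).1)
    (fun p hp => ((Nat.Prime.coprime_iff_not_dvd (mem_smallPrimes hp).1).2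
      (mem_smallPrimes hp).2.1).symm)
    (F := fun p n => if FreeAt m p n then (1 : ℝ) else 0)
    (fun p _ n => by simp only [FreeAt.periodic m p n])
  rw [h1]
  congr 1
  · have h2 := sum_range_eq_sum_zmod r
      (fun x : ZMod r => if IsSifted r m x ∧ R x then (1 : ℝ) else 0)
    rw [siftedCountOf, Finset.card_filter]
    push_cast
    rw [← h2]
  · refine Finset.prod_congr rfl fun p _ => ?_
    rw [freeCount, Finset.card_filter]
    push_cast
    rfl

lemma prod_localPrimes_eq (P : ℝ) (F : ℕ → ℝ) :
    ∏ p ∈ localPrimes r P, F p =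
      (∏ p ∈ r.primeFactors, F p) * (∏ p ∈ smallPrimes r, F p) * ∏ p ∈ mediumPrimes r P, F p := by
  have hr : r ≠ 0 := NeZero.ne r
  have hd2 : Disjoint (smallPrimes r) (mediumPrimes r P) := by
    rw [Finset.disjoint_left]
    intro p h1 h2
    have := (mem_smallPrimes h1).2.2
    have := (mem_mediumPrimes h2).2.2.1
    omega
  have hd1 : Disjoint r.primeFactors (smallPrimes r ∪ mediumPrimes r P) := by
    rw [Finset.disjoint_left]
    intro p h1 h2
    rcases Finset.mem_union.1 h2 with h | h
    · exact (mem_smallPrimes h).2.1 (Nat.dvd_of_mem_primeFactors h1)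
    · exact (mem_mediumPrimes h).2.1 (Nat.dvd_of_mem_primeFactors h1)
  rw [mul_assoc, ← Finset.prod_union hd2, ← Finset.prod_union hd1]
  refine Finset.prod_congr ?_ fun _ _ => rfl
  ext p
  simp only [localPrimes, Finset.mem_union]
  constructor
  · rintro ((h | h) | h)
    · by_cases hpr : p ∣ r
      · refine Or.inl (Nat.mem_primeFactors.2 ⟨?_, hpr, hr⟩)
        simp only [Finset.mem_insert, Finset.mem_singleton] at h
        rcases h with rfl | rfl
        exacts [Nat.prime_two, Nat.prime_three]
      · exact Or.inr (Or.inl (Finset.mem_filter.2 ⟨h, hpr⟩))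
    · by_cases hpr : p ∣ r
      · exact Or.inl (Nat.mem_primeFactors.2 ⟨(mem_primesBetween.1 h).1, hpr, hr⟩)
      · exact Or.inr (Or.inr (Finset.mem_filter.2 ⟨h, hpr⟩))
    · exact Or.inl h
  · rintro (h | h | h)
    · exact Or.inr h
    · exact Or.inl (Or.inl (Finset.mem_filter.1 h).1)
    · exact Or.inl (Or.inr (Finset.mem_filter.1 h).1)

end

lemma exists_eq_mul_one_add {u v c : ℝ} (hc : 0 ≤ c) (h : |u - v| ≤ c * v) :
    ∃ t, |t| ≤ c ∧ u = v * (1 + t) := by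
  rcases eq_or_ne v 0 with rfl | hv
  · refine ⟨0, by simpa using hc, ?_⟩
    rw [mul_zero, sub_zero] at h
    rw [zero_mul]
    exact abs_nonpos_iff.1 h
  · refine ⟨(u - v) / v, ?_, ?_⟩
    · rw [abs_div, div_le_iff₀ (abs_pos.2 hv)]
      exact h.trans (mul_le_mul_of_nonneg_left (le_abs_self v) hc)
    · field_simp
      ring

lemma abs_sum_baseWeight_le {r : ℕ} {P D : ℝ} (hP : 2 ≤ P) (hD : P ^ 202 < D)
    {S : Fin 4 → Set ℕ} (hS : ∀ i h, h ∈ S i ∨ h + 1 ∈ S i) (m : ℤ) {X : ℝ} (hX : 0 ≤ X)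
    (R : ZMod r → Prop) :
    |∑ n ∈ Finset.Icc 1 ⌊X⌋₊, baseWeight r m R n *
      ∏ i, sieveSum (betaSieveSet (S i) 200 D) (mediumPrimes r P) (sieveForm m n i)| ≤
      X * D ^ 4 := by
  have hcard : ∀ i, ((sieveSupport (betaSieveSet (S i) 200 D) (mediumPrimes r P)).card : ℝ) ≤ D :=
    fun i => card_sieveSupport_le (hS i) hP hD fun p hp =>
      ⟨(mem_mediumPrimes hp).1, (mem_mediumPrimes hp).2.2.2⟩
  refine (Finset.abs_sum_le_sum_abs _ _).trans ?_
  have hle : ∀ n ∈ Finset.Icc 1 ⌊X⌋₊, |baseWeight r m R n *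
      ∏ i, sieveSum (betaSieveSet (S i) 200 D) (mediumPrimes r P) (sieveForm m n i)| ≤ D ^ 4 :=
    fun n _ => by
      obtain ⟨h0, h1⟩ := baseWeight_mem_Icc r m R n
      rw [abs_mul, abs_of_nonneg h0, Finset.abs_prod]
      refine (mul_le_of_le_one_left (Finset.prod_nonneg fun _ _ => abs_nonneg _) h1).trans ?_
      calc _ ≤ ∏ _i : Fin 4, D := Finset.prod_le_prod (fun _ _ => abs_nonneg _)
            fun i _ => (abs_sieveSum_le_card _ _ _).trans (hcard i)
        _ = D ^ 4 := Fin.prod_const 4 D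
  refine (Finset.sum_le_sum hle).trans ?_
  rw [Finset.sum_const, Nat.card_Icc, Nat.add_sub_cancel, nsmul_eq_mul]
  exact mul_le_mul_of_nonneg_right (Nat.floor_le hX) (by positivity)

/-- The sum over an interval is a multiple of the length, up to a small relative error and a small
absolute error. -/
lemma exists_sum_baseWeight_eq : ∃ C : ℝ, 0 < C ∧
    ∀ (r : ℕ) [NeZero r] (P D : ℝ), 2 ≤ P → P ^ 202 < D → ∀ (S : Fin 4 → Set ℕ),
      (∀ i, ∀ h ∈ S i, 2 ≤ h → h - 2 ∈ S i) → (∀ i h, h ∈ S i ∨ h + 1 ∈ S i) →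
      ∀ (m : ℤ) (X : ℝ), 0 ≤ X → ∀ (R : ZMod r → Prop),
      ∃ t E : ℝ, |t| ≤ C * Real.exp (-(Real.log D / (10 * Real.log P))) ∧ |E| ≤ 24 * r * D ^ 4 ∧
        ∑ n ∈ Finset.Icc 1 ⌊X⌋₊, baseWeight r m R n *
          ∏ i, sieveSum (betaSieveSet (S i) 200 D) (mediumPrimes r P) (sieveForm m n i) =
        X * (siftedCountOf m R / r) * (∏ p ∈ smallPrimes r, (freeCount m p : ℝ) / p) *
          (∏ p ∈ mediumPrimes r P, (freeCount m p : ℝ) / p) * (1 + t) + E := by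
  obtain ⟨C, hC, hmain⟩ := exists_abs_sum_prod_sieveSum_sub_le
  refine ⟨C, hC, fun r _ P D hP hD S hS hS' m X hX R => ?_⟩
  have hr : 0 < r := Nat.pos_of_ne_zero (NeZero.ne r)
  set M := r * ∏ p ∈ smallPrimes r, p with hM
  have hMpos : 0 < M := Nat.mul_pos hr (Finset.prod_pos fun p hp => (mem_smallPrimes hp).1.pos)
  have hprime : ∀ p ∈ mediumPrimes r P, p.Prime := fun p hp => (mem_mediumPrimes hp).1
  have hcop : ∀ p ∈ mediumPrimes r P, Nat.Coprime M p := fun p hp => by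
    obtain ⟨h1, h2, h3, -⟩ := mem_mediumPrimes hp
    refine Nat.Coprime.mul_left ((Nat.Prime.coprime_iff_not_dvd h1).2 h2).symm ?_
    refine Nat.Coprime.prod_left fun q hq => ?_
    obtain ⟨hq1, -, hq2⟩ := mem_smallPrimes hq
    exact (Nat.coprime_primes hq1 h1).2 (by omega)
  have h1 := hmain S hS P D hP hD m (mediumPrimes r P)
    (fun p hp => ⟨(mem_mediumPrimes hp).1, (mem_mediumPrimes hp).2.2⟩) M hcop
    (baseWeight r m R) (periodic_baseWeight m R) (fun n => (baseWeight_mem_Icc r m R n).1)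
  have h2 := abs_sum_Icc_sub_sum_range_le hMpos (periodic_baseWeight m R)
    (fun n => baseWeight_mem_Icc r m R n) (fun i => betaSieveSet (S i) 200 D) hprime m hX
  obtain ⟨t, ht, heq⟩ := exists_eq_mul_one_add (by positivity) h1
  refine ⟨t, _, ht, ?_, (add_sub_cancel _ _).symm⟩
  rw [heq, sum_range_baseWeight] at h2
  have hmaineq : X / (M * ∏ p ∈ mediumPrimes r P, p : ℕ) *
      (siftedCountOf m R * (∏ p ∈ smallPrimes r, (freeCount m p : ℝ)) *
        (∏ p ∈ mediumPrimes r P, (freeCount m p : ℝ)) * (1 + t)) =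
      X * (siftedCountOf m R / r) * (∏ p ∈ smallPrimes r, (freeCount m p : ℝ) / p) *
          (∏ p ∈ mediumPrimes r P, (freeCount m p : ℝ) / p) * (1 + t) := by
    rw [Finset.prod_div_distrib, Finset.prod_div_distrib, hM]
    push_cast
    simp only [div_eq_mul_inv, mul_inv]
    ring
  rw [hmaineq] at h2
  refine h2.trans ?_
  have hcard : ∏ i, ((sieveSupport (betaSieveSet (S i) 200 D) (mediumPrimes r P)).card : ℝ) ≤
      D ^ 4 := by
    calc _ ≤ ∏ _i : Fin 4, D := Finset.prod_le_prod (fun _ _ => Nat.cast_nonneg _)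
          fun i _ => card_sieveSupport_le (hS' i) hP hD fun p hp =>
            ⟨(mem_mediumPrimes hp).1, (mem_mediumPrimes hp).2.2.2⟩
      _ = D ^ 4 := Fin.prod_const 4 D
  -- The modulus contributes at most 6r classes and each system has error at most 4, hence the
  -- constant 24.
  have hMle : (M : ℝ) ≤ r * 6 := by
    have := Nat.mul_le_mul_left r (prod_smallPrimes_le r)
    exact_mod_cast this
  have h3 := mul_le_mul hMle hcard (Finset.prod_nonneg fun _ _ => Nat.cast_nonneg _)
    (mul_nonneg (Nat.cast_nonneg r) (by norm_num))
  refine (mul_le_mul_of_nonneg_left h3 (by norm_num)).trans (le_of_eq ?_)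
  ring

/-- The trivial bound, when the modulus is large. -/
lemma abs_siftedSum_sub_le {r : ℕ} [NeZero r] {P D C : ℝ} (hP : 2 ≤ P) (hD : P ^ 202 < D)
    {f : Fin 4 → ℕ → ℝ} (hf : ∀ i, f i = lowerPreSieve P D ∨ f i = upperPreSieve P D)
    (hC : eulerProd P ≤ C * Real.log P) {m : ℕ} (hm : m ≡ 4 [MOD 6]) (hrm : m ^ 4 ≤ r)
    {X : ℝ} (hX : 0 ≤ X) (hXm : X ≤ m) {Q : ℕ → Prop} {R : ZMod r → Prop}
    (hQ : ∀ n ≤ m, Q n ↔ IsSifted r m ((n : ℤ) : ZMod r) ∧ R ((n : ℤ) : ZMod r)) :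
    |siftedSum f Q m X -
      X * singularSeries m * (siftedCountOf (m : ℤ) R / siftedCount r m)| ≤
      (C ^ 4 + 3240) * (r * D ^ 4 * Real.log P ^ 4) := by
  obtain ⟨S, hfS, -, hS⟩ := exists_preSieve_eq hf
  have hm0 : 0 < m := Nat.pos_of_ne_zero fun h => by
    rw [h] at hm
    exact absurd hm (by decide)
  have hm1 : (1 : ℝ) ≤ m := by exact_mod_cast hm0
  have hr0 : r ≠ 0 := NeZero.ne r
  have hrm' : (m : ℝ) ^ 4 ≤ r := by exact_mod_cast hrm
  have hXr : X ≤ r := (hXm.trans (le_self_pow₀ hm1 (by norm_num))).trans hrm'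
  have hlogP : 1 / 2 ≤ Real.log P := by
    have := Real.log_le_log two_pos hP
    have := Real.log_two_gt_d9
    linarith
  have hD1 : 1 ≤ D := (one_le_pow₀ (by linarith)).trans hD.le
  have hW0 : 0 ≤ eulerProd P := zero_le_one.trans (one_le_eulerProd P)
  have hW : eulerProd P ^ 4 ≤ C ^ 4 * Real.log P ^ 4 := by
    rw [← mul_pow]
    exact pow_le_pow_left₀ hW0 hC 4
  have h1 : |siftedSum f Q m X| ≤ C ^ 4 * (r * D ^ 4 * Real.log P ^ 4) := by
    rw [siftedSum_eq hr0 hfS hX hXm hQ, abs_mul, abs_of_nonneg (pow_nonneg hW0 4)]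
    refine (mul_le_mul hW (abs_sum_baseWeight_le hP hD hS m hX R) (abs_nonneg _)
      (by positivity)).trans ?_
    rw [show C ^ 4 * (r * D ^ 4 * Real.log P ^ 4) = C ^ 4 * Real.log P ^ 4 * (r * D ^ 4) by ring]
    gcongr
  have h2 : |X * singularSeries m * (siftedCountOf (m : ℤ) R / siftedCount r m)| ≤
      3240 * (r * D ^ 4 * Real.log P ^ 4) := by
    have hS0 := (singularSeries_pos hm).le
    have hprop : (siftedCountOf (m : ℤ) R : ℝ) / siftedCount r m ≤ 1 :=
      div_le_one_of_le₀ (by exact_mod_cast siftedCountOf_le (m : ℤ) R) (Nat.cast_nonneg _)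
    rw [abs_of_nonneg (by positivity)]
    have h3 : (1 / 2) ^ 4 ≤ Real.log P ^ 4 := pow_le_pow_left₀ (by norm_num) hlogP 4
    have h4 : (1 : ℝ) ≤ D ^ 4 := one_le_pow₀ hD1
    have h5 : X * singularSeries m ≤ m * (405 / 2 * (m : ℝ) ^ 3) :=
      mul_le_mul hXm (singularSeries_le m hm0) hS0 (Nat.cast_nonneg _)
    -- The constant is 3240 = 16 · 405/2, the 16 compensating for log P being possibly as small as
    -- log 2 > 1/2.
    calc X * singularSeries m * (siftedCountOf (m : ℤ) R / siftedCount r m)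
        ≤ m * (405 / 2 * (m : ℝ) ^ 3) * 1 := mul_le_mul h5 hprop (by positivity) (by positivity)
      _ = 3240 * (m ^ 4 * 1 * (1 / 2) ^ 4) := by ring
      _ ≤ 3240 * (r * D ^ 4 * Real.log P ^ 4) := by gcongr
  refine (abs_sub _ _).trans ?_
  linarith

/-- The asymptotic formula for a condition modulo `r` which implies coprimality with `r`. -/
lemma exists_siftedSum_eq : ∃ C : ℝ, 0 < C ∧
    ∀ (r : ℕ) [NeZero r] (P D : ℝ), 2 ≤ P → P ^ 202 < D → ∀ (f : Fin 4 → ℕ → ℝ),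
      (∀ i, f i = lowerPreSieve P D ∨ f i = upperPreSieve P D) →
      ∀ (m : ℕ) (X : ℝ), 1 ≤ X → X ≤ m → ∀ (Q : ℕ → Prop) (R : ZMod r → Prop),
      (∀ n ≤ m, Q n ↔ IsSifted r m ((n : ℤ) : ZMod r) ∧ R ((n : ℤ) : ZMod r)) →
      ∃ θ E : ℝ,
        |θ| ≤ C * (Real.exp (-(Real.log D / (10 * Real.log P))) + Real.log m / P) ∧
        |E| ≤ C * (r * D ^ 4 * Real.log P ^ 4) ∧
        siftedSum f Q m X =
          X * singularSeries m * (siftedCountOf (m : ℤ) R / siftedCount r m) * (1 + θ) + E := by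
  obtain ⟨C₁, hC₁, hsum⟩ := exists_sum_baseWeight_eq
  obtain ⟨C₂, hC₂, hratio⟩ := exists_ratio_singularSeries
  obtain ⟨C₃, hC₃', heuler⟩ := exists_eulerProd_le
  have hC₃ : 0 < C₃ := by linarith
  refine ⟨C₂ + C₂ * C₁ + 24 * C₃ ^ 4 + 3240, by positivity, ?_⟩
  intro r _ P D hP hD f hf m X hX hXm Q R hQ
  have hr : 0 < r := Nat.pos_of_ne_zero (NeZero.ne r)
  have hr0 : (0 : ℝ) < r := by exact_mod_cast hr
  have hX0 : 0 ≤ X := by linarith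
  have hm1 : (1 : ℝ) ≤ m := hX.trans hXm
  have hlogm : 0 ≤ Real.log m := Real.log_nonneg hm1
  have hlogm' : 0 ≤ Real.log m / P := div_nonneg hlogm (by linarith)
  have hlogP : 1 / 2 ≤ Real.log P := by
    have := Real.log_le_log two_pos hP
    have := Real.log_two_gt_d9
    linarith
  have hD1 : 1 ≤ D := (one_le_pow₀ (by linarith)).trans hD.le
  set e := Real.exp (-(Real.log D / (10 * Real.log P))) with he
  have he0 : 0 < e := Real.exp_pos _
  set C := C₂ + C₂ * C₁ + 24 * C₃ ^ 4 + 3240 with hC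
  have hCpos : 0 < C := by positivity
  have hEpos : 0 ≤ (r : ℝ) * D ^ 4 * Real.log P ^ 4 := by positivity
  obtain ⟨S, hfS, hS, hS'⟩ := exists_preSieve_eq hf
  have hsift := siftedSum_eq hr.ne' hfS hX0 hXm hQ
  have hW1 := one_le_eulerProd P
  have hW : eulerProd P ^ 4 ≤ C₃ ^ 4 * Real.log P ^ 4 := by
    rw [← mul_pow]
    exact pow_le_pow_left₀ (by linarith) (heuler P hP) 4
  by_cases hm : m ≡ 4 [MOD 6]
  swap
  · refine ⟨0, 0, by rw [abs_zero]; positivity, by rw [abs_zero]; positivity, ?_⟩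
    have h0 : ∀ n ∈ Finset.Icc 1 ⌊X⌋₊, baseWeight r (m : ℤ) R n *
        ∏ i, sieveSum (betaSieveSet (S i) 200 D) (mediumPrimes r P) (sieveForm m n i) = 0 :=
      fun n _ => by
        classical
        rw [baseWeight_eq hr.ne', if_neg fun h => hm (modEq_four_of_freeAt h.2.1 h.2.2), zero_mul]
    rw [hsift, Finset.sum_eq_zero h0, singularSeries, if_neg hm]
    ring
  have hN0 : (0 : ℝ) < siftedCount r m := lt_of_lt_of_le (by positivity) (le_siftedCount hm)
  have hprop0 : (0 : ℝ) ≤ siftedCountOf (m : ℤ) R / siftedCount r m := by positivity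
  have hprop1 : (siftedCountOf (m : ℤ) R : ℝ) / siftedCount r m ≤ 1 :=
    div_le_one_of_le₀ (by exact_mod_cast siftedCountOf_le (m : ℤ) R) hN0.le
  -- The singular series is compared with relative error log m / P only while log r ≪ log m.
  -- Otherwise the main term is itself absorbed into the additive error, with θ = 0.
  by_cases hrm : r ≤ m ^ 4
  · obtain ⟨t, E, ht, hE, heq⟩ := hsum r P D hP hD S hS hS' m X hX0 R
    obtain ⟨ρ, hρ0, hρC, hρeq, hρ1⟩ := hratio m r P hm hr.ne' hP
    refine ⟨ρ * (1 + t) - 1, eulerProd P ^ 4 * E, ?_, ?_, ?_⟩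
    · have h1 : |ρ * (1 + t) - 1| ≤ |ρ - 1| + |ρ * t| := by
        rw [show ρ * (1 + t) - 1 = (ρ - 1) + ρ * t by ring]
        exact abs_add_le _ _
      have h2 : |ρ * t| ≤ C₂ * (C₁ * e) := by
        rw [abs_mul, abs_of_nonneg hρ0]
        exact mul_le_mul hρC ht (abs_nonneg _) hC₂.le
      have h3 := hρ1 hrm
      have h4 : C₂ * (Real.log m / P) ≤ C * (Real.log m / P) :=
        mul_le_mul_of_nonneg_right (by rw [hC]; nlinarith [pow_pos hC₃ 4, mul_pos hC₂ hC₁]) hlogm'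
      have h5 : C₂ * C₁ * e ≤ C * e :=
        mul_le_mul_of_nonneg_right (by rw [hC]; nlinarith [pow_pos hC₃ 4, mul_pos hC₂ hC₁]) he0.le
      linarith
    · rw [abs_mul, abs_of_nonneg (by positivity)]
      calc eulerProd P ^ 4 * |E| ≤ (C₃ ^ 4 * Real.log P ^ 4) * (24 * r * D ^ 4) := by gcongr
        _ = 24 * C₃ ^ 4 * (r * D ^ 4 * Real.log P ^ 4) := by ring
        _ ≤ C * (r * D ^ 4 * Real.log P ^ 4) := by
          refine mul_le_mul_of_nonneg_right ?_ hEpos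
          rw [hC]
          nlinarith [pow_pos hC₃ 4, mul_pos hC₂ hC₁]
    · rw [prod_localPrimes_eq] at hρeq
      have hNeq := siftedCount_eq (r := r) (m : ℤ)
      have hNr : ∏ p ∈ r.primeFactors, (freeCount (m : ℤ) p : ℝ) / p = siftedCount r m / r := by
        rw [hNeq]
        field_simp
      rw [hNr] at hρeq
      rw [hsift, heq]
      -- The density of sifted classes modulo r supplies the local factors at the primes dividing r,
      -- completing the product over all local primes.
      have : X * singularSeries m * (siftedCountOf (m : ℤ) R / siftedCount r m) *
          (1 + (ρ * (1 + t) - 1)) =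
          X * (siftedCountOf (m : ℤ) R / siftedCount r m) * (1 + t) * (ρ * singularSeries m) := by
        ring
      rw [this, ← hρeq]
      field_simp
  · refine ⟨0, _, ?_, (abs_siftedSum_sub_le hP hD hf (heuler P hP) hm (not_le.1 hrm).le hX0 hXm
      hQ).trans ?_, by ring⟩
    · rw [abs_zero]
      positivity
    · refine mul_le_mul_of_nonneg_right ?_ hEpos
      rw [hC]
      nlinarith [pow_pos hC₃ 4, mul_pos hC₂ hC₁]

/-! ### Conclusion -/

/-- The bound `A ^ ω(r) ≪ r ^ ε`. -/
lemma pow_card_primeFactors_le {A ε : ℝ} (hA : 1 ≤ A) (hε : 0 < ε) {r : ℕ} (hr : r ≠ 0) :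
    A ^ r.primeFactors.card ≤ A ^ ⌈A ^ (1 / ε)⌉₊ * (r : ℝ) ^ ε := by
  classical
  -- The primes below A^{1/ε} are bounded in number, independently of r. For every other prime the
  -- factor A is at most p^ε.
  set s := r.primeFactors.filter (fun p : ℕ => (p : ℝ) ^ ε < A) with hs
  set t := r.primeFactors.filter (fun p : ℕ => ¬ (p : ℝ) ^ ε < A) with ht
  have hA0 : 0 ≤ A := by linarith
  have h1 : s.card ≤ ⌈A ^ (1 / ε)⌉₊ := by
    rw [← Finset.card_range ⌈A ^ (1 / ε)⌉₊]
    refine Finset.card_le_card fun p hp => Finset.mem_range.2 (Nat.lt_ceil.2 ?_)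
    have h2 := (Finset.mem_filter.1 hp).2
    rw [one_div]
    exact (Real.lt_rpow_inv_iff_of_pos (Nat.cast_nonneg _) hA0 hε).2 h2
  have h2 : A ^ t.card ≤ (r : ℝ) ^ ε := by
    calc A ^ t.card = ∏ _p ∈ t, A := by rw [Finset.prod_const]
      _ ≤ ∏ p ∈ t, (p : ℝ) ^ ε := Finset.prod_le_prod (fun _ _ => hA0)
          fun p hp => not_lt.1 (Finset.mem_filter.1 hp).2
      _ = (∏ p ∈ t, (p : ℝ)) ^ ε :=
          Real.finsetProd_rpow t (fun p => (p : ℝ)) (fun _ _ => Nat.cast_nonneg _) ε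
      _ ≤ (r : ℝ) ^ ε := by
        refine Real.rpow_le_rpow (Finset.prod_nonneg fun _ _ => Nat.cast_nonneg _) ?_ hε.le
        have : ∏ p ∈ t, p ∣ r := (Finset.prod_dvd_prod_of_subset _ _ _
          (Finset.filter_subset _ _)).trans (Nat.prod_primeFactors_dvd r)
        have := Nat.le_of_dvd (Nat.pos_of_ne_zero hr) this
        rw [← Nat.cast_prod]
        exact_mod_cast this
  have h3 : r.primeFactors.card = s.card + t.card :=
    (Finset.card_filter_add_card_filter_not _).symm
  rw [h3, pow_add]
  exact mul_le_mul (pow_le_pow_right₀ hA h1) h2 (by positivity) (by positivity)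

lemma coprime_iff_forall_not_dvd {k r : ℕ} (hr : r ≠ 0) :
    Nat.Coprime k r ↔ ∀ p ∈ r.primeFactors, ¬ (p : ℤ) ∣ (k : ℤ) := by
  simp only [Int.natCast_dvd_natCast]
  constructor
  · intro h p hp hpk
    exact Nat.not_coprime_of_dvd_of_dvd (Nat.prime_of_mem_primeFactors hp).one_lt hpk
      (Nat.dvd_of_mem_primeFactors hp) h
  · exact fun h => Nat.coprime_of_dvd fun p hp hpk hpr =>
      h p (Nat.mem_primeFactors.2 ⟨hp, hpr, hr⟩) hpk

lemma isSifted_natCast_iff {r : ℕ} (hr : r ≠ 0) {m n : ℕ} (hnm : n ≤ m) :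
    IsSifted r m ((n : ℤ) : ZMod r) ↔ Nat.Coprime n r ∧ Nat.Coprime (n + 2) r ∧
      Nat.Coprime (m - n) r ∧ Nat.Coprime (m - n + 2) r := by
  simp only [coprime_iff_forall_not_dvd hr, isSifted_intCast]
  push_cast [hnm]
  rw [← forall₂_and, ← forall₂_and, ← forall₂_and]
  exact forall₂_congr fun p _ => forall_sieveForm (Q := fun k => ¬ (p : ℤ) ∣ k)

lemma coprime_of_apply_ne_zero {r : ℕ} {χ : DirichletCharacter ℂ r} {k : ℕ}
    (h : χ (k : ZMod r) ≠ 0) : Nat.Coprime k r := by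
  by_contra hk
  exact h (χ.map_nonunit fun h => hk ((ZMod.isUnit_iff_coprime k r).1 h))

/-- The proportion g is close to its model c only when the singular series s is nonzero. When s
vanishes the main term is zero and η = 0 is admissible. -/
lemma exists_complex_form {X s g θ E F A B : ℝ} {c : ℂ} {δ : ℝ → ℝ}
    (hF : F = X * s * g * (1 + θ) + E) (hθ : |θ| ≤ A) (hE : |E| ≤ B)
    (hδ : ∀ ε, 0 < ε → 0 ≤ δ ε) (hg : s ≠ 0 → ∀ ε, 0 < ε → ‖(g : ℂ) - c‖ ≤ δ ε) :
    ∃ η θ E : ℂ, (∀ ε : ℝ, 0 < ε → ‖η‖ ≤ δ ε) ∧ ‖θ‖ ≤ A ∧ ‖E‖ ≤ B ∧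
      (F : ℂ) = X * s * (c + η) * (1 + θ) + E := by
  have hθ' : ‖(θ : ℂ)‖ ≤ A := by rwa [Complex.norm_real]
  have hE' : ‖(E : ℂ)‖ ≤ B := by rwa [Complex.norm_real]
  by_cases hs : s = 0
  · refine ⟨0, θ, E, fun ε hε => by rw [norm_zero]; exact hδ ε hε, hθ', hE', ?_⟩
    rw [hF, hs]
    push_cast
    ring
  · refine ⟨g - c, θ, E, hg hs, hθ', hE', ?_⟩
    rw [hF]
    push_cast
    ring

theorem proposition6p8 :
    ∃ (C : ℝ) (K : ℝ → ℝ),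
      ∀ (r : ℕ) (_ : 3 ≤ r) (χ : DirichletCharacter ℂ r) (_ : χ.IsPrimitive) (_ : χ.IsQuadratic),
        ∃ σ₁ σ₂ : ℕ → ℂ, (∀ m, ‖σ₁ m‖ ≤ 1) ∧ (∀ m, ‖σ₂ m‖ ≤ 1) ∧
          ∀ (P₁ D₁ : ℝ) (_ : 2 ≤ P₁) (_ : P₁ ^ 202 < D₁)
            (f : Fin 4 → ℕ → ℝ)
            (_ : ∀ i, f i = lowerPreSieve P₁ D₁ ∨ f i = upperPreSieve P₁ D₁)
            (m : ℕ) (X : ℝ) (_ : 1 ≤ X) (_ : X ≤ m),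
            (∃ η θ E : ℂ,
              (∀ ε : ℝ, 0 < ε → ‖η‖ ≤ K ε * (r : ℝ) ^ (-1 + ε)) ∧
              ‖θ‖ ≤ C * (Real.exp (-(Real.log D₁ / (10 * Real.log P₁))) + Real.log m / P₁) ∧
              ‖E‖ ≤ C * (r * D₁ ^ 4 * Real.log P₁ ^ 4) ∧
              (siftedSum f
                  (fun n => χ (n : ZMod r) = -1 ∧ χ ((m - n : ℕ) : ZMod r) = -1 ∧
                    Nat.Coprime (n + 2) r ∧ Nat.Coprime (m - n + 2) r) m X : ℂ) =
                X * singularSeries m * ((1 + σ₁ m) / 4 + η) * (1 + θ) + E) ∧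
            (∃ η θ E : ℂ,
              (∀ ε : ℝ, 0 < ε → ‖η‖ ≤ K ε * (r : ℝ) ^ (-(1 / 2 : ℝ) + ε)) ∧
              ‖θ‖ ≤ C * (Real.exp (-(Real.log D₁ / (10 * Real.log P₁))) + Real.log m / P₁) ∧
              ‖E‖ ≤ C * (r * D₁ ^ 4 * Real.log P₁ ^ 4) ∧
              (siftedSum f
                  (fun n => χ (n : ZMod r) = 1 ∧ χ ((n + 2 : ℕ) : ZMod r) = 1 ∧
                    χ ((m - n : ℕ) : ZMod r) = -1 ∧ Nat.Coprime (m - n + 2) r) m X : ℂ) =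
                X * singularSeries m * ((1 - σ₁ m - σ₂ m) / 8 + η) * (1 + θ) + E) := by
  classical
  obtain ⟨C, -, hmain⟩ := exists_siftedSum_eq
  -- This constant comes from bounding 4 · 20^ω(r) / r by the divisor-type estimate with A = 20.
  refine ⟨C, fun ε => 4 * 20 ^ ⌈(20 : ℝ) ^ (1 / ε)⌉₊, fun r hr3 χ hχ hq => ?_⟩
  have hr : r ≠ 0 := by omega
  have : NeZero r := ⟨hr⟩
  have hr1 : (1 : ℝ) ≤ r := by exact_mod_cast (by omega : 1 ≤ r)
  have hr0 : (0 : ℝ) < r := by linarith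
  obtain ⟨σ₁, σ₂, hσ₁, hσ₂, happrox⟩ := exists_siftedCharSum_approx hχ hq
  refine ⟨σ₁, σ₂, hσ₁, hσ₂, fun P D hP hD f hf m X hX hXm => ?_⟩
  have hbound : ∀ ε : ℝ, 0 < ε → 4 * (20 : ℝ) ^ r.primeFactors.card / r ≤
      4 * 20 ^ ⌈(20 : ℝ) ^ (1 / ε)⌉₊ * (r : ℝ) ^ (-1 + ε) := fun ε hε => by
    have h1 := pow_card_primeFactors_le (A := 20) (by norm_num) hε hr
    rw [Real.rpow_add hr0, Real.rpow_neg_one, div_eq_mul_inv]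
    have h2 := mul_le_mul_of_nonneg_right h1 (inv_nonneg.2 hr0.le)
    linarith
  have hbound' : ∀ ε : ℝ, 0 < ε → 4 * (20 : ℝ) ^ r.primeFactors.card / r ≤
      4 * 20 ^ ⌈(20 : ℝ) ^ (1 / ε)⌉₊ * (r : ℝ) ^ (-(1 / 2 : ℝ) + ε) := fun ε hε => by
    -- The second proportion in fact has the error r^{-1+ε} too, as the cubic sum sits inside σ₂.
    -- The weaker exponent follows from r ≥ 1.
    refine (hbound ε hε).trans (mul_le_mul_of_nonneg_left ?_ (by positivity))
    exact Real.rpow_le_rpow_of_exponent_le hr1 (by linarith)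
  have hm : singularSeries m ≠ 0 → m ≡ 4 [MOD 6] := fun h => by
    by_contra hm
    exact h (if_neg hm)
  have hcast : ∀ n ≤ m, ((m : ℤ) : ZMod r) - ((n : ℤ) : ZMod r) = ((m - n : ℕ) : ZMod r) :=
    fun n hn => by
      push_cast [hn]
      rfl
  have hne : (1 : ℂ) ≠ 0 := one_ne_zero
  have hne' : (-1 : ℂ) ≠ 0 := neg_ne_zero.2 hne
  constructor
  · obtain ⟨θ, E, hθ, hE, heq⟩ := hmain r P D hP hD f hf m X hX hXm
      (fun n => χ (n : ZMod r) = -1 ∧ χ ((m - n : ℕ) : ZMod r) = -1 ∧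
        Nat.Coprime (n + 2) r ∧ Nat.Coprime (m - n + 2) r)
      (fun x => χ x = -1 ∧ χ (((m : ℤ) : ZMod r) - x) = -1) fun n hn => by
        rw [isSifted_natCast_iff hr hn, hcast n hn, Int.cast_natCast]
        constructor
        · rintro ⟨h1, h2, h3, h4⟩
          exact ⟨⟨coprime_of_apply_ne_zero (by rwa [h1]), h3,
            coprime_of_apply_ne_zero (by rwa [h2]), h4⟩, h1, h2⟩
        · rintro ⟨⟨-, h3, -, h4⟩, h1, h2⟩
          exact ⟨h1, h2, h3, h4⟩
    refine exists_complex_form heq hθ hE (fun ε _ => by positivity) fun hs ε hε => ?_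
    refine le_trans ?_ (hbound ε hε)
    have := (happrox m (hm hs)).1
    rw [siftedCharSum_indicator (m : ℤ)
      (fun x : ZMod r => χ x = -1 ∧ χ (((m : ℤ) : ZMod r) - x) = -1)] at this
    rw [Complex.ofReal_div, Complex.ofReal_natCast, Complex.ofReal_natCast]
    exact this
  · obtain ⟨θ, E, hθ, hE, heq⟩ := hmain r P D hP hD f hf m X hX hXm
      (fun n => χ (n : ZMod r) = 1 ∧ χ ((n + 2 : ℕ) : ZMod r) = 1 ∧
        χ ((m - n : ℕ) : ZMod r) = -1 ∧ Nat.Coprime (m - n + 2) r)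
      (fun x => χ x = 1 ∧ χ (x + 2) = 1 ∧ χ (((m : ℤ) : ZMod r) - x) = -1) fun n hn => by
        have h2 : ((n : ZMod r) + 2) = ((n + 2 : ℕ) : ZMod r) := by
          push_cast
          rfl
        rw [isSifted_natCast_iff hr hn, hcast n hn, Int.cast_natCast, h2]
        constructor
        · rintro ⟨h1, h2, h3, h4⟩
          exact ⟨⟨coprime_of_apply_ne_zero (by rwa [h1]), coprime_of_apply_ne_zero (by rwa [h2]),
            coprime_of_apply_ne_zero (by rwa [h3]), h4⟩, h1, h2, h3⟩
        · rintro ⟨⟨-, -, -, h4⟩, h1, h2, h3⟩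
          exact ⟨h1, h2, h3, h4⟩
    refine exists_complex_form heq hθ hE (fun ε _ => by positivity) fun hs ε hε => ?_
    refine le_trans ?_ (hbound' ε hε)
    have := (happrox m (hm hs)).2
    rw [siftedCharSum_indicator (m : ℤ) (fun x : ZMod r => χ x = 1 ∧ χ (x + 2) = 1 ∧
      χ (((m : ℤ) : ZMod r) - x) = -1)] at this
    rw [Complex.ofReal_div, Complex.ofReal_natCast, Complex.ofReal_natCast]
    exact this
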